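/- An oriented virtual link diagram is a finite (possibly empty) collection of oriented closed polygons in general position in the plane, each of whose double points is marked either as a classical crossing (one branch over, the other under) or as a virtual crossing (no over/under information). Two diagrams are virtually isotopic if they are related by a finite sequence of augmented Reidemeister moves: planar isotopy, the three classical Reidemeister moves, the three virtual Reidemeister moves (the same moves with virtual crossings only), and the special detour move, in which an arc with two consecutive virtual crossings is moved across a classical crossing. A virtual braid on $n$ strands is a diagram, in general position, of $n$ strands running strictly downwards from $n$ points on a horizontal line to the $n$ points vertically below them on a lower line, in some order, whose crossings are classical or virtual. Its closure is the diagram obtained by joining, for each $j$, the $j$-th bottom end point to the $j$-th top end point by a simple arc around the braid, these arcs being disjoint from each other and not crossing the braid. **Theorem 1.** For every oriented virtual link diagram $D$ there are an integer $n\ge 0$ and a virtual braid $\beta$ on $n$ strands such that $D$ is virtually isotopic to the closure of $\beta$. -/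

import Mathlib

/-! Oriented virtual link diagrams are taken in the piecewise linear category: finitely many oriented
closed polygons in general position in the plane, each double point being a classical crossing (one
of the two branches is the over branch) or a virtual crossing (no over/under information). -/

namespace VirtualLink

/-- The plane; the second coordinate is the height. -/
abbrev Plane : Type := ℝ × ℝ

/-- An oriented straight edge, from the first point to the second one. -/
abbrev Edge : Type := Plane × Plane

/-- The closed segment carried by an edge. -/
def seg (e : Edge) : Set Plane := segment ℝ e.1 e.2

/-- The segment carried by an edge, without its end points. -/
def openSeg (e : Edge) : Set Plane := openSegment ℝ e.1 e.2

/-- Two edges cross: they have a common point that is interior to both. (For two different edges of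
a system in general position this is a single, transversal double point.) -/
def Crosses (e f : Edge) : Prop := (openSeg e ∩ openSeg f).Nonempty

/-- A system of oriented edges together with crossing information: `isOver e f` says that `e` and `f`
meet in a classical crossing, at which `e` is the over branch. Two crossing edges none of which is
over the other meet in a virtual crossing. -/
@[ext]
structure Drawing where
  edges : Set Edge
  isOver : Edge → Edge → Prop

/-- `e` and `f` do not form a classical crossing; if they cross, the crossing is virtual. -/
def Drawing.NotClassical (D : Drawing) (e f : Edge) : Prop := ¬ D.isOver e f ∧ ¬ D.isOver f e

/-- General position: finitely many non-degenerate edges, no two opposite ones, no vertex on an edge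
that does not end there, no triple points; crossing information exactly at crossings, and at most one
of the two branches is over the other. -/
structure Drawing.Generic (D : Drawing) : Prop where
  finite : D.edges.Finite
  ne : ∀ e ∈ D.edges, e.1 ≠ e.2
  not_opposite : ∀ e ∈ D.edges, (e.2, e.1) ∉ D.edges
  vertex : ∀ e ∈ D.edges, ∀ f ∈ D.edges, ∀ v : Plane, (v = f.1 ∨ v = f.2) → v ∈ seg e →
    v = e.1 ∨ v = e.2
  no_triple : ∀ e ∈ D.edges, ∀ f ∈ D.edges, ∀ g ∈ D.edges, e ≠ f → f ≠ g → e ≠ g →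
    openSeg e ∩ openSeg f ∩ openSeg g = ∅
  isOver_spec : ∀ e f : Edge, D.isOver e f →
    e ∈ D.edges ∧ f ∈ D.edges ∧ e ≠ f ∧ Crosses e f ∧ ¬ D.isOver f e

/-- Oriented virtual link diagrams: drawings in general position whose edges form closed oriented
polygons, that is, at every vertex exactly one edge ends and exactly one edge starts. -/
structure Drawing.IsLinkDiagram (D : Drawing) : Prop where
  generic : D.Generic
  next : ∀ e ∈ D.edges, ∃! w : Plane, (e.2, w) ∈ D.edges
  prev : ∀ e ∈ D.edges, ∃! w : Plane, (w, e.1) ∈ D.edges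

/-! ### Virtual isotopy

All moves have the following form: an edge `a → b` is replaced by the two edges `a → c → b`, nothing
else being changed. They differ by what the closed triangle `a c b` contains. -/

/-- The closed triangle with corners `a`, `b`, `c`; it is a segment if `c` lies between `a`, `b`. -/
def triangle (a b c : Plane) : Set Plane := convexHull ℝ {a, b, c}

/-- The edges that are left in place when the edge `a → b` is replaced. -/
def Drawing.rest (D : Drawing) (a b : Plane) : Set Edge := D.edges \ {(a, b)}

/-- The diagram `D'` is obtained from the diagram `D` by replacing the edge `a → b` by `a → c → b`;
the crossings among the other edges are kept. -/
structure Replaces (D D' : Drawing) (a b c : Plane) : Prop where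
  source : D.IsLinkDiagram
  target : D'.IsLinkDiagram
  mem : (a, b) ∈ D.edges
  edges_eq : D'.edges = D.rest a b ∪ {(a, c), (c, b)}
  isOver_iff : ∀ e ∈ D.rest a b, ∀ f ∈ D.rest a b, (D'.isOver e f ↔ D.isOver e f)

/-- The edge `f` is disjoint from the triangle, except that it may be attached to `a` or `b`. -/
def Avoids (a b c : Plane) (f : Edge) : Prop := ∀ p ∈ seg f, p ∈ triangle a b c → p = a ∨ p = b

/-- The edge `f` runs straight through the triangle, entering through the old edge `a → b` and leaving
through one of the new edges; its crossing is of the same type before and after the move. -/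
structure PassesThrough (D D' : Drawing) (a b c : Plane) (f : Edge) : Prop where
  old : Crosses f (a, b)
  new : Xor (Crosses f (a, c)) (Crosses f (c, b))
  type_eq : ∀ g : Edge, g = (a, c) ∨ g = (c, b) → Crosses f g →
    (D'.isOver g f ↔ D.isOver (a, b) f) ∧ (D'.isOver f g ↔ D.isOver f (a, b))

/-- The edges `f` and `g` cross inside the triangle. -/
def CrossInside (a b c : Plane) (f g : Edge) : Prop :=
  (openSeg f ∩ openSeg g ∩ triangle a b c).Nonempty

/-- Planar isotopy: the triangle contains only edges that run straight through it without crossing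
each other there. -/
def PlanarIsotopy (D D' : Drawing) : Prop :=
  ∃ a b c : Plane, Replaces D D' a b c ∧
    (∀ f ∈ D.rest a b, Avoids a b c f ∨ PassesThrough D D' a b c f) ∧
    (∀ f ∈ D.rest a b, ∀ g ∈ D.rest a b, f ≠ g → ¬ CrossInside a b c f g)

/-- First Reidemeister move, classical or virtual: the only other content of the triangle is the
preceding (or following) edge `h`, which starts from the corner `a` (or `b`) and leaves the triangle
through the opposite new edge. The new crossing may be of any type. -/
def ReidemeisterOne (D D' : Drawing) : Prop :=
  ∃ (a b c : Plane) (h : Edge), Replaces D D' a b c ∧ h ∈ D.rest a b ∧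
    ((h.2 = a ∧ Crosses h (c, b)) ∨ (h.1 = b ∧ Crosses h (a, c))) ∧
    (∀ f ∈ D.rest a b, f ≠ h → Avoids a b c f ∨ PassesThrough D D' a b c f) ∧
    (∀ f ∈ D.rest a b, ∀ g ∈ D.rest a b, f ≠ g → ¬ CrossInside a b c f g)

/-- Second Reidemeister move, classical or virtual: the only other content of the triangle is an edge
`h` that cuts off the corner `c`. The two new crossings are both virtual, or `h` is over at both of
them, or `h` is under at both of them. -/
def ReidemeisterTwo (D D' : Drawing) : Prop :=
  ∃ (a b c : Plane) (h : Edge), Replaces D D' a b c ∧ h ∈ D.rest a b ∧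
    Crosses h (a, c) ∧ Crosses h (c, b) ∧
    (D'.isOver (a, c) h ↔ D'.isOver (c, b) h) ∧ (D'.isOver h (a, c) ↔ D'.isOver h (c, b)) ∧
    (∀ f ∈ D.rest a b, f ≠ h → Avoids a b c f ∨ PassesThrough D D' a b c f) ∧
    (∀ f ∈ D.rest a b, ∀ g ∈ D.rest a b, f ≠ g → ¬ CrossInside a b c f g)

/-- The admissible types of three mutually crossing edges in a third Reidemeister move: either one
edge `x` crosses both others virtually (the crossing of the others is arbitrary), or all three
crossings are classical and there are a top, a middle and a bottom edge. Two classical crossings and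
one virtual crossing (the forbidden moves) are not admissible. -/
def Drawing.AdmissibleTriple (D : Drawing) (e f g : Edge) : Prop :=
  ∃ x y z : Edge, [x, y, z].Perm [e, f, g] ∧
    ((D.NotClassical x y ∧ D.NotClassical x z) ∨ (D.isOver x y ∧ D.isOver x z ∧ D.isOver y z))

/-- Third Reidemeister move, classical, virtual or mixed: the moving edge passes over the crossing of
two edges `h`, `k` that run straight through the triangle, the only crossing there. -/
def ReidemeisterThree (D D' : Drawing) : Prop :=
  ∃ (a b c : Plane) (h k : Edge), Replaces D D' a b c ∧
    h ∈ D.rest a b ∧ k ∈ D.rest a b ∧ h ≠ k ∧ CrossInside a b c h k ∧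
    D.AdmissibleTriple (a, b) h k ∧
    (∀ f ∈ D.rest a b, Avoids a b c f ∨ PassesThrough D D' a b c f) ∧
    (∀ f ∈ D.rest a b, ∀ g ∈ D.rest a b, f ≠ g → CrossInside a b c f g →
      (f = h ∧ g = k) ∨ (f = k ∧ g = h))

/-- The augmented Reidemeister moves. -/
def AugmentedMove (D D' : Drawing) : Prop :=
  PlanarIsotopy D D' ∨ ReidemeisterOne D D' ∨ ReidemeisterTwo D D' ∨ ReidemeisterThree D D'

/-- Virtual isotopy: the equivalence relation generated by the augmented Reidemeister moves. -/
def VirtuallyIsotopic : Drawing → Drawing → Prop := Relation.EqvGen AugmentedMove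

/-! ### Virtual braids and their closures -/

/-- A drawing with a choice of `n` abscissae `x 0 < ⋯ < x (n - 1)` for the end points of the strands,
two heights `bot`, `top`, and a number `right` that bounds the picture on the right. -/
structure BraidDrawing (n : ℕ) extends Drawing where
  x : Fin n → ℝ
  bot : ℝ
  top : ℝ
  right : ℝ

/-- Virtual braids on `n` strands: drawings in general position, between the heights `bot` and `top`,
of `n` strands that run strictly downwards from the points `(x j, top)` to the points `(x i, bot)`, in
some order, with classical and virtual crossings. -/
structure BraidDrawing.IsVirtualBraid {n : ℕ} (β : BraidDrawing n) : Prop where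
  generic : β.toDrawing.Generic
  strictMono : StrictMono β.x
  bot_lt_top : β.bot < β.top
  down : ∀ e ∈ β.edges, e.2.2 < e.1.2
  height : ∀ e ∈ β.edges, e.1.2 ≤ β.top ∧ β.bot ≤ e.2.2
  lt_right : ∀ e ∈ β.edges, e.1.1 < β.right ∧ e.2.1 < β.right
  start : ∀ j : Fin n, ∃! w : Plane, ((β.x j, β.top), w) ∈ β.edges
  finish : ∀ j : Fin n, ∃! w : Plane, (w, (β.x j, β.bot)) ∈ β.edges
  next : ∀ e ∈ β.edges, (∃! w : Plane, (e.2, w) ∈ β.edges) ∨ ∃ j : Fin n, e.2 = (β.x j, β.bot)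
  prev : ∀ e ∈ β.edges, (∃! w : Plane, (w, e.1) ∈ β.edges) ∨ ∃ j : Fin n, e.1 = (β.x j, β.top)

/-- The distance at which the `j`-th closing arc runs around the braid (the last arc is innermost). -/
def closingOffset {n : ℕ} (j : Fin n) : ℝ := (n : ℝ) - (j : ℝ)

/-- The corners of the simple arc that joins the `j`-th bottom end point of the braid to its `j`-th top
end point, around the right side of the braid. -/
def BraidDrawing.closingCorner {n : ℕ} (β : BraidDrawing n) (j : Fin n) : Fin 6 → Plane :=
  ![(β.x j, β.bot), (β.x j, β.bot - closingOffset j),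
    (β.right + closingOffset j, β.bot - closingOffset j),
    (β.right + closingOffset j, β.top + closingOffset j),
    (β.x j, β.top + closingOffset j), (β.x j, β.top)]

/-- The closure of a virtual braid: the corresponding end points are joined by simple arcs, which are
disjoint from each other and do not cross the braid. -/
def BraidDrawing.closure {n : ℕ} (β : BraidDrawing n) : Drawing where
  edges := β.edges ∪
    {e | ∃ (j : Fin n) (i : Fin 5),
      e = (β.closingCorner j i.castSucc, β.closingCorner j i.succ)}
  isOver := β.isOver

end VirtualLink

/-! # Every virtual link diagram is virtually isotopic to the closure of a virtual braid

The argument is the detour argument: an arc whose crossings are all virtual may be moved freely, so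
only the classical crossings restrict what can be done to a diagram.

A drawing is written as `draw S L`, where `S` is its set of edges and `L` a set of markers, one for
each classical crossing: the position of the crossing and the direction of its over branch
(`exists_markers`). As long as no move touches a marked point, the moves change `S` only; `VI L S T`
says that `draw S L` and `draw T L` are virtually isotopic. An edge is `Free` if no marked point
lies in its interior.

The main tool is the sweep of a free edge `p → C` across a triangle, to the path `p → q → C`
(`Frame.Sweepable.VI`). The apex `C` stays fixed while the corner of the path `p → pt t → C` runs
along the side from `p` to `q`. If the vertices, double points and marked points in the triangle lie
on different rays from `C`, the diagram changes only when the ray passes one of them. Passing a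
crossing with the side `p q` is a planar isotopy or a second virtual Reidemeister move, passing a
double point of two other edges is a third virtual Reidemeister move or a special detour move, a
first virtual move can occur at the start, and passing a vertex is reduced to these cases by cutting
off the corner there on one side of the path and restoring it on the other (`cut_corner`). The
supremum of the parameters that can be reached is `1`.

With the sweep, a point that lies on no line through two events can be inserted into any free edge
(`VI.insert_generic`). Any free edge can then be replaced by any polygonal path of free edges with
the same end points (`VI.chain`): the edge is first led through two points `C`, `C'` below
the whole picture, the vertices of the path are then inserted one after the other by sweeps with the
apex `C`, and finally the detour through `C` and `C'` is undone on the last edge of the path.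

It remains to put the diagram into the form of a closed braid. First the classical crossings are
made to descend: near a crossing one branch is turned around the other by two planar isotopies,
until it runs downwards (`exists_turned`, `exists_descending`). After that every edge that does not
run downwards is free. Each such edge `a → b` is replaced by a path that runs down from `a` to the
bottom of the picture, around its right side to the top, and down to `b`. The end points of these
strands are chosen generic (`exists_strands`), and the arcs around the braid are nested, so that all
paths together are in general position (`Layout.genPos`). By `VI.chain` the result is virtually
isotopic to the diagram (`Layout.isotopic`), and it is the closure of a virtual braid
(`Layout.closure_braid`, `Layout.isVirtualBraid`). -/

namespace VirtualLink

open Set Filter Topology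

/-! ### Edges, determinants and general position -/

/-- The determinant of two plane vectors; it vanishes exactly when they are parallel. -/
def det (u v : Plane) : ℝ := u.1 * v.2 - u.2 * v.1

theorem mem_seg {e : Edge} {z : Plane} :
    z ∈ seg e ↔ ∃ s : ℝ, 0 ≤ s ∧ s ≤ 1 ∧ z = e.1 + s • (e.2 - e.1) := by
  rw [seg, segment_eq_image']
  constructor
  · rintro ⟨s, ⟨h0, h1⟩, rfl⟩
    exact ⟨s, h0, h1, rfl⟩
  · rintro ⟨s, h0, h1, rfl⟩
    exact ⟨s, ⟨h0, h1⟩, rfl⟩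

theorem mem_openSeg {e : Edge} {z : Plane} :
    z ∈ openSeg e ↔ ∃ s : ℝ, 0 < s ∧ s < 1 ∧ z = e.1 + s • (e.2 - e.1) := by
  rw [openSeg, openSegment_eq_image']
  constructor
  · rintro ⟨s, ⟨h0, h1⟩, rfl⟩
    exact ⟨s, h0, h1, rfl⟩
  · rintro ⟨s, h0, h1, rfl⟩
    exact ⟨s, ⟨h0, h1⟩, rfl⟩

theorem openSeg_subset (e : Edge) : openSeg e ⊆ seg e := openSegment_subset_segment ℝ _ _

theorem fst_mem_seg (e : Edge) : e.1 ∈ seg e := left_mem_segment ℝ _ _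

theorem snd_mem_seg (e : Edge) : e.2 ∈ seg e := right_mem_segment ℝ _ _

theorem seg_swap (e : Edge) : seg e.swap = seg e := segment_symm ℝ _ _

theorem openSeg_swap (e : Edge) : openSeg e.swap = openSeg e := openSegment_symm ℝ _ _

theorem isCompact_seg (e : Edge) : IsCompact (seg e) := by
  rw [seg, segment_eq_image']
  exact isCompact_Icc.image (by fun_prop)

theorem mem_seg_iff {e : Edge} {z : Plane} :
    z ∈ seg e ↔ z = e.1 ∨ z = e.2 ∨ z ∈ openSeg e := by
  constructor
  · intro h
    obtain ⟨s, h0, h1, rfl⟩ := mem_seg.1 h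
    rcases h0.eq_or_lt with rfl | h0
    · left; simp
    rcases h1.eq_or_lt with rfl | h1
    · right; left; simp
    exact Or.inr (Or.inr (mem_openSeg.2 ⟨s, h0, h1, rfl⟩))
  · rintro (rfl | rfl | h)
    · exact fst_mem_seg _
    · exact snd_mem_seg _
    · exact openSeg_subset _ h

theorem fst_notMem_openSeg {e : Edge} (h : e.1 ≠ e.2) : e.1 ∉ openSeg e := by
  intro h'
  obtain ⟨s, h0, -, h2⟩ := mem_openSeg.1 h'
  have : s • (e.2 - e.1) = 0 := by simpa using h2
  rcases smul_eq_zero.1 this with h3 | h3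
  · exact h0.ne' h3
  · exact h (sub_eq_zero.1 h3).symm

theorem snd_notMem_openSeg {e : Edge} (h : e.1 ≠ e.2) : e.2 ∉ openSeg e := by
  have := fst_notMem_openSeg (e := e.swap) (by simpa using h.symm)
  rwa [openSeg_swap] at this

theorem mem_triangle {a b c z : Plane} :
    z ∈ triangle a b c ↔
      ∃ s t : ℝ, 0 ≤ s ∧ 0 ≤ t ∧ s + t ≤ 1 ∧ z = a + s • (b - a) + t • (c - a) := by
  rw [triangle, convexHull_insert (by simp), convexHull_pair, convexJoin_singleton_left]
  simp only [mem_iUnion, exists_prop]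
  constructor
  · rintro ⟨w, hw, hz⟩
    rw [segment_eq_image'] at hw hz
    obtain ⟨x, ⟨hx0, hx1⟩, rfl⟩ := hw
    obtain ⟨y, ⟨hy0, hy1⟩, rfl⟩ := hz
    refine ⟨y * (1 - x), y * x, by nlinarith, by positivity, by nlinarith, ?_⟩
    ext <;> simp <;> ring
  · rintro ⟨s, t, hs, ht, hst, rfl⟩
    by_cases h : s + t = 0
    · have hs' : s = 0 := by linarith
      have ht' : t = 0 := by linarith
      subst hs'; subst ht'
      exact ⟨b, left_mem_segment ℝ _ _, by simpa using left_mem_segment ℝ a b⟩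
    · have hpos : 0 < s + t := lt_of_le_of_ne (by linarith) (Ne.symm h)
      refine ⟨b + (t / (s + t)) • (c - b), ?_, ?_⟩
      · rw [segment_eq_image']
        exact ⟨_, ⟨by positivity, by rw [div_le_one hpos]; linarith⟩, rfl⟩
      · rw [segment_eq_image']
        refine ⟨s + t, ⟨hpos.le, hst⟩, ?_⟩
        ext <;> simp <;> field_simp <;> ring

theorem triangle_swap (a b c : Plane) : triangle a b c = triangle b a c := by
  rw [triangle, triangle, Set.insert_comm]

/-- The geometric part of `Drawing.Generic`: general position of a set of edges. -/
structure GenPos (S : Set Edge) : Prop where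
  finite : S.Finite
  ne : ∀ e ∈ S, e.1 ≠ e.2
  not_opposite : ∀ e ∈ S, (e.2, e.1) ∉ S
  vertex : ∀ e ∈ S, ∀ f ∈ S, ∀ v : Plane, (v = f.1 ∨ v = f.2) → v ∈ seg e → v = e.1 ∨ v = e.2
  no_triple : ∀ e ∈ S, ∀ f ∈ S, ∀ g ∈ S, e ≠ f → f ≠ g → e ≠ g →
    openSeg e ∩ openSeg f ∩ openSeg g = ∅

/-- Every vertex has exactly one incoming and one outgoing edge. -/
structure LinkSet (S : Set Edge) : Prop where
  outInj : ∀ e ∈ S, ∀ f ∈ S, e.1 = f.1 → e = f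
  inInj : ∀ e ∈ S, ∀ f ∈ S, e.2 = f.2 → e = f
  succ : ∀ e ∈ S, ∃ f ∈ S, f.1 = e.2
  pred : ∀ e ∈ S, ∃ f ∈ S, f.2 = e.1

/-- The edges of a link diagram. -/
structure Diag (S : Set Edge) : Prop where
  gen : GenPos S
  link : LinkSet S

/-- The end points of a set of edges. -/
def verts (S : Set Edge) : Set Plane := {v | ∃ e ∈ S, v = e.1 ∨ v = e.2}

/-- The double points of a set of edges. -/
def crossPts (S : Set Edge) : Set Plane :=
  {z | ∃ e ∈ S, ∃ f ∈ S, e ≠ f ∧ z ∈ openSeg e ∧ z ∈ openSeg f}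

theorem verts_mono {S T : Set Edge} (h : S ⊆ T) : verts S ⊆ verts T :=
  fun _ ⟨e, he, hv⟩ => ⟨e, h he, hv⟩

theorem crossPts_mono {S T : Set Edge} (h : S ⊆ T) : crossPts S ⊆ crossPts T :=
  fun _ ⟨e, he, f, hf, hv⟩ => ⟨e, h he, f, h hf, hv⟩

theorem fst_mem_verts {S : Set Edge} {e : Edge} (h : e ∈ S) : e.1 ∈ verts S := ⟨e, h, Or.inl rfl⟩

theorem snd_mem_verts {S : Set Edge} {e : Edge} (h : e ∈ S) : e.2 ∈ verts S := ⟨e, h, Or.inr rfl⟩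

theorem verts_insert (e : Edge) (S : Set Edge) :
    verts (insert e S) = insert e.1 (insert e.2 (verts S)) := by
  ext v
  simp only [verts, mem_insert_iff, Set.mem_ofPred_eq, exists_eq_or_imp, or_assoc]

theorem GenPos.mono {S T : Set Edge} (h : GenPos T) (hST : S ⊆ T) : GenPos S where
  finite := h.finite.subset hST
  ne e he := h.ne e (hST he)
  not_opposite e he he' := h.not_opposite e (hST he) (hST he')
  vertex e he f hf := h.vertex e (hST he) f (hST hf)
  no_triple e he f hf g hg := h.no_triple e (hST he) f (hST hf) g (hST hg)

theorem GenPos.eq_of_mem {S : Set Edge} (h : GenPos S) {v : Plane} (hv : v ∈ verts S) {e : Edge}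
    (he : e ∈ S) (hve : v ∈ seg e) : v = e.1 ∨ v = e.2 := by
  obtain ⟨f, hf, hvf⟩ := hv
  exact h.vertex e he f hf v hvf hve

theorem GenPos.notMem_openSeg {S : Set Edge} (h : GenPos S) {v : Plane} (hv : v ∈ verts S)
    {e : Edge} (he : e ∈ S) : v ∉ openSeg e := by
  intro hve
  rcases h.eq_of_mem hv he (openSeg_subset _ hve) with rfl | rfl
  · exact fst_notMem_openSeg (h.ne e he) hve
  · exact snd_notMem_openSeg (h.ne e he) hve

theorem GenPos.crossPts_disjoint_verts {S : Set Edge} (h : GenPos S) {v : Plane}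
    (hv : v ∈ verts S) : v ∉ crossPts S := by
  rintro ⟨e, he, -, -, -, hve, -⟩
  exact h.notMem_openSeg hv he hve

/-- An edge may be added to a set in general position if no vertex and no double point gets into its
interior, and its end points are not interior to old edges. -/
theorem GenPos.insert_edge {S : Set Edge} (h : GenPos S) {e : Edge} (hne : e.1 ≠ e.2)
    (hop : (e.2, e.1) ∉ S) (hv : ∀ v ∈ verts S, v ∈ seg e → v = e.1 ∨ v = e.2)
    (h1 : ∀ f ∈ S, e.1 ∈ seg f → e.1 = f.1 ∨ e.1 = f.2)
    (h2 : ∀ f ∈ S, e.2 ∈ seg f → e.2 = f.1 ∨ e.2 = f.2)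
    (hc : ∀ z ∈ crossPts S, z ∉ openSeg e) : GenPos (insert e S) where
  finite := h.finite.insert e
  ne := by
    rintro f (rfl | hf)
    · exact hne
    · exact h.ne f hf
  not_opposite := by
    rintro f (rfl | hf) (hf' | hf')
    · exact hne (congrArg Prod.fst hf').symm
    · exact hop hf'
    · apply hop
      rw [← hf']
      exact hf
    · exact h.not_opposite f hf hf'
  vertex := by
    rintro f (rfl | hf) g (rfl | hg) v hvg hvf
    · exact hvg
    · exact hv v ⟨g, hg, hvg⟩ hvf
    · rcases hvg with rfl | rfl
      · exact h1 f hf hvf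
      · exact h2 f hf hvf
    · exact h.vertex f hf g hg v hvg hvf
  no_triple := by
    rintro f hf g hg k hk hfg hgk hfk
    rw [eq_empty_iff_forall_notMem]
    rintro z ⟨⟨hzf, hzg⟩, hzk⟩
    rcases hf with rfl | hf <;> rcases hg with rfl | hg <;> rcases hk with rfl | hk
    · exact hfg rfl
    · exact hfg rfl
    · exact hfk rfl
    · exact hc z ⟨g, hg, k, hk, hgk, hzg, hzk⟩ hzf
    · exact hgk rfl
    · exact hc z ⟨f, hf, k, hk, hfk, hzf, hzk⟩ hzg
    · exact hc z ⟨f, hf, g, hg, hfg, hzf, hzg⟩ hzk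
    · have := h.no_triple f hf g hg k hk hfg hgk hfk
      rw [eq_empty_iff_forall_notMem] at this
      exact this z ⟨⟨hzf, hzg⟩, hzk⟩

theorem exists_smul_of_det_eq_zero {u v : Plane} (hu : u ≠ 0) (h : det u v = 0) :
    ∃ k : ℝ, v = k • u := by
  simp only [det] at h
  by_cases h1 : u.1 = 0
  · have h2 : u.2 ≠ 0 := fun h2 => hu (Prod.ext h1 h2)
    refine ⟨v.2 / u.2, Prod.ext ?_ ?_⟩
    · have : v.1 = 0 := by
        have : u.2 * v.1 = 0 := by rw [h1] at h; linarith
        exact (mul_eq_zero.1 this).resolve_left h2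
      simp [h1, this]
    · simp [h2]
  · refine ⟨v.1 / u.1, Prod.ext ?_ ?_⟩
    · simp [h1]
    · simp; field_simp; linarith

@[simp] theorem det_self (u : Plane) : det u u = 0 := by simp [det]; ring

@[simp] theorem det_zero_left (u : Plane) : det 0 u = 0 := by simp [det]

@[simp] theorem det_zero_right (u : Plane) : det u 0 = 0 := by simp [det]

theorem det_comm (u v : Plane) : det u v = - det v u := by simp [det]; ring

@[simp] theorem det_smul_left (k : ℝ) (u v : Plane) : det (k • u) v = k * det u v := by
  simp [det]; ring

@[simp] theorem det_smul_right (k : ℝ) (u v : Plane) : det u (k • v) = k * det u v := by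
  simp [det]; ring

theorem det_add_left (u u' v : Plane) : det (u + u') v = det u v + det u' v := by
  simp [det]; ring

theorem det_add_right (u v v' : Plane) : det u (v + v') = det u v + det u v' := by
  simp [det]; ring

/-- Two vectors that are parallel to a common non-zero vector are parallel. -/
theorem det_eq_zero_trans {u v w : Plane} (hv : v ≠ 0) (h1 : det u v = 0) (h2 : det v w = 0) :
    det u w = 0 := by
  obtain ⟨k, rfl⟩ := exists_smul_of_det_eq_zero hv h2
  simp [h1]

/-- Two non-parallel edges meet in at most one point. -/
theorem eq_of_mem_seg_of_det_ne {e f : Edge} (h : det (e.2 - e.1) (f.2 - f.1) ≠ 0) {z z' : Plane}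
    (hze : z ∈ seg e) (hzf : z ∈ seg f) (hze' : z' ∈ seg e) (hzf' : z' ∈ seg f) : z = z' := by
  obtain ⟨s, -, -, hs⟩ := mem_seg.1 hze
  obtain ⟨s', -, -, hs'⟩ := mem_seg.1 hze'
  obtain ⟨r, -, -, hr⟩ := mem_seg.1 hzf
  obtain ⟨r', -, -, hr'⟩ := mem_seg.1 hzf'
  have h1 : z - z' = (s - s') • (e.2 - e.1) := by rw [hs, hs']; module
  have h2 : z - z' = (r - r') • (f.2 - f.1) := by rw [hr, hr']; module
  have h3 : (s - s') * det (e.2 - e.1) (f.2 - f.1) = 0 := by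
    rw [← det_smul_left, ← h1, h2]; simp
  have h4 : s - s' = 0 := (mul_eq_zero.1 h3).resolve_right h
  rw [h4, zero_smul] at h1
  exact sub_eq_zero.1 h1

/-- In general position crossings are transversal. -/
theorem GenPos.det_ne {S : Set Edge} (h : GenPos S) {e f : Edge} (he : e ∈ S) (hf : f ∈ S)
    (hef : e ≠ f) {z : Plane} (hze : z ∈ openSeg e) (hzf : z ∈ openSeg f) :
    det (e.2 - e.1) (f.2 - f.1) ≠ 0 := by
  intro h0
  have hu : e.2 - e.1 ≠ 0 := sub_ne_zero.2 (h.ne e he).symm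
  obtain ⟨k, hk⟩ := exists_smul_of_det_eq_zero hu h0
  obtain ⟨s, hs0, hs1, hs⟩ := mem_openSeg.1 hze
  obtain ⟨r, hr0, hr1, hr⟩ := mem_openSeg.1 hzf
  have hk0 : k ≠ 0 := by
    rintro rfl
    rw [zero_smul] at hk
    exact h.ne f hf (sub_eq_zero.1 hk).symm
  -- otherwise `e` and `f` overlap, and an end point of one of them lies inside the other, or they
  -- have the same end points; along the line of `e`, the end points of `f` have the parameters
  -- `s - r k` and `s + (1 - r) k`
  have hf1 : f.1 = e.1 + (s - r * k) • (e.2 - e.1) := by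
    have : f.1 = z - r • (f.2 - f.1) := by rw [hr]; module
    rw [this, hk, hs]; module
  have hf2 : f.2 = e.1 + (s + (1 - r) * k) • (e.2 - e.1) := by
    have : f.2 = z + (1 - r) • (f.2 - f.1) := by rw [hr]; module
    rw [this, hk, hs]; module
  have key : ∀ x y : ℝ, e.1 + x • (e.2 - e.1) = e.1 + y • (e.2 - e.1) → x = y := by
    intro x y hxy
    have : (x - y) • (e.2 - e.1) = 0 := by
      rw [sub_smul]; exact sub_eq_zero.2 (add_left_cancel hxy)
    rcases smul_eq_zero.1 this with h' | h'
    · linarith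
    · exact absurd h' hu
  have p0 : e.1 = e.1 + (0 : ℝ) • (e.2 - e.1) := by simp
  have p1 : e.2 = e.1 + (1 : ℝ) • (e.2 - e.1) := by simp
  have inE : ∀ x : ℝ, 0 ≤ x → x ≤ 1 → (e.1 + x • (e.2 - e.1) = f.1 ∨ e.1 + x • (e.2 - e.1) = f.2) →
      x = 0 ∨ x = 1 := by
    intro x h0 h1 hx
    rcases h.vertex e he f hf _ hx (mem_seg.2 ⟨x, h0, h1, rfl⟩) with h' | h'
    · left; exact key _ _ (h'.trans p0)
    · right; exact key _ _ (h'.trans p1)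
  have inF : ∀ x : ℝ, 0 ≤ (x - (s - r * k)) / k → (x - (s - r * k)) / k ≤ 1 → (x = 0 ∨ x = 1) →
      x = s - r * k ∨ x = s + (1 - r) * k := by
    intro x h0 h1 hx
    have hx' : e.1 + x • (e.2 - e.1) = e.1 ∨ e.1 + x • (e.2 - e.1) = e.2 := by
      rcases hx with rfl | rfl
      · left; simp
      · right; simp
    have : e.1 + x • (e.2 - e.1) ∈ seg f := by
      refine mem_seg.2 ⟨_, h0, h1, ?_⟩
      rw [hk, hf1, smul_smul, div_mul_cancel₀ _ hk0]; module
    rcases h.vertex f hf e he _ hx' this with h' | h'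
    · left; exact key _ _ (h'.trans hf1)
    · right; exact key _ _ (h'.trans hf2)
  rcases lt_or_gt_of_ne hk0 with hk | hk
  · have hA : 1 ≤ s - r * k := by
      by_contra hc
      push Not at hc
      rcases inE _ (by nlinarith) hc.le (Or.inl hf1.symm) with h' | h' <;> nlinarith
    have hB : s + (1 - r) * k ≤ 0 := by
      by_contra hc
      push Not at hc
      rcases inE _ hc.le (by nlinarith) (Or.inr hf2.symm) with h' | h' <;> nlinarith
    have h1 := inF 1 (div_nonneg_of_nonpos (by linarith) hk.le)
      (by rw [div_le_one_of_neg hk]; nlinarith) (Or.inr rfl)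
    have h2 := inF 0 (div_nonneg_of_nonpos (by linarith) hk.le)
      (by rw [div_le_one_of_neg hk]; nlinarith) (Or.inl rfl)
    have h1' : 1 = s - r * k := by rcases h1 with h' | h'; exact h'; nlinarith
    have h2' : 0 = s + (1 - r) * k := by rcases h2 with h' | h'; nlinarith; exact h'
    apply h.not_opposite e he
    have : (e.2, e.1) = f := by
      refine Prod.ext ?_ ?_
      · rw [hf1, ← h1']; simp
      · rw [hf2, ← h2']; simp
    rwa [this]
  · have hA : s - r * k ≤ 0 := by
      by_contra hc
      push Not at hc
      rcases inE _ hc.le (by nlinarith) (Or.inl hf1.symm) with h' | h' <;> nlinarith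
    have hB : 1 ≤ s + (1 - r) * k := by
      by_contra hc
      push Not at hc
      rcases inE _ (by nlinarith) hc.le (Or.inr hf2.symm) with h' | h' <;> nlinarith
    have h1 := inF 1 (div_nonneg (by linarith) hk.le)
      (by rw [div_le_one hk]; nlinarith) (Or.inr rfl)
    have h2 := inF 0 (div_nonneg (by linarith) hk.le)
      (by rw [div_le_one hk]; nlinarith) (Or.inl rfl)
    have h1' : 1 = s + (1 - r) * k := by rcases h1 with h' | h'; nlinarith; exact h'
    have h2' : 0 = s - r * k := by rcases h2 with h' | h'; exact h'; nlinarith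
    apply hef
    refine Prod.ext ?_ ?_
    · rw [hf1, ← h2']; simp
    · rw [hf2, ← h1']; simp

/-- In general position two different edges have at most one common interior point. -/
theorem GenPos.eq_of_mem_openSeg {S : Set Edge} (h : GenPos S) {e f : Edge} (he : e ∈ S)
    (hf : f ∈ S) (hef : e ≠ f) {z z' : Plane} (hze : z ∈ openSeg e) (hzf : z ∈ openSeg f)
    (hze' : z' ∈ seg e) (hzf' : z' ∈ seg f) : z = z' :=
  eq_of_mem_seg_of_det_ne (h.det_ne he hf hef hze hzf) (openSeg_subset _ hze)
    (openSeg_subset _ hzf) hze' hzf'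

theorem GenPos.finite_verts {S : Set Edge} (h : GenPos S) : (verts S).Finite := by
  refine ((h.finite.image Prod.fst).union (h.finite.image Prod.snd)).subset ?_
  rintro v ⟨e, he, rfl | rfl⟩
  · exact Or.inl ⟨e, he, rfl⟩
  · exact Or.inr ⟨e, he, rfl⟩

theorem GenPos.finite_crossPts {S : Set Edge} (h : GenPos S) : (crossPts S).Finite := by
  have : crossPts S ⊆ ⋃ e ∈ S, ⋃ f ∈ S, {z | e ≠ f ∧ z ∈ openSeg e ∧ z ∈ openSeg f} := by
    rintro z ⟨e, he, f, hf, hz⟩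
    simp only [mem_iUnion]
    exact ⟨e, he, f, hf, hz⟩
  refine (h.finite.biUnion fun e he => h.finite.biUnion fun f hf => ?_).subset this
  apply Set.Subsingleton.finite
  rintro z ⟨hef, hz1, hz2⟩ z' ⟨-, hz1', hz2'⟩
  exact h.eq_of_mem_openSeg he hf hef hz1 hz2 (openSeg_subset _ hz1') (openSeg_subset _ hz2')

/-! ### Drawings with fixed crossing markers -/

/-- A set of crossing markers: a point together with the direction of the over branch there. -/
abbrev Markers : Type := Set (Plane × Plane)

/-- The drawing with edges `S` whose classical crossings are those marked by `L`: the over branch is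
the one parallel to the direction of the marker. The same markers can be used for different sets of
edges, as long as these agree near the marked points. -/
def draw (S : Set Edge) (L : Markers) : Drawing where
  edges := S
  isOver e f := e ∈ S ∧ f ∈ S ∧ ∃ m ∈ L, m.1 ∈ openSeg e ∧ m.1 ∈ openSeg f ∧
    det (e.2 - e.1) m.2 = 0 ∧ det (f.2 - f.1) m.2 ≠ 0

/-- There is at most one marker at each point. -/
def Functional (L : Markers) : Prop := ∀ m ∈ L, ∀ m' ∈ L, m.1 = m'.1 → m = m'

/-- No marked point lies in the interior of the edge, so all its crossings are virtual. -/
def Free (L : Markers) (e : Edge) : Prop := ∀ m ∈ L, m.1 ∉ openSeg e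

theorem det_ne_of_marker {e f : Edge} {w : Plane} (hne : e.1 ≠ e.2)
    (h1 : det (e.2 - e.1) w = 0) (h2 : det (f.2 - f.1) w ≠ 0) :
    det (e.2 - e.1) (f.2 - f.1) ≠ 0 := by
  intro h
  apply h2
  refine det_eq_zero_trans (v := e.2 - e.1) (sub_ne_zero.2 hne.symm) ?_ h1
  rw [det_comm, h, neg_zero]

theorem GenPos.generic {S : Set Edge} (h : GenPos S) {L : Markers} (hL : Functional L) :
    (draw S L).Generic where
  finite := h.finite
  ne := h.ne
  not_opposite := h.not_opposite
  vertex := h.vertex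
  no_triple := h.no_triple
  isOver_spec := by
    rintro e f ⟨he, hf, m, hm, h1, h2, h3, h4⟩
    have hdet := det_ne_of_marker (h.ne e he) h3 h4
    refine ⟨he, hf, ?_, ⟨m.1, h1, h2⟩, ?_⟩
    · rintro rfl
      exact h4 h3
    · rintro ⟨-, -, m', hm', h1', h2', h3', h4'⟩
      have : m.1 = m'.1 := eq_of_mem_seg_of_det_ne hdet (openSeg_subset _ h1) (openSeg_subset _ h2)
        (openSeg_subset _ h2') (openSeg_subset _ h1')
      rw [← hL m hm m' hm' this] at h3'
      exact h4 h3'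

theorem Diag.isLinkDiagram {S : Set Edge} (h : Diag S) {L : Markers} (hL : Functional L) :
    (draw S L).IsLinkDiagram where
  generic := h.gen.generic hL
  next := by
    intro e he
    obtain ⟨f, hf, hfe⟩ := h.link.succ e he
    refine ⟨f.2, ?_, fun w hw => ?_⟩
    · change (e.2, f.2) ∈ S
      rw [← hfe]; exact hf
    · exact congrArg Prod.snd (h.link.outInj _ hw f hf hfe.symm)
  prev := by
    intro e he
    obtain ⟨f, hf, hfe⟩ := h.link.pred e he
    refine ⟨f.1, ?_, fun w hw => ?_⟩
    · change (f.1, e.1) ∈ S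
      rw [← hfe]; exact hf
    · exact congrArg Prod.fst (h.link.inInj _ hw f hf hfe.symm)

theorem genPos_of_generic {D : Drawing} (h : D.Generic) : GenPos D.edges :=
  ⟨h.finite, h.ne, h.not_opposite, h.vertex, h.no_triple⟩

theorem diag_of_isLinkDiagram {D : Drawing} (h : D.IsLinkDiagram) : Diag D.edges where
  gen := genPos_of_generic h.generic
  link := by
    refine ⟨?_, ?_, ?_, ?_⟩
    · rintro ⟨x, y⟩ he ⟨x', y'⟩ hf (rfl : x = x')
      obtain ⟨w, hw, -⟩ := h.prev _ he
      have := (h.next _ hw).unique (y₁ := y) (y₂ := y') he hf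
      rw [this]
    · rintro ⟨x, y⟩ he ⟨x', y'⟩ hf (rfl : y = y')
      obtain ⟨w, hw, -⟩ := h.next _ he
      have := (h.prev _ hw).unique (y₁ := x) (y₂ := x') he hf
      rw [this]
    · intro e he
      obtain ⟨w, hw, -⟩ := h.next _ he
      exact ⟨_, hw, rfl⟩
    · intro e he
      obtain ⟨w, hw, -⟩ := h.prev _ he
      exact ⟨_, hw, rfl⟩

/-- Every marker sits at a crossing of two edges and is parallel to exactly one of them. -/
def Realized (S : Set Edge) (L : Markers) : Prop :=
  ∀ m ∈ L, ∃ e ∈ S, ∃ f ∈ S, m.1 ∈ openSeg e ∧ m.1 ∈ openSeg f ∧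
    det (e.2 - e.1) m.2 = 0 ∧ det (f.2 - f.1) m.2 ≠ 0

/-- Every generic drawing arises from markers. -/
theorem exists_markers {D : Drawing} (h : D.Generic) :
    ∃ L : Markers, Functional L ∧ Realized D.edges L ∧ D = draw D.edges L := by
  have hg := genPos_of_generic h
  let L : Markers := {m | ∃ e f, D.isOver e f ∧ m.1 ∈ openSeg e ∧ m.1 ∈ openSeg f ∧ m.2 = e.2 - e.1}
  have pair : ∀ {e f e' f' : Edge} {z : Plane}, e ∈ D.edges → f ∈ D.edges → e' ∈ D.edges →
      f' ∈ D.edges → e ≠ f → e' ≠ f' → z ∈ openSeg e → z ∈ openSeg f → z ∈ openSeg e' →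
      z ∈ openSeg f' → (e = e' ∧ f = f') ∨ (e = f' ∧ f = e') := by
    intro e f e' f' z he hf he' hf' hef hef' h1 h2 h3 h4
    have key : ∀ g ∈ D.edges, z ∈ openSeg g → g = e ∨ g = f := by
      intro g hg' hz
      by_contra hc
      push Not at hc
      have := hg.no_triple e he f hf g hg' hef hc.2.symm hc.1.symm
      rw [eq_empty_iff_forall_notMem] at this
      exact this z ⟨⟨h1, h2⟩, hz⟩
    rcases key e' he' h3 with rfl | rfl <;> rcases key f' hf' h4 with rfl | rfl
    · exact absurd rfl hef'
    · exact Or.inl ⟨rfl, rfl⟩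
    · exact Or.inr ⟨rfl, rfl⟩
    · exact absurd rfl hef'
  refine ⟨L, ?_, ?_, ?_⟩
  · rintro ⟨x, w⟩ ⟨e, f, ho, h1, h2, rfl⟩ ⟨x', w'⟩ ⟨e', f', ho', h1', h2', rfl⟩ (rfl : x = x')
    obtain ⟨he, hf, hef, -, hno⟩ := h.isOver_spec _ _ ho
    obtain ⟨he', hf', hef', -, -⟩ := h.isOver_spec _ _ ho'
    rcases pair he hf he' hf' hef hef' h1 h2 h1' h2' with ⟨rfl, rfl⟩ | ⟨rfl, rfl⟩
    · rfl
    · exact absurd ho' hno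
  · rintro ⟨x, w⟩ ⟨e, f, ho, h1, h2, rfl⟩
    obtain ⟨he, hf, hef, -, hno⟩ := h.isOver_spec _ _ ho
    refine ⟨e, he, f, hf, h1, h2, by simp, ?_⟩
    rw [det_comm]
    exact neg_ne_zero.2 (hg.det_ne he hf hef h1 h2)
  · refine Drawing.ext rfl ?_
    funext e f
    refine propext ⟨fun ho => ?_, ?_⟩
    · obtain ⟨he, hf, hef, ⟨x, hxe, hxf⟩, hno⟩ := h.isOver_spec _ _ ho
      refine ⟨he, hf, ⟨x, e.2 - e.1⟩, ⟨e, f, ho, hxe, hxf, rfl⟩, hxe, hxf, by simp, ?_⟩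
      rw [det_comm]
      exact neg_ne_zero.2 (hg.det_ne he hf hef hxe hxf)
    · rintro ⟨he, hf, ⟨x, w⟩, ⟨e', f', ho, hx1, hx2, rfl⟩, h1, h2, h3, h4⟩
      obtain ⟨he', hf', hef', -, hno⟩ := h.isOver_spec _ _ ho
      have hef : e ≠ f := by
        rintro rfl
        exact h4 h3
      rcases pair he' hf' he hf hef' hef hx1 hx2 h1 h2 with ⟨rfl, rfl⟩ | ⟨rfl, rfl⟩
      · exact ho
      · simp at h4

/-! ### Moves between drawings with fixed markers -/

/-- Virtual isotopy of two drawings with the same markers. -/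
def VI (L : Markers) (S T : Set Edge) : Prop := VirtuallyIsotopic (draw S L) (draw T L)

theorem VI.refl (L : Markers) (S : Set Edge) : VI L S S := Relation.EqvGen.refl _

theorem VI.symm {L : Markers} {S T : Set Edge} (h : VI L S T) : VI L T S :=
  Relation.EqvGen.symm _ _ h

theorem VI.trans {L : Markers} {S T U : Set Edge} (h : VI L S T) (h' : VI L T U) : VI L S U :=
  Relation.EqvGen.trans _ _ _ h h'

/-- A new vertex on an edge keeps the combinatorial type of a link. -/
theorem LinkSet.split {S : Set Edge} {a b c : Plane} (h : LinkSet (insert (a, b) S))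
    (hab : (a, b) ∉ S) (hc : c ∉ verts (insert (a, b) S)) :
    LinkSet (insert (a, c) (insert (c, b) S)) := by
  rw [verts_insert] at hc
  simp only [mem_insert_iff, not_or] at hc
  obtain ⟨hca, hcb, hcS⟩ := hc
  have hS : ∀ f ∈ S, f ∈ insert (a, b) S := fun f hf => Or.inr hf
  have out_a : ∀ f ∈ S, f.1 ≠ a := fun f hf hfa =>
    hab (h.outInj f (hS f hf) (a, b) (Or.inl rfl) hfa ▸ hf)
  have in_b : ∀ f ∈ S, f.2 ≠ b := fun f hf hfb =>
    hab (h.inInj f (hS f hf) (a, b) (Or.inl rfl) hfb ▸ hf)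
  have out_c : ∀ f ∈ S, f.1 ≠ c := fun f hf hfc => hcS (hfc ▸ fst_mem_verts hf)
  have in_c : ∀ f ∈ S, f.2 ≠ c := fun f hf hfc => hcS (hfc ▸ snd_mem_verts hf)
  refine ⟨?_, ?_, ?_, ?_⟩
  · rintro e (rfl | rfl | he) f (rfl | rfl | hf) hef
    · rfl
    · exact absurd hef.symm hca
    · exact absurd hef.symm (out_a f hf)
    · exact absurd hef hca
    · rfl
    · exact absurd hef.symm (out_c f hf)
    · exact absurd hef (out_a e he)
    · exact absurd hef (out_c e he)
    · exact h.outInj e (hS e he) f (hS f hf) hef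
  · rintro e (rfl | rfl | he) f (rfl | rfl | hf) hef
    · rfl
    · exact absurd hef hcb
    · exact absurd hef.symm (in_c f hf)
    · exact absurd hef.symm hcb
    · rfl
    · exact absurd hef.symm (in_b f hf)
    · exact absurd hef (in_c e he)
    · exact absurd hef (in_b e he)
    · exact h.inInj e (hS e he) f (hS f hf) hef
  · have key : ∀ e ∈ insert (a, b) S, ∃ f ∈ insert (a, c) (insert (c, b) S), f.1 = e.2 := by
      intro e he
      obtain ⟨f, rfl | hf, hfe⟩ := h.succ e he
      · exact ⟨(a, c), Or.inl rfl, hfe⟩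
      · exact ⟨f, Or.inr (Or.inr hf), hfe⟩
    rintro e (rfl | rfl | he)
    · exact ⟨(c, b), Or.inr (Or.inl rfl), rfl⟩
    · exact key (a, b) (Or.inl rfl)
    · exact key e (hS e he)
  · have key : ∀ e ∈ insert (a, b) S, ∃ f ∈ insert (a, c) (insert (c, b) S), f.2 = e.1 := by
      intro e he
      obtain ⟨f, rfl | hf, hfe⟩ := h.pred e he
      · exact ⟨(c, b), Or.inr (Or.inl rfl), hfe⟩
      · exact ⟨f, Or.inr (Or.inr hf), hfe⟩
    rintro e (rfl | rfl | he)
    · exact key (a, b) (Or.inl rfl)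
    · exact ⟨(a, c), Or.inl rfl, rfl⟩
    · exact key e (hS e he)

/-- Removing a vertex keeps the combinatorial type of a link. -/
theorem LinkSet.merge {S : Set Edge} {a b c : Plane}
    (h : LinkSet (insert (a, c) (insert (c, b) S))) (hc : c ∉ verts S) (hca : c ≠ a)
    (hcb : c ≠ b) : LinkSet (insert (a, b) S) := by
  have hS : ∀ f ∈ S, f ∈ insert (a, c) (insert (c, b) S) := fun f hf => Or.inr (Or.inr hf)
  have hac : (a, c) ∉ S := fun h' => hc (snd_mem_verts h')
  have hcb' : (c, b) ∉ S := fun h' => hc (fst_mem_verts h')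
  have out_a : ∀ f ∈ S, f.1 ≠ a := fun f hf hfa =>
    hac (h.outInj f (hS f hf) (a, c) (Or.inl rfl) hfa ▸ hf)
  have in_b : ∀ f ∈ S, f.2 ≠ b := fun f hf hfb =>
    hcb' (h.inInj f (hS f hf) (c, b) (Or.inr (Or.inl rfl)) hfb ▸ hf)
  refine ⟨?_, ?_, ?_, ?_⟩
  · rintro e (rfl | he) f (rfl | hf) hef
    · rfl
    · exact absurd hef.symm (out_a f hf)
    · exact absurd hef (out_a e he)
    · exact h.outInj e (hS e he) f (hS f hf) hef
  · rintro e (rfl | he) f (rfl | hf) hef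
    · rfl
    · exact absurd hef.symm (in_b f hf)
    · exact absurd hef (in_b e he)
    · exact h.inInj e (hS e he) f (hS f hf) hef
  · have key : ∀ e ∈ insert (a, c) (insert (c, b) S), e.2 ≠ c → ∃ f ∈ insert (a, b) S, f.1 = e.2
      := by
      intro e he hec
      obtain ⟨f, rfl | rfl | hf, hfe⟩ := h.succ e he
      · exact ⟨(a, b), Or.inl rfl, hfe⟩
      · exact absurd hfe.symm hec
      · exact ⟨f, Or.inr hf, hfe⟩
    rintro e (rfl | he)
    · exact key (c, b) (Or.inr (Or.inl rfl)) hcb.symm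
    · exact key e (hS e he) fun h' => hc (h' ▸ snd_mem_verts he)
  · have key : ∀ e ∈ insert (a, c) (insert (c, b) S), e.1 ≠ c → ∃ f ∈ insert (a, b) S, f.2 = e.1
      := by
      intro e he hec
      obtain ⟨f, rfl | rfl | hf, hfe⟩ := h.pred e he
      · exact absurd hfe.symm hec
      · exact ⟨(a, b), Or.inl rfl, hfe⟩
      · exact ⟨f, Or.inr hf, hfe⟩
    rintro e (rfl | he)
    · exact key (a, c) (Or.inl rfl) hca.symm
    · exact key e (hS e he) fun h' => hc (h' ▸ fst_mem_verts he)

theorem draw_rest {S : Set Edge} {L : Markers} {a b : Plane} (hab : (a, b) ∉ S) :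
    (draw (insert (a, b) S) L).rest a b = S := by
  ext e
  simp only [Drawing.rest, draw, Set.mem_sdiff, mem_insert_iff, mem_singleton_iff]
  constructor
  · rintro ⟨rfl | h, h'⟩
    · exact absurd rfl h'
    · exact h
  · intro h
    exact ⟨Or.inr h, fun h' => hab (h' ▸ h)⟩

theorem Diag.notMem_of_split {S : Set Edge} {a b c : Plane}
    (h : Diag (insert (a, c) (insert (c, b) S))) : (a, b) ∉ S := by
  intro hab
  have : ((a, b) : Edge) = (a, c) :=
    h.link.outInj _ (Or.inr (Or.inr hab)) _ (Or.inl rfl) rfl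
  exact h.gen.ne (c, b) (Or.inr (Or.inl rfl)) (congrArg Prod.snd this).symm

theorem replaces_draw {S : Set Edge} {L : Markers} (hL : Functional L) {a b c : Plane}
    (h : Diag (insert (a, b) S)) (h' : Diag (insert (a, c) (insert (c, b) S))) :
    Replaces (draw (insert (a, b) S) L) (draw (insert (a, c) (insert (c, b) S)) L) a b c where
  source := h.isLinkDiagram hL
  target := h'.isLinkDiagram hL
  mem := Or.inl rfl
  edges_eq := by
    rw [draw_rest h'.notMem_of_split]
    ext e
    simp only [draw, mem_insert_iff, mem_union, mem_singleton_iff]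
    tauto
  isOver_iff := by
    rw [draw_rest h'.notMem_of_split]
    intro e he f hf
    simp only [draw, mem_insert_iff, he, hf, or_true, true_and]

theorem not_isOver_left {S : Set Edge} {L : Markers} {e : Edge} (h : Free L e) (f : Edge) :
    ¬ (draw S L).isOver e f := by
  rintro ⟨-, -, m, hm, h1, -⟩
  exact h m hm h1

theorem not_isOver_right {S : Set Edge} {L : Markers} {e : Edge} (h : Free L e) (f : Edge) :
    ¬ (draw S L).isOver f e := by
  rintro ⟨-, -, m, hm, -, h1, -⟩
  exact h m hm h1

/-- The edge `f` crosses the old edge `a → b` and exactly one of the new edges. -/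
def Straight (a b c : Plane) (f : Edge) : Prop :=
  Crosses f (a, b) ∧ Xor (Crosses f (a, c)) (Crosses f (c, b))

theorem Straight.passesThrough {S T : Set Edge} {L : Markers} {a b c : Plane} {f : Edge}
    (h : Straight a b c f) (hab : Free L (a, b)) (hac : Free L (a, c)) (hcb : Free L (c, b)) :
    PassesThrough (draw S L) (draw T L) a b c f where
  old := h.1
  new := h.2
  type_eq := by
    have key : ∀ g : Edge, Free L g →
        ((draw T L).isOver g f ↔ (draw S L).isOver (a, b) f) ∧
        ((draw T L).isOver f g ↔ (draw S L).isOver f (a, b)) := fun g hg =>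
      ⟨iff_of_false (not_isOver_left hg f) (not_isOver_left hab f),
        iff_of_false (not_isOver_right hg f) (not_isOver_right hab f)⟩
    rintro g (rfl | rfl) -
    · exact key _ hac
    · exact key _ hcb

section moves

variable {S : Set Edge} {L : Markers} {a b c : Plane} (hL : Functional L)
  (h : Diag (insert (a, b) S)) (h' : Diag (insert (a, c) (insert (c, b) S)))
  (hab : Free L (a, b)) (hac : Free L (a, c)) (hcb : Free L (c, b))

include hL h h' hab hac hcb

theorem VI.planar (h1 : ∀ f ∈ S, Avoids a b c f ∨ Straight a b c f)
    (h2 : ∀ f ∈ S, ∀ g ∈ S, f ≠ g → ¬ CrossInside a b c f g) :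
    VI L (insert (a, b) S) (insert (a, c) (insert (c, b) S)) := by
  refine Relation.EqvGen.rel _ _ (Or.inl ⟨a, b, c, replaces_draw hL h h', ?_⟩)
  rw [draw_rest h'.notMem_of_split]
  exact ⟨fun f hf => (h1 f hf).imp_right fun h3 => h3.passesThrough hab hac hcb, h2⟩

theorem VI.one {k : Edge} (hk : k ∈ S)
    (hk' : (k.2 = a ∧ Crosses k (c, b)) ∨ (k.1 = b ∧ Crosses k (a, c)))
    (h1 : ∀ f ∈ S, f ≠ k → Avoids a b c f ∨ Straight a b c f)
    (h2 : ∀ f ∈ S, ∀ g ∈ S, f ≠ g → ¬ CrossInside a b c f g) :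
    VI L (insert (a, b) S) (insert (a, c) (insert (c, b) S)) := by
  refine Relation.EqvGen.rel _ _ (Or.inr (Or.inl ⟨a, b, c, k, replaces_draw hL h h', ?_⟩))
  rw [draw_rest h'.notMem_of_split]
  exact ⟨hk, hk', fun f hf hfk => (h1 f hf hfk).imp_right fun h3 => h3.passesThrough hab hac hcb,
      h2⟩

theorem VI.two {k : Edge} (hk : k ∈ S) (hk1 : Crosses k (a, c)) (hk2 : Crosses k (c, b))
    (h1 : ∀ f ∈ S, f ≠ k → Avoids a b c f ∨ Straight a b c f)
    (h2 : ∀ f ∈ S, ∀ g ∈ S, f ≠ g → ¬ CrossInside a b c f g) :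
    VI L (insert (a, b) S) (insert (a, c) (insert (c, b) S)) := by
  refine Relation.EqvGen.rel _ _ (Or.inr (Or.inr (Or.inl ⟨a, b, c, k, replaces_draw hL h h', ?_⟩)))
  rw [draw_rest h'.notMem_of_split]
  exact ⟨hk, hk1, hk2, iff_of_false (not_isOver_left hac k) (not_isOver_left hcb k),
    iff_of_false (not_isOver_right hac k) (not_isOver_right hcb k),
    fun f hf hfk => (h1 f hf hfk).imp_right fun h3 => h3.passesThrough hab hac hcb, h2⟩

theorem VI.three {k l : Edge} (hk : k ∈ S) (hl : l ∈ S) (hkl : k ≠ l) (hc : CrossInside a b c k l)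
    (h1 : ∀ f ∈ S, Avoids a b c f ∨ Straight a b c f)
    (h2 : ∀ f ∈ S, ∀ g ∈ S, f ≠ g → CrossInside a b c f g →
      (f = k ∧ g = l) ∨ (f = l ∧ g = k)) :
    VI L (insert (a, b) S) (insert (a, c) (insert (c, b) S)) := by
  refine Relation.EqvGen.rel _ _ (Or.inr (Or.inr (Or.inr
      ⟨a, b, c, k, l, replaces_draw hL h h', ?_⟩)))
  rw [draw_rest h'.notMem_of_split]
  exact ⟨hk, hl, hkl, hc, ⟨(a, b), k, l, List.Perm.refl _, Or.inl
    ⟨⟨not_isOver_left hab k, not_isOver_right hab k⟩,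
      ⟨not_isOver_left hab l, not_isOver_right hab l⟩⟩⟩,
    fun f hf => (h1 f hf).imp_right fun h3 => h3.passesThrough hab hac hcb, h2⟩

end moves

/-! ### Subdivision of an edge -/

theorem smul_sub_cancel {a b : Plane} (hab : a ≠ b) {x y : ℝ}
    (h : a + x • (b - a) = a + y • (b - a)) : x = y := by
  have : (x - y) • (b - a) = 0 := by
    rw [sub_smul]; exact sub_eq_zero.2 (add_left_cancel h)
  rcases smul_eq_zero.1 this with h' | h'
  · linarith
  · exact absurd (sub_eq_zero.1 h').symm hab

section subdivision

variable {a b d : Plane} (hd : d ∈ openSeg (a, b))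

include hd

theorem openSeg_left_subset : openSeg (a, d) ⊆ openSeg (a, b) := by
  obtain ⟨s, h0, h1, rfl⟩ := mem_openSeg.1 hd
  intro z hz
  obtain ⟨r, hr0, hr1, rfl⟩ := mem_openSeg.1 hz
  refine mem_openSeg.2 ⟨r * s, by positivity, by nlinarith, ?_⟩
  dsimp only; module

theorem openSeg_right_subset : openSeg (d, b) ⊆ openSeg (a, b) := by
  have := openSeg_left_subset (a := b) (b := a) (d := d) (by rwa [← openSeg_swap] at hd)
  rw [← openSeg_swap, ← openSeg_swap (a, b)]
  exact this

theorem seg_left_subset : seg (a, d) ⊆ seg (a, b) := by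
  intro z hz
  rcases mem_seg_iff.1 hz with rfl | rfl | h
  · exact fst_mem_seg (_, b)
  · exact openSeg_subset _ hd
  · exact openSeg_subset _ (openSeg_left_subset hd h)

theorem seg_right_subset : seg (d, b) ⊆ seg (a, b) := by
  intro z hz
  rcases mem_seg_iff.1 hz with rfl | rfl | h
  · exact openSeg_subset _ hd
  · exact snd_mem_seg (a, _)
  · exact openSeg_subset _ (openSeg_right_subset hd h)

theorem mem_openSeg_cases {z : Plane} (hz : z ∈ openSeg (a, b)) :
    z ∈ openSeg (a, d) ∨ z = d ∨ z ∈ openSeg (d, b) := by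
  obtain ⟨s, h0, h1, rfl⟩ := mem_openSeg.1 hd
  obtain ⟨r, hr0, hr1, rfl⟩ := mem_openSeg.1 hz
  rcases lt_trichotomy r s with h | rfl | h
  · left
    refine mem_openSeg.2 ⟨r / s, by positivity, (div_lt_one h0).2 h, ?_⟩
    dsimp only
    rw [add_sub_cancel_left, smul_smul, div_mul_cancel₀ _ h0.ne']
  · right; left; rfl
  · right; right
    have h1' : (1 - s) ≠ 0 := by linarith
    refine mem_openSeg.2 ⟨(r - s) / (1 - s), div_pos (by linarith) (by linarith),
      (div_lt_one (by linarith)).2 (by linarith), ?_⟩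
    ext <;> simp <;> field_simp <;> ring

theorem openSeg_disjoint (hab : a ≠ b) {z : Plane} (h1 : z ∈ seg (a, d)) : z ∉ openSeg (d, b) := by
  intro h2
  obtain ⟨s, h0, h1', rfl⟩ := mem_openSeg.1 hd
  obtain ⟨r, hr0, hr1, rfl⟩ := mem_seg.1 h1
  obtain ⟨r', hr0', hr1', hr⟩ := mem_openSeg.1 h2
  dsimp only at hr
  have hr' : a + (r * s) • (b - a) = a + (s + r' * (1 - s)) • (b - a) := by
    convert hr using 1 <;> module
  have := smul_sub_cancel hab hr'
  nlinarith

theorem snd_notMem_seg_left (hab : a ≠ b) : b ∉ seg (a, d) := by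
  intro h
  rcases mem_seg_iff.1 h with h | h | h
  · exact hab h.symm
  · exact snd_notMem_openSeg (e := (a, b)) hab (h ▸ hd)
  · exact snd_notMem_openSeg (e := (a, b)) hab (openSeg_left_subset hd h)

theorem fst_notMem_seg_right (hab : a ≠ b) : a ∉ seg (d, b) := by
  intro h
  rcases mem_seg_iff.1 h with h | h | h
  · exact fst_notMem_openSeg (e := (a, b)) hab (h ▸ hd)
  · exact hab h
  · exact fst_notMem_openSeg (e := (a, b)) hab (openSeg_right_subset hd h)

theorem GenPos.subdivide {S : Set Edge} (h : GenPos (insert (a, b) S)) (hS : (a, b) ∉ S)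
    (hdS : ∀ f ∈ S, d ∉ seg f) : GenPos (insert (a, d) (insert (d, b) S)) := by
  have hab : a ≠ b := h.ne (a, b) (Or.inl rfl)
  have hda : d ≠ a := fun h' => fst_notMem_openSeg (e := (a, b)) hab (h' ▸ hd)
  have hdb : d ≠ b := fun h' => snd_notMem_openSeg (e := (a, b)) hab (h' ▸ hd)
  have gS : GenPos S := h.mono (subset_insert _ _)
  have hvS : ∀ v ∈ verts S, v ∈ seg (a, b) → v = a ∨ v = b := fun v hv hv' =>
    h.eq_of_mem (verts_mono (subset_insert _ _) hv) (e := (a, b)) (Or.inl rfl) hv'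
  have hcr : ∀ z ∈ crossPts S, z ∉ openSeg (a, b) := by
    rintro z ⟨e, he, f, hf, hef, hze, hzf⟩ hz
    have := h.no_triple e (Or.inr he) f (Or.inr hf) (a, b) (Or.inl rfl) hef
      (fun h' => hS (h' ▸ hf)) (fun h' => hS (h' ▸ he))
    rw [eq_empty_iff_forall_notMem] at this
    exact this z ⟨⟨hze, hzf⟩, hz⟩
  have ha : ∀ f ∈ S, a ∈ seg f → a = f.1 ∨ a = f.2 := fun f hf hfa =>
    h.vertex f (Or.inr hf) (a, b) (Or.inl rfl) a (Or.inl rfl) hfa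
  have hb : ∀ f ∈ S, b ∈ seg f → b = f.1 ∨ b = f.2 := fun f hf hfa =>
    h.vertex f (Or.inr hf) (a, b) (Or.inl rfl) b (Or.inr rfl) hfa
  have g1 : GenPos (insert (d, b) S) := by
    refine gS.insert_edge hdb (fun h' => hdS _ h' (snd_mem_seg (b, d))) ?_ ?_ hb ?_
    · intro v hv hv'
      rcases hvS v hv (seg_right_subset hd hv') with rfl | rfl
      · exact absurd hv' (fst_notMem_seg_right hd hab)
      · exact Or.inr rfl
    · intro f hf hf'
      exact absurd hf' (hdS f hf)
    · intro z hz hz'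
      exact hcr z hz (openSeg_right_subset hd hz')
  refine g1.insert_edge hda.symm ?_ ?_ ?_ ?_ ?_
  · rintro (h' | h')
    · exact hab (congrArg Prod.snd h')
    · exact hdS _ h' (fst_mem_seg (d, a))
  · rw [verts_insert]
    rintro v (rfl | rfl | hv) hv'
    · exact Or.inr rfl
    · exact absurd hv' (snd_notMem_seg_left hd hab)
    · rcases hvS v hv (seg_left_subset hd hv') with rfl | rfl
      · exact Or.inl rfl
      · exact absurd hv' (snd_notMem_seg_left hd hab)
  · rintro f (rfl | hf) hf'
    · exact absurd hf' (fst_notMem_seg_right hd hab)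
    · exact ha f hf hf'
  · rintro f (rfl | hf) hf'
    · exact Or.inl rfl
    · exact absurd hf' (hdS f hf)
  · rintro z ⟨e, he, f, hf, hef, hze, hzf⟩ hz
    rcases he with rfl | he
    · exact openSeg_disjoint hd hab (openSeg_subset _ hz) hze
    · rcases hf with rfl | hf
      · exact openSeg_disjoint hd hab (openSeg_subset _ hz) hzf
      · exact hcr z ⟨e, he, f, hf, hef, hze, hzf⟩ (openSeg_left_subset hd hz)

theorem Diag.subdivide {S : Set Edge} (h : Diag (insert (a, b) S)) (hS : (a, b) ∉ S)
    (hdS : ∀ f ∈ S, d ∉ seg f) : Diag (insert (a, d) (insert (d, b) S)) where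
  gen := h.gen.subdivide hd hS hdS
  link := by
    refine h.link.split hS fun hv => ?_
    have hab : a ≠ b := h.gen.ne (a, b) (Or.inl rfl)
    rw [verts_insert] at hv
    rcases hv with h' | h' | ⟨f, hf, hdf⟩
    · exact fst_notMem_openSeg (e := (a, b)) hab (h' ▸ hd)
    · exact snd_notMem_openSeg (e := (a, b)) hab (h' ▸ hd)
    · rcases hdf with rfl | rfl
      · exact hdS f hf (fst_mem_seg f)
      · exact hdS f hf (snd_mem_seg f)

/-- An edge can be subdivided at any point that is not on another edge; the edge may have
classical crossings. -/
theorem VI.subdivide {S : Set Edge} {L : Markers} (hL : Functional L)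
    (h : Diag (insert (a, b) S)) (hS : (a, b) ∉ S) (hdS : ∀ f ∈ S, d ∉ seg f) :
    VI L (insert (a, b) S) (insert (a, d) (insert (d, b) S)) := by
  have h' := h.subdivide hd hS hdS
  have hab : a ≠ b := h.gen.ne (a, b) (Or.inl rfl)
  refine Relation.EqvGen.rel _ _ (Or.inl ⟨a, b, d, replaces_draw hL h h', ?_⟩)
  rw [draw_rest hS]
  -- the move takes place across the degenerate triangle `a b d`
  have htri : triangle a b d ⊆ seg (a, b) := by
    rw [triangle]
    refine convexHull_min ?_ (convex_segment _ _)
    rintro z (rfl | rfl | rfl)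
    · exact fst_mem_seg (z, b)
    · exact snd_mem_seg (a, z)
    · exact openSeg_subset _ hd
  have hfS : ∀ f ∈ S, f ≠ (a, b) := fun f hf h' => hS (h' ▸ hf)
  have hend : ∀ f ∈ S, ∀ z, z ∈ seg f → z ∈ openSeg (a, b) → z ∈ openSeg f := by
    intro f hf z hz hz'
    rcases mem_seg_iff.1 hz with rfl | rfl | h3
    · exact absurd hz' (h.gen.notMem_openSeg (fst_mem_verts (Or.inr hf)) (e := (a, b)) (Or.inl rfl))
    · exact absurd hz' (h.gen.notMem_openSeg (snd_mem_verts (Or.inr hf)) (e := (a, b)) (Or.inl rfl))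
    · exact h3
  refine ⟨fun f hf => ?_, ?_⟩
  · by_cases hc : Crosses f (a, b)
    · right
      obtain ⟨z, hzf, hz⟩ := hc
      have uniq : ∀ z' ∈ openSeg f, z' ∈ openSeg (a, b) → z' = z := fun z' h1 h2 =>
        h.gen.eq_of_mem_openSeg (Or.inr hf) (Or.inl rfl) (hfS f hf) h1 h2
          (openSeg_subset _ hzf) (openSeg_subset _ hz)
      refine ⟨⟨z, hzf, hz⟩, ?_, ?_⟩
      · rcases mem_openSeg_cases hd hz with h1 | rfl | h1
        · refine Or.inl ⟨⟨z, hzf, h1⟩, ?_⟩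
          rintro ⟨z', h2, h3⟩
          obtain rfl := uniq z' h2 (openSeg_right_subset hd h3)
          exact openSeg_disjoint hd hab (openSeg_subset _ h1) h3
        · exact absurd (openSeg_subset _ hzf) (hdS f hf)
        · refine Or.inr ⟨⟨z, hzf, h1⟩, ?_⟩
          rintro ⟨z', h2, h3⟩
          obtain rfl := uniq z' h2 (openSeg_left_subset hd h3)
          exact openSeg_disjoint hd hab (openSeg_subset _ h3) h1
      · rintro g hg ⟨y, hyf, hyg⟩
        have hgsub : openSeg g ⊆ openSeg (a, b) := by
          rcases hg with rfl | rfl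
          · exact openSeg_left_subset hd
          · exact openSeg_right_subset hd
        obtain rfl := uniq y hyf (hgsub hyg)
        have hgmem : g ∈ insert (a, d) (insert (d, b) S) := by
          rcases hg with rfl | rfl
          · exact Or.inl rfl
          · exact Or.inr (Or.inl rfl)
        obtain ⟨k, hk0, hk⟩ : ∃ k : ℝ, k ≠ 0 ∧ g.2 - g.1 = k • (b - a) := by
          obtain ⟨s, h0, h1, rfl⟩ := mem_openSeg.1 hd
          rcases hg with rfl | rfl
          · exact ⟨s, h0.ne', by dsimp only; module⟩
          · exact ⟨1 - s, by linarith, by dsimp only; module⟩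
        have hfm : f ∈ insert (a, d) (insert (d, b) S) := Or.inr (Or.inr hf)
        have hfm' : f ∈ insert (a, b) S := Or.inr hf
        have habm : (a, b) ∈ insert (a, b) S := Or.inl rfl
        -- the half `g` is parallel to the whole edge, so the marker designates the same over branch
        constructor
        · constructor
          · rintro ⟨-, -, m, hm, h1, h2, h3, h4⟩
            refine ⟨habm, hfm', m, hm, hgsub h1, h2, ?_, h4⟩
            rw [hk, det_smul_left] at h3
            exact (mul_eq_zero.1 h3).resolve_left hk0
          · rintro ⟨-, -, m, hm, h1, h2, h3, h4⟩
            refine ⟨hgmem, hfm, m, hm, ?_, h2, ?_, h4⟩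
            · rw [uniq _ h2 h1]; exact hyg
            · rw [hk, det_smul_left]
              exact mul_eq_zero_of_right _ h3
        · constructor
          · rintro ⟨-, -, m, hm, h1, h2, h3, h4⟩
            refine ⟨hfm', habm, m, hm, h1, hgsub h2, h3, ?_⟩
            rw [hk, det_smul_left] at h4
            exact right_ne_zero_of_mul h4
          · rintro ⟨-, -, m, hm, h1, h2, h3, h4⟩
            refine ⟨hfm, hgmem, m, hm, h1, ?_, h3, ?_⟩
            · rw [uniq _ h1 h2]; exact hyg
            · rw [hk, det_smul_left]
              exact mul_ne_zero hk0 h4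
    · left
      intro z hz hzt
      rcases mem_seg_iff.1 (htri hzt) with h1 | h1 | h1
      · exact Or.inl h1
      · exact Or.inr h1
      · exact absurd ⟨z, hend f hf z hz h1, h1⟩ hc
  · rintro f hf g hg hfg ⟨z, ⟨hzf, hzg⟩, hzt⟩
    rcases mem_seg_iff.1 (htri hzt) with rfl | rfl | h1
    · exact h.gen.notMem_openSeg (fst_mem_verts (mem_insert (z, b) S)) (Or.inr hf) hzf
    · exact h.gen.notMem_openSeg (snd_mem_verts (mem_insert (a, z) S)) (Or.inr hf) hzf
    · have := h.gen.no_triple f (Or.inr hf) g (Or.inr hg) (a, b) (Or.inl rfl) hfg (hfS g hg)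
        (hfS f hf)
      rw [eq_empty_iff_forall_notMem] at this
      exact this z ⟨⟨hzf, hzg⟩, h1⟩

end subdivision

/-! ### Reversal of the orientation -/

/-- The drawing with all orientations reversed. -/
def reverse (D : Drawing) : Drawing where
  edges := Prod.swap ⁻¹' D.edges
  isOver e f := D.isOver e.swap f.swap

theorem crosses_swap_left {e f : Edge} : Crosses e.swap f ↔ Crosses e f := by
  rw [Crosses, Crosses, openSeg_swap]

theorem crosses_swap_right {e f : Edge} : Crosses e f.swap ↔ Crosses e f := by
  rw [Crosses, Crosses, openSeg_swap]

theorem crosses_pair_swap {e : Edge} {a b : Plane} : Crosses e (a, b) ↔ Crosses e (b, a) :=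
  crosses_swap_right (f := (b, a))

theorem IsLinkDiagram.reverse {D : Drawing} (h : D.IsLinkDiagram) :
    (reverse D).IsLinkDiagram where
  generic :=
    { finite := h.generic.finite.preimage Prod.swap_injective.injOn
      ne := fun e he => (h.generic.ne _ he).symm
      not_opposite := fun e he he' => h.generic.not_opposite _ he he'
      vertex := fun e he f hf v hv hve =>
        (h.generic.vertex _ he _ hf v hv.symm (by rwa [seg_swap])).symm
      no_triple := fun e he f hf g hg hef hfg heg => by
        have := h.generic.no_triple _ he _ hf _ hg (Prod.swap_injective.ne hef)
          (Prod.swap_injective.ne hfg) (Prod.swap_injective.ne heg)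
        simpa only [openSeg_swap] using this
      isOver_spec := fun e f ho => by
        obtain ⟨h1, h2, h3, h4, h5⟩ := h.generic.isOver_spec _ _ ho
        refine ⟨h1, h2, fun h' => h3 (h' ▸ rfl), ?_, h5⟩
        rwa [crosses_swap_left, crosses_swap_right] at h4 }
  next := fun e he => h.prev _ he
  prev := fun e he => h.next _ he

theorem mem_rest_reverse {D : Drawing} {a b : Plane} {e : Edge} :
    e ∈ (reverse D).rest b a ↔ e.swap ∈ D.rest a b := by
  refine and_congr Iff.rfl (not_congr ?_)
  rw [mem_singleton_iff, mem_singleton_iff]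
  constructor
  · rintro rfl; rfl
  · intro h
    rw [← Prod.swap_swap e, h]; rfl

theorem Replaces.reverse {D D' : Drawing} {a b c : Plane} (h : Replaces D D' a b c) :
    Replaces (reverse D) (reverse D') b a c where
  source := IsLinkDiagram.reverse h.source
  target := IsLinkDiagram.reverse h.target
  mem := h.mem
  edges_eq := by
    ext e
    rw [mem_union, mem_rest_reverse]
    change e.swap ∈ D'.edges ↔ _
    rw [h.edges_eq]
    obtain ⟨x, y⟩ := e
    simp only [mem_union, mem_insert_iff, mem_singleton_iff, Prod.swap_prod_mk, Prod.mk.injEq]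
    tauto
  isOver_iff := fun e he f hf =>
    h.isOver_iff _ (mem_rest_reverse.1 he) _ (mem_rest_reverse.1 hf)

theorem Avoids.reverse {a b c : Plane} {f : Edge} (h : Avoids a b c f.swap) : Avoids b a c f := by
  intro z hz hzt
  rw [triangle_swap] at hzt
  exact (h z (by rwa [seg_swap]) hzt).symm

theorem PassesThrough.reverse {D D' : Drawing} {a b c : Plane} {f : Edge}
    (h : PassesThrough D D' a b c f.swap) :
    PassesThrough (reverse D) (reverse D') b a c f where
  old := crosses_pair_swap.1 (crosses_swap_left.1 h.old)
  new := by
    have := h.new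
    rw [crosses_swap_left, crosses_swap_left, crosses_pair_swap,
      crosses_pair_swap (a := c) (b := b)] at this
    exact this.symm
  type_eq := by
    intro g hg hfg
    refine h.type_eq g.swap ?_ ?_
    · rcases hg with rfl | rfl
      · exact Or.inr rfl
      · exact Or.inl rfl
    · rwa [crosses_swap_left, crosses_swap_right]

theorem crossInside_reverse {a b c : Plane} {f g : Edge} :
    CrossInside b a c f g ↔ CrossInside a b c f.swap g.swap := by
  rw [CrossInside, CrossInside, openSeg_swap, openSeg_swap, triangle_swap]

theorem AdmissibleTriple.reverse {D : Drawing} {e f g : Edge} (h : D.AdmissibleTriple e f g) :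
    (reverse D).AdmissibleTriple e.swap f.swap g.swap := by
  obtain ⟨x, y, z, hp, h⟩ := h
  exact ⟨x.swap, y.swap, z.swap, hp.map Prod.swap, h⟩

/-- Augmented moves stay augmented moves when all orientations are reversed; the end points of the
moved edge change their roles. -/
theorem AugmentedMove.reverse {D D' : Drawing} (h : AugmentedMove D D') :
    AugmentedMove (reverse D) (reverse D') := by
  have key : ∀ {a b c : Plane} {f : Edge}, Avoids a b c f.swap ∨ PassesThrough D D' a b c f.swap →
      Avoids b a c f ∨ PassesThrough (VirtualLink.reverse D) (VirtualLink.reverse D') b a c f :=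
    fun h => h.imp Avoids.reverse PassesThrough.reverse
  have swap_ne : ∀ {f g : Edge}, f ≠ g → f.swap ≠ g.swap := fun h => Prod.swap_injective.ne h
  rcases h with ⟨a, b, c, h1, h2, h3⟩ | ⟨a, b, c, k, h1, hk, hk', h2, h3⟩ |
    ⟨a, b, c, k, h1, hk, hk1, hk2, ho1, ho2, h2, h3⟩ |
    ⟨a, b, c, k, l, h1, hk, hl, hkl, hc, hadm, h2, h3⟩
  · refine Or.inl ⟨b, a, c, h1.reverse, fun f hf => key (h2 _ (mem_rest_reverse.1 hf)), ?_⟩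
    intro f hf g hg hfg hc
    exact h3 _ (mem_rest_reverse.1 hf) _ (mem_rest_reverse.1 hg) (swap_ne hfg)
      (crossInside_reverse.1 hc)
  · refine Or.inr (Or.inl ⟨b, a, c, k.swap, h1.reverse, mem_rest_reverse.2 hk, ?_, ?_, ?_⟩)
    · rw [crosses_swap_left, crosses_swap_left, crosses_pair_swap, crosses_pair_swap (a := b)]
      exact hk'.symm
    · intro f hf hfk
      exact key (h2 _ (mem_rest_reverse.1 hf) fun h' => hfk (by rw [← h', Prod.swap_swap]))
    · intro f hf g hg hfg hc
      exact h3 _ (mem_rest_reverse.1 hf) _ (mem_rest_reverse.1 hg) (swap_ne hfg)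
        (crossInside_reverse.1 hc)
  · refine Or.inr (Or.inr (Or.inl ⟨b, a, c, k.swap, h1.reverse, mem_rest_reverse.2 hk, ?_, ?_,
      ho1.symm, ho2.symm, ?_, ?_⟩))
    · rw [crosses_swap_left, crosses_pair_swap]; exact hk2
    · rw [crosses_swap_left, crosses_pair_swap]; exact hk1
    · intro f hf hfk
      exact key (h2 _ (mem_rest_reverse.1 hf) fun h' => hfk (by rw [← h', Prod.swap_swap]))
    · intro f hf g hg hfg hc
      exact h3 _ (mem_rest_reverse.1 hf) _ (mem_rest_reverse.1 hg) (swap_ne hfg)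
        (crossInside_reverse.1 hc)
  · refine Or.inr (Or.inr (Or.inr ⟨b, a, c, k.swap, l.swap, h1.reverse, mem_rest_reverse.2 hk,
      mem_rest_reverse.2 hl, swap_ne hkl, crossInside_reverse.2 hc, AdmissibleTriple.reverse hadm,
      fun f hf => key (h2 _ (mem_rest_reverse.1 hf)), ?_⟩))
    intro f hf g hg hfg hc
    refine (h3 _ (mem_rest_reverse.1 hf) _ (mem_rest_reverse.1 hg) (swap_ne hfg)
      (crossInside_reverse.1 hc)).imp ?_ ?_
    · rintro ⟨rfl, rfl⟩; exact ⟨rfl, rfl⟩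
    · rintro ⟨rfl, rfl⟩; exact ⟨rfl, rfl⟩

theorem VirtuallyIsotopic.reverse {D D' : Drawing} (h : VirtuallyIsotopic D D') :
    VirtuallyIsotopic (reverse D) (reverse D') := by
  induction h with
  | rel _ _ h => exact Relation.EqvGen.rel _ _ (AugmentedMove.reverse h)
  | refl _ => exact Relation.EqvGen.refl _
  | symm _ _ _ ih => exact Relation.EqvGen.symm _ _ ih
  | trans _ _ _ _ _ ih ih' => exact Relation.EqvGen.trans _ _ _ ih ih'

theorem reverse_draw (S : Set Edge) (L : Markers) :
    reverse (draw S L) = draw (Prod.swap ⁻¹' S) L := by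
  refine Drawing.ext rfl ?_
  funext e f
  simp only [VirtualLink.reverse, draw, openSeg_swap, mem_preimage, Prod.fst_swap, Prod.snd_swap]
  have : ∀ (e : Edge) (w : Plane), det (e.1 - e.2) w = - det (e.2 - e.1) w := by
    intro e w; simp [det]; ring
  simp only [this, neg_eq_zero, ne_eq]

theorem VI.reverse {L : Markers} {S T : Set Edge} (h : VI L S T) :
    VI L (Prod.swap ⁻¹' S) (Prod.swap ⁻¹' T) := by
  have := VirtuallyIsotopic.reverse h
  rwa [reverse_draw, reverse_draw] at this

theorem preimage_swap_insert (a b : Plane) (S : Set Edge) :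
    Prod.swap ⁻¹' (insert (a, b) S) = insert (b, a) (Prod.swap ⁻¹' S) := by
  ext ⟨x, y⟩
  simp only [mem_preimage, mem_insert_iff, Prod.swap_prod_mk, Prod.mk.injEq]
  tauto

theorem GenPos.reverse {S : Set Edge} (h : GenPos S) : GenPos (Prod.swap ⁻¹' S) where
  finite := h.finite.preimage Prod.swap_injective.injOn
  ne := fun e he => (h.ne _ he).symm
  not_opposite := fun e he he' => h.not_opposite _ he he'
  vertex := fun e he f hf v hv hve => (h.vertex _ he _ hf v hv.symm (by rwa [seg_swap])).symm
  no_triple := fun e he f hf g hg hef hfg heg => by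
    have := h.no_triple _ he _ hf _ hg (Prod.swap_injective.ne hef)
      (Prod.swap_injective.ne hfg) (Prod.swap_injective.ne heg)
    simpa only [openSeg_swap] using this

theorem Diag.reverse {S : Set Edge} (h : Diag S) : Diag (Prod.swap ⁻¹' S) where
  gen := h.gen.reverse
  link :=
    { outInj := fun e he f hf hef => Prod.swap_injective (h.link.inInj _ he _ hf hef)
      inInj := fun e he f hf hef => Prod.swap_injective (h.link.outInj _ he _ hf hef)
      succ := fun e he => by
        obtain ⟨f, hf, hfe⟩ := h.link.pred _ he
        exact ⟨f.swap, by simpa using hf, hfe⟩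
      pred := fun e he => by
        obtain ⟨f, hf, hfe⟩ := h.link.succ _ he
        exact ⟨f.swap, by simpa using hf, hfe⟩ }

theorem verts_reverse (S : Set Edge) : verts (Prod.swap ⁻¹' S) = verts S := by
  ext v
  constructor
  · rintro ⟨e, he, hv⟩
    exact ⟨e.swap, he, hv.symm⟩
  · rintro ⟨e, he, hv⟩
    exact ⟨e.swap, by simpa using he, hv.symm⟩

theorem crossPts_reverse (S : Set Edge) : crossPts (Prod.swap ⁻¹' S) = crossPts S := by
  have key : ∀ T : Set Edge, crossPts (Prod.swap ⁻¹' T) ⊆ crossPts T := by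
    rintro T z ⟨e, he, f, hf, hef, hze, hzf⟩
    exact ⟨e.swap, he, f.swap, hf, Prod.swap_injective.ne hef, by rwa [openSeg_swap],
      by rwa [openSeg_swap]⟩
  refine (key S).antisymm ?_
  have := key (Prod.swap ⁻¹' S)
  rwa [← preimage_comp, Prod.swap_swap_eq, preimage_id] at this

/-! ### Coordinates adapted to a triangle -/

/-- A non-degenerate triangle, with an apex `C` from which the opposite side `p q` is seen. -/
structure Frame where
  C : Plane
  p : Plane
  q : Plane
  nondeg : det (p - C) (q - C) ≠ 0

namespace Frame

variable (F : Frame)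

/-- The affine function that is `0` at the apex and `1` on the opposite side. -/
noncomputable def lam (z : Plane) : ℝ := det (z - F.C) (F.q - F.p) / det (F.p - F.C) (F.q - F.C)

/-- The affine function that is `0` on the line through `C` and `p`, and `1` at `q`. -/
noncomputable def bet (z : Plane) : ℝ := det (F.p - F.C) (z - F.C) / det (F.p - F.C) (F.q - F.C)

/-- The point of the side `p q` with parameter `t`; the ray from the apex through it consists of the
points with `bet = t * lam`. -/
def pt (t : ℝ) : Plane := F.p + t • (F.q - F.p)

theorem lam_comb (x y : Plane) (s : ℝ) :
    F.lam (x + s • (y - x)) = F.lam x + s * (F.lam y - F.lam x) := by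
  have := F.nondeg
  rw [lam, lam, lam]; field_simp; simp [det]; ring

theorem bet_comb (x y : Plane) (s : ℝ) :
    F.bet (x + s • (y - x)) = F.bet x + s * (F.bet y - F.bet x) := by
  have := F.nondeg
  rw [bet, bet, bet]; field_simp; simp [det]; ring

@[simp] theorem lam_C : F.lam F.C = 0 := by simp [lam]

@[simp] theorem bet_C : F.bet F.C = 0 := by simp [bet]

@[simp] theorem lam_pt (t : ℝ) : F.lam (F.pt t) = 1 := by
  have := F.nondeg
  rw [lam, pt, div_eq_one_iff_eq this]; simp [det]; ring

@[simp] theorem bet_pt (t : ℝ) : F.bet (F.pt t) = t := by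
  have := F.nondeg
  rw [bet, pt, div_eq_iff this]; simp [det]; ring

@[simp] theorem pt_zero : F.pt 0 = F.p := by simp [pt]

@[simp] theorem pt_one : F.pt 1 = F.q := by simp [pt]

@[simp] theorem lam_p : F.lam F.p = 1 := by simpa using F.lam_pt 0

@[simp] theorem lam_q : F.lam F.q = 1 := by simpa using F.lam_pt 1

@[simp] theorem bet_p : F.bet F.p = 0 := by simpa using F.bet_pt 0

@[simp] theorem bet_q : F.bet F.q = 1 := by simpa using F.bet_pt 1

theorem eq_comb (z : Plane) :
    z = F.C + (F.lam z - F.bet z) • (F.p - F.C) + F.bet z • (F.q - F.C) := by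
  have := F.nondeg
  have h : ∀ x y d : ℝ, d ≠ 0 → x * d = y → x = y / d := fun x y d hd h => by
    rw [← h]; field_simp
  ext
  · simp only [lam, bet, Prod.fst_add, Prod.smul_fst, smul_eq_mul]
    rw [← sub_div, div_mul_eq_mul_div, div_mul_eq_mul_div, add_assoc, ← add_div,
      ← sub_eq_iff_eq_add']
    refine h _ _ _ this ?_
    simp [det]; ring
  · simp only [lam, bet, Prod.snd_add, Prod.smul_snd, smul_eq_mul]
    rw [← sub_div, div_mul_eq_mul_div, div_mul_eq_mul_div, add_assoc, ← add_div,
      ← sub_eq_iff_eq_add']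
    refine h _ _ _ this ?_
    simp [det]; ring

theorem ext_coord {z w : Plane} (h1 : F.lam z = F.lam w) (h2 : F.bet z = F.bet w) : z = w := by
  rw [F.eq_comb z, F.eq_comb w, h1, h2]

theorem pt_injective : Function.Injective F.pt := fun s t h => by
  simpa using congrArg F.bet h

theorem continuous_lam : Continuous F.lam := by
  unfold lam det; fun_prop

theorem continuous_bet : Continuous F.bet := by
  unfold bet det; fun_prop

/-- A point is collinear with the apex and `pt t` exactly when `bet = t * lam`. -/
theorem det_pt_eq_zero_iff (t : ℝ) (z : Plane) :
    det (F.pt t - F.C) (z - F.C) = 0 ↔ F.bet z = t * F.lam z := by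
  have := F.nondeg
  rw [lam, bet, ← mul_div_assoc, div_left_inj' this, ← sub_eq_zero (a := det (F.p - F.C) _)]
  have : det (F.pt t - F.C) (z - F.C) =
      det (F.p - F.C) (z - F.C) - t * det (z - F.C) (F.q - F.p) := by
    simp [pt, det]; ring
  rw [this]

theorem mem_seg_ray {t : ℝ} {z : Plane} :
    z ∈ seg (F.pt t, F.C) ↔ F.bet z = t * F.lam z ∧ 0 ≤ F.lam z ∧ F.lam z ≤ 1 := by
  rw [mem_seg]
  constructor
  · rintro ⟨s, h0, h1, rfl⟩
    simp only [lam_comb, bet_comb, lam_pt, bet_pt, lam_C, bet_C]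
    refine ⟨by ring, by linarith, by linarith⟩
  · rintro ⟨h, h0, h1⟩
    refine ⟨1 - F.lam z, by linarith, by linarith, F.ext_coord ?_ ?_⟩
    · simp only [lam_comb, lam_pt, lam_C]; ring
    · simp only [bet_comb, bet_pt, bet_C, h]; ring

theorem mem_openSeg_ray {t : ℝ} {z : Plane} :
    z ∈ openSeg (F.pt t, F.C) ↔ F.bet z = t * F.lam z ∧ 0 < F.lam z ∧ F.lam z < 1 := by
  rw [mem_openSeg]
  constructor
  · rintro ⟨s, h0, h1, rfl⟩
    simp only [lam_comb, bet_comb, lam_pt, bet_pt, lam_C, bet_C]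
    refine ⟨by ring, by linarith, by linarith⟩
  · rintro ⟨h, h0, h1⟩
    refine ⟨1 - F.lam z, by linarith, by linarith, F.ext_coord ?_ ?_⟩
    · simp only [lam_comb, lam_pt, lam_C]; ring
    · simp only [bet_comb, bet_pt, bet_C, h]; ring

theorem mem_openSeg_side {t t' : ℝ} (htt' : t < t') {z : Plane} :
    z ∈ openSeg (F.pt t, F.pt t') ↔ F.lam z = 1 ∧ t < F.bet z ∧ F.bet z < t' := by
  rw [mem_openSeg]
  constructor
  · rintro ⟨s, h0, h1, rfl⟩
    simp only [lam_comb, bet_comb, lam_pt, bet_pt]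
    refine ⟨by ring, by nlinarith, by nlinarith⟩
  · rintro ⟨h, h0, h1⟩
    have : t' - t ≠ 0 := by linarith
    refine ⟨(F.bet z - t) / (t' - t), div_pos (by linarith) (by linarith),
      (div_lt_one (by linarith)).2 (by linarith), F.ext_coord ?_ ?_⟩
    · simp only [lam_comb, lam_pt, h]; ring
    · simp only [bet_comb, bet_pt]; field_simp; ring

theorem mem_seg_side {t t' : ℝ} (htt' : t ≤ t') {z : Plane} (hz : z ∈ seg (F.pt t, F.pt t')) :
    F.lam z = 1 ∧ t ≤ F.bet z ∧ F.bet z ≤ t' := by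
  obtain ⟨s, h0, h1, rfl⟩ := mem_seg.1 hz
  simp only [lam_comb, bet_comb, lam_pt, bet_pt]
  refine ⟨by ring, by nlinarith, by nlinarith⟩

/-- The sector of the triangle between the parameters `t` and `t'`. -/
theorem mem_sector {t t' : ℝ} (htt' : t < t') {z : Plane} :
    z ∈ triangle (F.pt t) F.C (F.pt t') ↔
      0 ≤ F.lam z ∧ F.lam z ≤ 1 ∧ t * F.lam z ≤ F.bet z ∧ F.bet z ≤ t' * F.lam z := by
  rw [mem_triangle]
  have hl : ∀ s r : ℝ, F.lam (F.pt t + s • (F.C - F.pt t) + r • (F.pt t' - F.pt t)) = 1 - s := by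
    intro s r
    have := F.nondeg
    rw [lam, div_eq_iff this]; simp [pt, det]; ring
  have hb : ∀ s r : ℝ, F.bet (F.pt t + s • (F.C - F.pt t) + r • (F.pt t' - F.pt t)) =
      t * (1 - s) + r * (t' - t) := by
    intro s r
    have := F.nondeg
    rw [bet, div_eq_iff this]; simp [pt, det]; ring
  constructor
  · rintro ⟨s, r, hs, hr, hsr, rfl⟩
    rw [hl, hb]
    exact ⟨by linarith, by linarith, by nlinarith, by nlinarith⟩
  · rintro ⟨h0, h1, h2, h3⟩
    have hpos : 0 < t' - t := by linarith
    refine ⟨1 - F.lam z, (F.bet z - t * F.lam z) / (t' - t), by linarith,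
      div_nonneg (by linarith) hpos.le, ?_, F.ext_coord ?_ ?_⟩
    · have : (F.bet z - t * F.lam z) / (t' - t) ≤ F.lam z := by
        rw [div_le_iff₀ hpos]; linarith
      linarith
    · rw [hl]; ring
    · rw [hb, div_mul_cancel₀ _ hpos.ne']; ring

/-! ### Thin sectors around a ray -/

theorem eventually_of_lt {P : ℝ → Prop} {δ : ℝ} (hδ : 0 < δ) (h : ∀ ε, 0 < ε → ε < δ → P ε) :
    ∀ᶠ ε in 𝓝[>] (0 : ℝ), P ε := by
  filter_upwards [Ioo_mem_nhdsGT hδ] with ε hε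
  exact h ε hε.1 hε.2

theorem eventually_of_nhds {P : ℝ → Prop} {t₀ : ℝ} (h : ∀ᶠ t in 𝓝 t₀, P t) :
    ∀ᶠ ε in 𝓝[>] (0 : ℝ), ∀ t, t₀ - ε < t → t < t₀ + ε → P t := by
  obtain ⟨δ, hδ, h⟩ := Metric.eventually_nhds_iff.1 h
  refine eventually_of_lt hδ fun ε _ hε t h1 h2 => h ?_
  rw [Real.dist_eq, abs_lt]
  constructor <;> linarith

theorem exists_pos_of_compact {K : Set Plane} (hK : IsCompact K) {g : Plane → ℝ}
    (hg : Continuous g) (hpos : ∀ z ∈ K, 0 < g z) : ∃ δ > 0, ∀ z ∈ K, δ < g z := by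
  rcases K.eq_empty_or_nonempty with rfl | hne
  · exact ⟨1, one_pos, by simp⟩
  · obtain ⟨x, hx, hmin⟩ := hK.exists_isMinOn hne hg.continuousOn
    refine ⟨g x / 2, half_pos (hpos x hx), fun z hz => ?_⟩
    have h1 : g x ≤ g z := hmin hz
    have := hpos x hx
    linarith

/-- A compact set that misses a ray misses all thin sectors around it. -/
theorem eventually_disjoint {K : Set Plane} (hK : IsCompact K) {t₀ : ℝ}
    (h : ∀ z ∈ K, z ∉ seg (F.pt t₀, F.C)) :
    ∀ᶠ ε in 𝓝[>] (0 : ℝ), ∀ t t', t₀ - ε < t → t < t' → t' < t₀ + ε →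
      ∀ z ∈ K, z ∉ triangle (F.pt t) F.C (F.pt t') := by
  have hc : Continuous fun z => max |F.bet z - t₀ * F.lam z| (max (-F.lam z) (F.lam z - 1)) := by
    have := F.continuous_lam
    have := F.continuous_bet
    fun_prop
  obtain ⟨δ, hδ, hlt⟩ := exists_pos_of_compact hK hc fun z hz => by
    by_contra hcon
    rw [not_lt, max_le_iff, max_le_iff, abs_nonpos_iff] at hcon
    exact h z hz (F.mem_seg_ray.2 ⟨by linarith [hcon.1], by linarith [hcon.2.1],
      by linarith [hcon.2.2]⟩)
  refine eventually_of_lt hδ fun ε h0 hε t t' ht htt' ht' z hz hzt => ?_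
  obtain ⟨h1, h2, h3, h4⟩ := (F.mem_sector htt').1 hzt
  have h5 := hlt z hz
  rw [lt_max_iff, lt_max_iff, lt_abs] at h5
  rcases h5 with (h5 | h5) | h5 | h5 <;> nlinarith

/-- A compact set that misses a point of the side misses short intervals of the side around it. -/
theorem eventually_notMem_side {K : Set Plane} (hK : IsCompact K) {t₀ : ℝ} (h : F.pt t₀ ∉ K) :
    ∀ᶠ ε in 𝓝[>] (0 : ℝ), ∀ t t', t₀ - ε < t → t < t' → t' < t₀ + ε →
      ∀ z ∈ K, z ∉ openSeg (F.pt t, F.pt t') := by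
  have hc : Continuous fun z => max |F.bet z - t₀| |F.lam z - 1| := by
    have := F.continuous_lam
    have := F.continuous_bet
    fun_prop
  obtain ⟨δ, hδ, hlt⟩ := exists_pos_of_compact hK hc fun z hz => by
    by_contra hcon
    rw [not_lt, max_le_iff, abs_nonpos_iff, abs_nonpos_iff] at hcon
    have : z = F.pt t₀ := F.ext_coord (by simp; linarith [hcon.2]) (by simp; linarith [hcon.1])
    exact h (this ▸ hz)
  refine eventually_of_lt hδ fun ε h0 hε t t' ht htt' ht' z hz hzt => ?_
  obtain ⟨h1, h2, h3⟩ := (F.mem_openSeg_side htt').1 hzt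
  have h5 := hlt z hz
  rw [h1, sub_self, abs_zero, lt_max_iff, lt_abs] at h5
  rcases h5 with (h5 | h5) | h5 <;> linarith

theorem eventually_avoids {f : Edge} {t₀ : ℝ} (h : ∀ z ∈ seg f, z ∉ seg (F.pt t₀, F.C)) :
    ∀ᶠ ε in 𝓝[>] (0 : ℝ), ∀ t t', t₀ - ε < t → t < t' → t' < t₀ + ε →
      Avoids (F.pt t) F.C (F.pt t') f := by
  filter_upwards [F.eventually_disjoint (isCompact_seg f) h] with ε hε t t' h1 h2 h3 z hz hzt
  exact absurd hzt (hε t t' h1 h2 h3 z hz)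

/-- The rate at which the signed distance from the ray with parameter `t` changes along `f`. -/
noncomputable def slope (t : ℝ) (f : Edge) : ℝ :=
  (F.bet f.2 - t * F.lam f.2) - (F.bet f.1 - t * F.lam f.1)

/-- The edge `f` crosses the line of the ray with parameter `t` transversally, at the interior
point with parameter `s`. -/
def CrossesRayAt (t : ℝ) (f : Edge) (s : ℝ) : Prop :=
  0 < s ∧ s < 1 ∧ F.slope t f ≠ 0 ∧ (F.bet f.1 - t * F.lam f.1) + s * F.slope t f = 0

theorem bet_sub_comb (t : ℝ) (f : Edge) (s : ℝ) :
    F.bet (f.1 + s • (f.2 - f.1)) - t * F.lam (f.1 + s • (f.2 - f.1)) =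
      (F.bet f.1 - t * F.lam f.1) + s * F.slope t f := by
  rw [lam_comb, bet_comb, slope]; ring

/-- Transversal crossings with a ray persist, and move continuously, if the ray is turned. -/
theorem eventually_crossesRayAt {t₀ s₀ : ℝ} {f : Edge} (h : F.CrossesRayAt t₀ f s₀) {η : ℝ}
    (hη : 0 < η) : ∀ᶠ t in 𝓝 t₀, ∃ s, F.CrossesRayAt t f s ∧ |s - s₀| < η := by
  obtain ⟨h0, h1, h2, h3⟩ := h
  have hc : Continuous fun t => F.slope t f := by unfold slope; fun_prop
  have hc' : ContinuousAt (fun t => -(F.bet f.1 - t * F.lam f.1) / F.slope t f) t₀ :=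
    ContinuousAt.div (by fun_prop) hc.continuousAt h2
  have hval : -(F.bet f.1 - t₀ * F.lam f.1) / F.slope t₀ f = s₀ := by
    rw [div_eq_iff h2]; linarith
  have hmem : Ioo (0 : ℝ) 1 ∩ {s | |s - s₀| < η} ∈
      𝓝 (-(F.bet f.1 - t₀ * F.lam f.1) / F.slope t₀ f) := by
    rw [hval]
    refine inter_mem (Ioo_mem_nhds h0 h1) ?_
    have := Metric.ball_mem_nhds s₀ hη
    exact this
  filter_upwards [hc'.eventually_mem hmem, hc.continuousAt.eventually_ne h2] with t ht ht'
  exact ⟨_, ⟨ht.1.1, ht.1.2, ht', by field_simp; ring⟩, ht.2⟩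

variable {F} in
theorem CrossesRayAt.unique {t : ℝ} {f : Edge} {s : ℝ} (h : F.CrossesRayAt t f s) {s' : ℝ}
    (h' : F.bet (f.1 + s' • (f.2 - f.1)) = t * F.lam (f.1 + s' • (f.2 - f.1))) : s' = s := by
  have h1 := F.bet_sub_comb t f s'
  obtain ⟨-, -, h2, h3⟩ := h
  have : (s' - s) * F.slope t f = 0 := by linarith
  linarith [(mul_eq_zero.1 this).resolve_right h2]

/-- If `f` crosses a ray transversally in its interior then it runs straight through all thin
sectors around the ray. -/
theorem eventually_straight {t₀ s₀ : ℝ} {f : Edge} (h : F.CrossesRayAt t₀ f s₀)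
    (h0 : 0 < F.lam (f.1 + s₀ • (f.2 - f.1))) (h1 : F.lam (f.1 + s₀ • (f.2 - f.1)) < 1) :
    ∀ᶠ ε in 𝓝[>] (0 : ℝ), ∀ t t', t₀ - ε < t → t < t' → t' < t₀ + ε →
      Straight (F.pt t) F.C (F.pt t') f := by
  have hcont : Continuous fun s : ℝ => F.lam (f.1 + s • (f.2 - f.1)) :=
    F.continuous_lam.comp (by fun_prop)
  obtain ⟨η, hη, hball⟩ := Metric.eventually_nhds_iff.1
    (hcont.continuousAt.eventually_mem (Ioo_mem_nhds h0 h1) : ∀ᶠ s in 𝓝 s₀, _)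
  have hcross : ∀ᶠ t in 𝓝 t₀, Crosses f (F.pt t, F.C) := by
    filter_upwards [F.eventually_crossesRayAt h hη] with t ⟨s, hs, hss⟩
    refine ⟨f.1 + s • (f.2 - f.1), mem_openSeg.2 ⟨s, hs.1, hs.2.1, rfl⟩, ?_⟩
    have h4 := F.bet_sub_comb t f s
    rw [hs.2.2.2] at h4
    exact F.mem_openSeg_ray.2 ⟨by linarith, hball (by rwa [Real.dist_eq])⟩
  have hnot : F.pt t₀ ∉ seg f := by
    intro hmem
    obtain ⟨s, -, -, hs⟩ := mem_seg.1 hmem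
    have : s = s₀ := h.unique (s' := s) (by rw [← hs]; simp)
    rw [this] at hs
    rw [← hs, lam_pt] at h1
    exact lt_irrefl _ h1
  filter_upwards [eventually_of_nhds hcross, F.eventually_notMem_side (isCompact_seg f) hnot]
    with ε hε hε' t t' ht htt' ht'
  refine ⟨hε t ht (by linarith), Or.inr ⟨hε t' (by linarith) ht', ?_⟩⟩
  rintro ⟨z, hz, hz'⟩
  exact hε' t t' ht htt' ht' z (openSeg_subset _ hz) hz'

/-- If `f` crosses the side of the triangle at the end of a ray, then in thin sectors around the ray
it either runs straight through or cuts off a corner. -/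
theorem eventually_straight_or_corner {t₀ s₀ : ℝ} {f : Edge} (h : F.CrossesRayAt t₀ f s₀)
    (h0 : f.1 + s₀ • (f.2 - f.1) = F.pt t₀) (h1 : F.lam f.2 ≠ F.lam f.1) :
    ∀ᶠ ε in 𝓝[>] (0 : ℝ), ∀ t t', t₀ - ε < t → t < t₀ → t₀ < t' → t' < t₀ + ε →
      Straight (F.pt t) F.C (F.pt t') f ∨
        (Crosses f (F.pt t, F.pt t') ∧ Crosses f (F.pt t', F.C)) := by
  have hl0 : F.lam f.1 + s₀ * (F.lam f.2 - F.lam f.1) = 1 := by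
    rw [← F.lam_comb, h0, lam_pt]
  have hcont : Continuous fun s : ℝ => F.lam (f.1 + s • (f.2 - f.1)) :=
    F.continuous_lam.comp (by fun_prop)
  obtain ⟨η, hη, hball⟩ := Metric.eventually_nhds_iff.1
    (hcont.continuousAt.eventually_mem (Ioi_mem_nhds (by simp only [h0, lam_pt]; norm_num :
      (0 : ℝ) < F.lam (f.1 + s₀ • (f.2 - f.1)))) : ∀ᶠ s in 𝓝 s₀, _)
  set c := (F.lam f.2 - F.lam f.1) * F.slope t₀ f with hc
  have hc0 : c ≠ 0 := mul_ne_zero (sub_ne_zero.2 h1) h.2.2.1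
  -- the crossing with a nearby ray lies inside or outside the triangle according to a sign
  have key : ∀ᶠ t in 𝓝 t₀, ∃ s, F.CrossesRayAt t f s ∧
      0 < F.lam (f.1 + s • (f.2 - f.1)) ∧
      F.slope t₀ f ^ 2 * (F.lam (f.1 + s • (f.2 - f.1)) - 1) =
        c * (t - t₀) * F.lam (f.1 + s • (f.2 - f.1)) := by
    filter_upwards [F.eventually_crossesRayAt h hη] with t ⟨s, hs, hss⟩
    refine ⟨s, hs, hball (by rwa [Real.dist_eq]), ?_⟩
    obtain ⟨-, -, -, h4⟩ := hs
    obtain ⟨-, -, -, h5⟩ := h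
    rw [lam_comb]
    have e1 : F.lam f.1 + s * (F.lam f.2 - F.lam f.1) - 1 = (F.lam f.2 - F.lam f.1) * (s - s₀) := by
      linear_combination hl0
    have e2 : F.slope t₀ f * (s - s₀) = (t - t₀) * (F.lam f.1 + s * (F.lam f.2 - F.lam f.1)) := by
      simp only [slope] at h4 h5 ⊢
      linear_combination h4 - h5
    rw [e1, hc]
    linear_combination (F.lam f.2 - F.lam f.1) * F.slope t₀ f * e2
  have hslope : 0 < F.slope t₀ f ^ 2 := by have := h.2.2.1; positivity
  have cross : ∀ t s, F.CrossesRayAt t f s → 0 < F.lam (f.1 + s • (f.2 - f.1)) →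
      F.lam (f.1 + s • (f.2 - f.1)) < 1 → Crosses f (F.pt t, F.C) := by
    intro t s hs hpos hlt
    refine ⟨_, mem_openSeg.2 ⟨s, hs.1, hs.2.1, rfl⟩, F.mem_openSeg_ray.2 ⟨?_, hpos, hlt⟩⟩
    have h4 := F.bet_sub_comb t f s
    rw [hs.2.2.2] at h4
    linarith
  filter_upwards [eventually_of_nhds key] with ε hε t t' ht htt₀ htt' ht'
  have hside : Crosses f (F.pt t, F.pt t') :=
    ⟨F.pt t₀, mem_openSeg.2 ⟨s₀, h.1, h.2.1, h0.symm⟩,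
      (F.mem_openSeg_side (htt₀.trans htt')).2 ⟨by simp, by simpa, by simpa⟩⟩
  obtain ⟨s, hs, hpos, hsgn⟩ := hε t ht (by linarith)
  obtain ⟨s', hs', hpos', hsgn'⟩ := hε t' (by linarith) ht'
  rcases lt_or_gt_of_ne hc0 with hneg | hposc
  · right
    refine ⟨hside, cross t' s' hs' hpos' ?_⟩
    have : c * (t' - t₀) * F.lam (f.1 + s' • (f.2 - f.1)) < 0 :=
      mul_neg_of_neg_of_pos (mul_neg_of_neg_of_pos hneg (by linarith)) hpos'
    nlinarith
  · left
    refine ⟨cross t s hs hpos ?_, Or.inl ⟨hside, ?_⟩⟩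
    · have : c * (t - t₀) * F.lam (f.1 + s • (f.2 - f.1)) < 0 :=
        mul_neg_of_neg_of_pos (mul_neg_of_pos_of_neg hposc (by linarith)) hpos
      nlinarith
    · rintro ⟨z, hz, hz'⟩
      obtain ⟨r, -, -, rfl⟩ := mem_openSeg.1 hz
      obtain ⟨h4, -, h5⟩ := F.mem_openSeg_ray.1 hz'
      obtain rfl := hs'.unique (s' := r) h4
      have : 0 < c * (t' - t₀) * F.lam (f.1 + r • (f.2 - f.1)) :=
        mul_pos (mul_pos hposc (by linarith)) hpos'
      nlinarith

end Frame

namespace Frame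

variable (F : Frame)

/-! ### Turning a path around a ray -/

/-- The edges `S` together with the path `p → pt t → C`. -/
def path (S : Set Edge) (t : ℝ) : Set Edge := insert (F.p, F.pt t) (insert (F.pt t, F.C) S)

/-- The parameter `t` is good if the path `p → pt t → C` gives a link diagram. -/
structure Good (S : Set Edge) (L : Markers) (t : ℝ) : Prop where
  diag : Diag (F.path S t)
  notMem : ∀ f ∈ S, F.pt t ∉ seg f
  free : Free L (F.pt t, F.C)

variable {F} {S : Set Edge} {L : Markers}

theorem p_ne_C (F : Frame) : F.p ≠ F.C := fun h => by
  simpa using congrArg F.lam h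

theorem q_ne_C (F : Frame) : F.q ≠ F.C := fun h => by
  simpa using congrArg F.lam h

theorem p_ne_q (F : Frame) : F.p ≠ F.q := fun h => by
  simpa using congrArg F.bet h

theorem pt_ne_C (F : Frame) (t : ℝ) : F.pt t ≠ F.C := fun h => by
  simpa using congrArg F.lam h

theorem free_side (h : Free L (F.p, F.q)) {t t' : ℝ} (h0 : 0 ≤ t) (htt' : t < t') (h1 : t' ≤ 1) :
    Free L (F.pt t, F.pt t') := by
  intro m hm hmem
  obtain ⟨h3, h4, h5⟩ := (F.mem_openSeg_side htt').1 hmem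
  refine h m hm ?_
  have := (F.mem_openSeg_side (zero_lt_one' ℝ) (z := m.1)).2 ⟨h3, by linarith, by linarith⟩
  simpa using this

theorem mem_triangle_of_mem_sector {t t' : ℝ} (h0 : 0 ≤ t) (htt' : t < t') (h1 : t' ≤ 1) {z : Plane}
    (hz : z ∈ triangle (F.pt t) F.C (F.pt t')) : z ∈ triangle F.p F.C F.q := by
  obtain ⟨h2, h3, h4, h5⟩ := (F.mem_sector htt').1 hz
  have := (F.mem_sector (zero_lt_one' ℝ) (z := z)).2 ⟨h2, h3, by nlinarith, by nlinarith⟩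
  simpa using this

/-- Turning the path from the parameter `t` to the parameter `t'` amounts to replacing
`pt t → C` by `pt t → pt t' → C`. -/
theorem VI_path_of_move (hL : Functional L) (hpq : Free L (F.p, F.q)) {t t' : ℝ} (h0 : 0 < t)
    (htt' : t < t') (h1 : t' ≤ 1) (g : F.Good S L t) (g' : F.Good S L t')
    (move : Diag (insert (F.pt t, F.C) (insert (F.p, F.pt t) S)) →
      Diag (insert (F.pt t, F.pt t') (insert (F.pt t', F.C) (insert (F.p, F.pt t) S))) →
      Free L (F.pt t, F.C) → Free L (F.pt t, F.pt t') → Free L (F.pt t', F.C) →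
      VI L (insert (F.pt t, F.C) (insert (F.p, F.pt t) S))
        (insert (F.pt t, F.pt t') (insert (F.pt t', F.C) (insert (F.p, F.pt t) S)))) :
    VI L (F.path S t) (F.path S t') := by
  have hmem : F.pt t ∈ openSeg (F.p, F.pt t') := by
    have := (F.mem_openSeg_side (h0.trans htt') (z := F.pt t)).2 ⟨by simp, by simpa, by simpa⟩
    simpa using this
  have hnot : (F.p, F.pt t') ∉ insert (F.pt t', F.C) S := by
    rintro (h | h)
    · exact F.pt_ne_C t' (congrArg Prod.snd h)
    · exact g'.notMem _ h (snd_mem_seg (F.p, F.pt t'))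
  have hdS : ∀ f ∈ insert (F.pt t', F.C) S, F.pt t ∉ seg f := by
    rintro f (rfl | hf)
    · intro h
      have := (F.mem_seg_ray.1 h).1
      simp at this
      linarith
    · exact g.notMem f hf
  have e : insert (F.p, F.pt t) (insert (F.pt t, F.pt t') (insert (F.pt t', F.C) S)) =
      insert (F.pt t, F.pt t') (insert (F.pt t', F.C) (insert (F.p, F.pt t) S)) := by
    rw [insert_comm, insert_comm (F.p, F.pt t)]
  have hsub := VI.subdivide hmem hL g'.diag hnot hdS
  have hdiag := g'.diag.subdivide hmem hnot hdS
  rw [e] at hsub hdiag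
  have e' : F.path S t = insert (F.pt t, F.C) (insert (F.p, F.pt t) S) := insert_comm _ _ _
  have hd := g.diag
  rw [e'] at hd ⊢
  exact (move hd hdiag g.free (free_side hpq h0.le htt' h1) g'.free).trans hsub.symm

theorem avoids_side (F : Frame) {t t' : ℝ} (h0 : 0 < t) (htt' : t < t') :
    Avoids (F.pt t) F.C (F.pt t') (F.p, F.pt t) := by
  intro z hz hzt
  have hz' : z ∈ seg (F.pt 0, F.pt t) := by simpa using hz
  obtain ⟨h1, -, h2⟩ := F.mem_seg_side h0.le hz'
  obtain ⟨-, -, h3, -⟩ := (F.mem_sector htt').1 hzt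
  left
  refine F.ext_coord (by simp [h1]) ?_
  rw [h1] at h3
  simp; linarith

theorem not_crossInside_side {t t' : ℝ} (h0 : 0 < t) (htt' : t < t') (f : Edge) :
    ¬ CrossInside (F.pt t) F.C (F.pt t') (F.p, F.pt t) f := by
  rintro ⟨z, ⟨hz, -⟩, hzt⟩
  have hz' : z ∈ openSeg (F.pt 0, F.pt t) := by simpa using hz
  obtain ⟨h1, -, h2⟩ := (F.mem_openSeg_side h0).1 hz'
  obtain ⟨-, -, h3, -⟩ := (F.mem_sector htt').1 hzt
  rw [h1] at h3
  linarith

theorem crossInside_comm {a b c : Plane} {f g : Edge} :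
    CrossInside a b c f g ↔ CrossInside a b c g f := by
  rw [CrossInside, CrossInside, inter_comm (openSeg f)]

section step

variable (hL : Functional L) (hpq : Free L (F.p, F.q)) {t t' : ℝ} (h0 : 0 < t)
    (htt' : t < t') (h1 : t' ≤ 1) (g : F.Good S L t) (g' : F.Good S L t')

include hL hpq h0 htt' h1 g g'

/-- Turning the path by a planar isotopy. -/
theorem VI_path_planar (h2 : ∀ f ∈ S, Avoids (F.pt t) F.C (F.pt t') f ∨
      Straight (F.pt t) F.C (F.pt t') f)
    (h3 : ∀ f ∈ S, ∀ g ∈ S, f ≠ g → ¬ CrossInside (F.pt t) F.C (F.pt t') f g) :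
    VI L (F.path S t) (F.path S t') := by
  refine VI_path_of_move hL hpq h0 htt' h1 g g' fun d d' f1 f2 f3 => ?_
  refine VI.planar hL d d' f1 f2 f3 ?_ ?_
  · rintro f (rfl | hf)
    · exact Or.inl (F.avoids_side h0 htt')
    · exact h2 f hf
  · rintro f (rfl | hf) k (rfl | hk) hfk
    · exact absurd rfl hfk
    · exact not_crossInside_side h0 htt' k
    · rw [crossInside_comm]; exact not_crossInside_side h0 htt' f
    · exact h3 f hf k hk hfk

/-- Turning the path by a second virtual Reidemeister move with the edge `e`. -/
theorem VI_path_two {e : Edge} (he : e ∈ S) (he1 : Crosses e (F.pt t, F.pt t'))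
    (he2 : Crosses e (F.pt t', F.C))
    (h2 : ∀ f ∈ S, f ≠ e → Avoids (F.pt t) F.C (F.pt t') f ∨ Straight (F.pt t) F.C (F.pt t') f)
    (h3 : ∀ f ∈ S, ∀ g ∈ S, f ≠ g → ¬ CrossInside (F.pt t) F.C (F.pt t') f g) :
    VI L (F.path S t) (F.path S t') := by
  refine VI_path_of_move hL hpq h0 htt' h1 g g' fun d d' f1 f2 f3 => ?_
  refine VI.two hL d d' f1 f2 f3 (Or.inr he) he1 he2 ?_ ?_
  · rintro f (rfl | hf) hfe
    · exact Or.inl (F.avoids_side h0 htt')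
    · exact h2 f hf hfe
  · rintro f (rfl | hf) k (rfl | hk) hfk
    · exact absurd rfl hfk
    · exact not_crossInside_side h0 htt' k
    · rw [crossInside_comm]; exact not_crossInside_side h0 htt' f
    · exact h3 f hf k hk hfk

/-- Turning the path across the crossing of `e` and `e'`, by a third virtual Reidemeister move or by
the special detour move. -/
theorem VI_path_three {e e' : Edge} (he : e ∈ S) (he' : e' ∈ S) (hee' : e ≠ e')
    (hc : CrossInside (F.pt t) F.C (F.pt t') e e')
    (h2 : ∀ f ∈ S, Avoids (F.pt t) F.C (F.pt t') f ∨ Straight (F.pt t) F.C (F.pt t') f)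
    (h3 : ∀ f ∈ S, ∀ g ∈ S, f ≠ g → CrossInside (F.pt t) F.C (F.pt t') f g →
      (f = e ∧ g = e') ∨ (f = e' ∧ g = e)) :
    VI L (F.path S t) (F.path S t') := by
  refine VI_path_of_move hL hpq h0 htt' h1 g g' fun d d' f1 f2 f3 => ?_
  refine VI.three hL d d' f1 f2 f3 (Or.inr he) (Or.inr he') hee' hc ?_ ?_
  · rintro f (rfl | hf)
    · exact Or.inl (F.avoids_side h0 htt')
    · exact h2 f hf
  · rintro f (rfl | hf) k (rfl | hk) hfk hc
    · exact absurd rfl hfk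
    · exact absurd hc (not_crossInside_side h0 htt' k)
    · exact absurd (crossInside_comm.1 hc) (not_crossInside_side h0 htt' f)
    · exact h3 f hf k hk hfk hc

end step

/-! ### Crossing a single event that is not a vertex -/

/-- The edge `f` is disjoint from the ray with parameter `t`, or meets the triangle in the apex
only, or crosses the interior of the ray transversally. -/
def Tame (F : Frame) (t : ℝ) (f : Edge) : Prop :=
  (∀ z ∈ seg f, z ∉ seg (F.pt t, F.C)) ∨ (∀ z ∈ seg f, z ∈ triangle F.p F.C F.q → z = F.C) ∨
    ∃ s, F.CrossesRayAt t f s ∧ 0 < F.lam (f.1 + s • (f.2 - f.1)) ∧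
      F.lam (f.1 + s • (f.2 - f.1)) < 1

theorem eventually_of_tame {t₀ : ℝ} {f : Edge} (h : F.Tame t₀ f) :
    ∀ᶠ ε in 𝓝[>] (0 : ℝ), ∀ t t', t₀ - ε < t → t < t' → t' < t₀ + ε → 0 ≤ t → t' ≤ 1 →
      Avoids (F.pt t) F.C (F.pt t') f ∨ Straight (F.pt t) F.C (F.pt t') f := by
  rcases h with h | h | ⟨s, h, h0, h1⟩
  · filter_upwards [F.eventually_avoids h] with ε hε t t' h1 h2 h3 _ _
    exact Or.inl (hε t t' h1 h2 h3)
  · refine Eventually.of_forall fun ε t t' h1 h2 h3 h4 h5 => Or.inl fun z hz hzt => ?_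
    exact Or.inr (h z hz (mem_triangle_of_mem_sector h4 h2 h5 hzt))
  · filter_upwards [F.eventually_straight h h0 h1] with ε hε t t' h1 h2 h3 _ _
    exact Or.inr (hε t t' h1 h2 h3)

theorem eventually_all_tame (hfin : S.Finite) {t₀ : ℝ} {P : Edge → Prop}
    (h : ∀ f ∈ S, P f → F.Tame t₀ f) :
    ∀ᶠ ε in 𝓝[>] (0 : ℝ), ∀ t t', t₀ - ε < t → t < t' → t' < t₀ + ε → 0 ≤ t → t' ≤ 1 →
      ∀ f ∈ S, P f → Avoids (F.pt t) F.C (F.pt t') f ∨ Straight (F.pt t) F.C (F.pt t') f := by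
  have : ∀ᶠ ε in 𝓝[>] (0 : ℝ), ∀ f ∈ S, P f → ∀ t t', t₀ - ε < t → t < t' → t' < t₀ + ε → 0 ≤ t →
      t' ≤ 1 → Avoids (F.pt t) F.C (F.pt t') f ∨ Straight (F.pt t) F.C (F.pt t') f := by
    rw [eventually_all_finite hfin]
    intro f hf
    by_cases hP : P f
    · filter_upwards [eventually_of_tame (h f hf hP)] with ε hε _
      exact hε
    · exact Eventually.of_forall fun ε h' => absurd h' hP
  filter_upwards [this] with ε hε t t' h1 h2 h3 h4 h5 f hf hP
  exact hε f hf hP t t' h1 h2 h3 h4 h5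

/-- Two edges that cross in a thin sector around a ray cross on the ray. -/
theorem eventually_crossInside (hgen : GenPos S) (t₀ : ℝ) :
    ∀ᶠ ε in 𝓝[>] (0 : ℝ), ∀ t t', t₀ - ε < t → t < t' → t' < t₀ + ε →
      ∀ f ∈ S, ∀ g ∈ S, f ≠ g → CrossInside (F.pt t) F.C (F.pt t') f g →
        ∃ z, z ∈ openSeg f ∧ z ∈ openSeg g ∧ z ∈ seg (F.pt t₀, F.C) := by
  have : ∀ᶠ ε in 𝓝[>] (0 : ℝ), ∀ z ∈ crossPts S, z ∉ seg (F.pt t₀, F.C) →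
      ∀ t t', t₀ - ε < t → t < t' → t' < t₀ + ε → z ∉ triangle (F.pt t) F.C (F.pt t') := by
    rw [eventually_all_finite hgen.finite_crossPts]
    intro z hz
    by_cases hzr : z ∈ seg (F.pt t₀, F.C)
    · exact Eventually.of_forall fun ε h => absurd hzr h
    · filter_upwards [F.eventually_disjoint (isCompact_singleton (x := z)) (t₀ := t₀)
        (by rintro _ rfl; exact hzr)] with ε hε _ t t' h1 h2 h3
      exact hε t t' h1 h2 h3 z rfl
  filter_upwards [this] with ε hε t t' h1 h2 h3 f hf g hg hfg
  rintro ⟨z, ⟨hzf, hzg⟩, hzt⟩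
  refine ⟨z, hzf, hzg, ?_⟩
  by_contra hzr
  exact hε z ⟨f, hf, g, hg, hfg, hzf, hzg⟩ hzr t t' h1 h2 h3 hzt

/-- An edge that meets a ray, but has no vertex on it, crosses the ray transversally. -/
theorem exists_crossesRayAt {t₀ : ℝ} {f : Edge} (hC : F.C ∉ seg f)
    (h1 : f.1 ∉ seg (F.pt t₀, F.C)) (h2 : f.2 ∉ seg (F.pt t₀, F.C)) {z : Plane} (hz : z ∈ seg f)
    (hzr : z ∈ seg (F.pt t₀, F.C)) :
    ∃ s, F.CrossesRayAt t₀ f s ∧ f.1 + s • (f.2 - f.1) = z ∧ 0 < F.lam z := by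
  obtain ⟨hb, hl0, hl1⟩ := F.mem_seg_ray.1 hzr
  have hlpos : 0 < F.lam z := by
    refine lt_of_le_of_ne hl0 fun h => hC ?_
    have : z = F.C := F.ext_coord (by simp [← h]) (by rw [hb, ← h]; simp)
    exact this ▸ hz
  rcases mem_seg_iff.1 hz with rfl | rfl | hzo
  · exact absurd hzr h1
  · exact absurd hzr h2
  obtain ⟨s, hs0, hs1, hs⟩ := mem_openSeg.1 hzo
  have hb' := F.bet_sub_comb t₀ f s
  rw [← hs] at hb'
  refine ⟨s, ⟨hs0, hs1, fun hslope => ?_, by linarith⟩, hs.symm, hlpos⟩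
  -- otherwise `f` lies on the line of the ray, and must contain the apex or have a vertex on
  -- the ray
  rw [hslope] at hb'
  have b1 : F.bet f.1 = t₀ * F.lam f.1 := by linarith
  have b2 : F.bet f.2 = t₀ * F.lam f.2 := by
    rw [slope] at hslope; linarith
  have hlz : F.lam z = F.lam f.1 + s * (F.lam f.2 - F.lam f.1) := by rw [hs, lam_comb]
  have hnz : ∀ r : ℝ, 0 ≤ r → r ≤ 1 → F.lam f.1 + r * (F.lam f.2 - F.lam f.1) ≠ 0 := by
    intro r hr0 hr1 h
    apply hC
    have : F.C = f.1 + r • (f.2 - f.1) := by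
      refine F.ext_coord ?_ ?_
      · rw [lam_comb, h]; simp
      · rw [bet_comb, b1, b2]
        simp only [bet_C]
        linear_combination -t₀ * h
    exact mem_seg.2 ⟨r, hr0, hr1, this⟩
  have pos : ∀ x y : ℝ, x ≤ 0 → 0 < y → ∃ r, 0 ≤ r ∧ r ≤ 1 ∧ x + r * (y - x) = 0 := by
    intro x y hx hy
    have : 0 < y - x := by linarith
    exact ⟨-x / (y - x), div_nonneg (by linarith) this.le, (div_le_one this).2 (by linarith),
      by field_simp; ring⟩
  have p1 : 1 < F.lam f.1 := by
    by_contra hcon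
    push Not at hcon
    rcases le_or_gt (F.lam f.1) 0 with hle | hlt
    · rcases le_or_gt (F.lam f.2) 0 with hle' | hlt'
      · nlinarith
      · obtain ⟨r, hr0, hr1, hr⟩ := pos _ _ hle hlt'
        exact hnz r hr0 hr1 hr
    · exact h1 (F.mem_seg_ray.2 ⟨b1, hlt.le, hcon⟩)
  have p2 : 1 < F.lam f.2 := by
    by_contra hcon
    push Not at hcon
    rcases le_or_gt (F.lam f.2) 0 with hle | hlt
    · obtain ⟨r, hr0, hr1, hr⟩ := pos _ _ hle (by linarith : 0 < F.lam f.1)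
      exact hnz (1 - r) (by linarith) (by linarith) (by linear_combination hr)
    · exact h2 (F.mem_seg_ray.2 ⟨b2, hlt.le, hcon⟩)
  nlinarith

theorem tame_of_no_vertex {t₀ : ℝ} {f : Edge}
    (hC : F.C ∈ seg f → ∀ z ∈ seg f, z ∈ triangle F.p F.C F.q → z = F.C)
    (h1 : f.1 ∈ seg (F.pt t₀, F.C) → f.1 = F.C) (h2 : f.2 ∈ seg (F.pt t₀, F.C) → f.2 = F.C)
    (hr : F.pt t₀ ∉ seg f) : F.Tame t₀ f := by
  by_cases hCf : F.C ∈ seg f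
  · exact Or.inr (Or.inl (hC hCf))
  by_cases hex : ∃ z ∈ seg f, z ∈ seg (F.pt t₀, F.C)
  · obtain ⟨z, hz, hzr⟩ := hex
    obtain ⟨s, hs, hsz, hpos⟩ := exists_crossesRayAt hCf
      (fun h => hCf (h1 h ▸ fst_mem_seg f)) (fun h => hCf (h2 h ▸ snd_mem_seg f)) hz hzr
    refine Or.inr (Or.inr ⟨s, hs, hsz ▸ hpos, ?_⟩)
    rw [hsz]
    obtain ⟨hb, -, hle⟩ := F.mem_seg_ray.1 hzr
    refine lt_of_le_of_ne hle fun h => hr ?_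
    have : F.pt t₀ = z := F.ext_coord (by simp [h]) (by simp [hb, h])
    exact this ▸ hz
  · push Not at hex
    exact Or.inl hex

/-- The path can be turned across a ray that carries no vertices and no double points. -/
theorem eventually_VI_planar (hL : Functional L) (hpq : Free L (F.p, F.q)) (hgen : GenPos S)
    {t₀ : ℝ} (htame : ∀ f ∈ S, F.Tame t₀ f)
    (hnc : ∀ f ∈ S, ∀ g ∈ S, f ≠ g → ∀ z, z ∈ openSeg f → z ∈ openSeg g →
      z ∉ seg (F.pt t₀, F.C)) :
    ∀ᶠ ε in 𝓝[>] (0 : ℝ), ∀ t t', t₀ - ε < t → t < t' → t' < t₀ + ε → 0 < t → t' ≤ 1 →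
      F.Good S L t → F.Good S L t' → VI L (F.path S t) (F.path S t') := by
  filter_upwards [eventually_crossInside (F := F) hgen t₀,
    eventually_all_tame (P := fun _ => True) hgen.finite fun f hf _ => htame f hf]
    with ε e1 e3 t t' h1 htt' h4 h5 h6 g g'
  refine VI_path_planar hL hpq h5 htt' h6 g g'
    (fun f hf => e3 t t' h1 htt' h4 h5.le h6 f hf trivial) ?_
  intro f hf g hg hfg hc
  obtain ⟨z, hzf, hzg, hz⟩ := e1 t t' h1 htt' h4 f hf g hg hfg hc
  exact hnc f hf g hg hfg z hzf hzg hz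

/-- Local step of the sweep at a ray without vertices on it: at most one double point lies on the
ray, and the path can be turned across it. -/
theorem eventually_VI_of_no_vertex (hL : Functional L) (hpq : Free L (F.p, F.q))
    (hgen : GenPos (insert (F.p, F.q) S)) (hS : (F.p, F.q) ∉ S)
    (hC : ∀ f ∈ S, F.C ∈ seg f → ∀ z ∈ seg f, z ∈ triangle F.p F.C F.q → z = F.C)
    {t₀ : ℝ} (ht0 : 0 < t₀) (ht1 : t₀ < 1) (hv : ∀ v ∈ verts S, v ∈ seg (F.pt t₀, F.C) → v = F.C)
    (hev : ∀ x ∈ crossPts (insert (F.p, F.q) S), ∀ y ∈ crossPts (insert (F.p, F.q) S),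
      x ∈ seg (F.pt t₀, F.C) → y ∈ seg (F.pt t₀, F.C) → x = y) :
    ∀ᶠ ε in 𝓝[>] (0 : ℝ), ∀ t t', t₀ - ε < t → t < t₀ → t₀ < t' → t' < t₀ + ε → 0 < t → t' ≤ 1 →
      F.Good S L t → F.Good S L t' → VI L (F.path S t) (F.path S t') := by
  have hS' : S ⊆ insert (F.p, F.q) S := subset_insert _ _
  have hgS : GenPos S := hgen.mono hS'
  have hr : F.pt t₀ ∈ openSeg (F.p, F.q) := by
    have := (F.mem_openSeg_side (zero_lt_one' ℝ) (z := F.pt t₀)).2 ⟨by simp, by simpa, by simpa⟩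
    simpa using this
  have hrr : F.pt t₀ ∈ seg (F.pt t₀, F.C) := fst_mem_seg (F.pt t₀, F.C)
  have hopen : ∀ f ∈ S, F.pt t₀ ∈ seg f → F.pt t₀ ∈ openSeg f := by
    intro f hf h
    rcases mem_seg_iff.1 h with h' | h' | h'
    · exact absurd (hv _ (fst_mem_verts hf) (h' ▸ hrr)) (h' ▸ F.pt_ne_C t₀)
    · exact absurd (hv _ (snd_mem_verts hf) (h' ▸ hrr)) (h' ▸ F.pt_ne_C t₀)
    · exact h'
  have hne : ∀ f ∈ S, f ≠ (F.p, F.q) := fun f hf h => hS (h ▸ hf)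
  have hcross : ∀ f ∈ S, F.C ∉ seg f → ∀ z ∈ seg f, z ∈ seg (F.pt t₀, F.C) →
      ∃ s, F.CrossesRayAt t₀ f s ∧ f.1 + s • (f.2 - f.1) = z ∧ 0 < F.lam z := by
    intro f hf hCf z hz hzr
    refine exists_crossesRayAt hCf (fun h => hCf ?_) (fun h => hCf ?_) hz hzr
    · rw [← hv _ (fst_mem_verts hf) h]; exact fst_mem_seg f
    · rw [← hv _ (snd_mem_verts hf) h]; exact snd_mem_seg f
  have htame : ∀ f ∈ S, F.pt t₀ ∉ seg f → F.Tame t₀ f := fun f hf =>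
    tame_of_no_vertex (hC f hf) (hv _ (fst_mem_verts hf)) (hv _ (snd_mem_verts hf))
  have hcE := eventually_crossInside (F := F) hgS t₀
  by_cases hk : ∃ k ∈ S, F.pt t₀ ∈ seg k
  · obtain ⟨k, hkS, hkr⟩ := hk
    have hko := hopen k hkS hkr
    have hkC : F.C ∉ seg k := by
      intro h
      refine F.pt_ne_C t₀ (hC k hkS h _ hkr ?_)
      exact mem_triangle_of_mem_sector (t := 0) (t' := 1) le_rfl one_pos le_rfl
        ((F.mem_sector one_pos).2 ⟨by simp, by simp, by simp; linarith, by simp; linarith⟩)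
    obtain ⟨s, hs, hsz, -⟩ := hcross k hkS hkC _ hkr hrr
    -- `k` crosses the side `p q` at the corner of the path, so it cannot be parallel to that side
    have hlam : F.lam k.2 ≠ F.lam k.1 := by
      have := hgen.det_ne (hS' hkS) (Or.inl rfl) (hne k hkS) hko hr
      intro h
      apply this
      have h' : F.lam k.2 - F.lam k.1 = det (k.2 - k.1) (F.q - F.p) / det (F.p - F.C) (F.q - F.C)
          := by
        rw [lam, lam, ← sub_div]; congr 1; simp [det]; ring
      rw [h, sub_self, eq_comm, div_eq_zero_iff] at h'
      exact h'.resolve_right F.nondeg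
    have huniq : ∀ f ∈ S, f ≠ k → F.pt t₀ ∉ seg f := by
      intro f hf hfk hfr
      have := hgen.no_triple f (hS' hf) k (hS' hkS) (F.p, F.q) (Or.inl rfl) hfk (hne k hkS)
          (hne f hf)
      rw [eq_empty_iff_forall_notMem] at this
      exact this _ ⟨⟨hopen f hf hfr, hko⟩, hr⟩
    filter_upwards [hcE, F.eventually_straight_or_corner hs hsz hlam,
      eventually_all_tame (P := (· ≠ k)) hgS.finite fun f hf hfk => htame f hf (huniq f hf hfk)]
      with ε e1 e2 e3 t t' h1 h2 h3 h4 h5 h6 g g'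
    have htt' := h2.trans h3
    have hnc : ∀ f ∈ S, ∀ g ∈ S, f ≠ g → ¬ CrossInside (F.pt t) F.C (F.pt t') f g := by
      intro f hf g hg hfg hc
      obtain ⟨z, hzf, hzg, hzr⟩ := e1 t t' h1 htt' h4 f hf g hg hfg hc
      have : z = F.pt t₀ := hev z ⟨f, hS' hf, g, hS' hg, hfg, hzf, hzg⟩ _
        ⟨k, hS' hkS, _, Or.inl rfl, hne k hkS, hko, hr⟩ hzr hrr
      subst this
      have := hgen.no_triple f (hS' hf) g (hS' hg) (F.p, F.q) (Or.inl rfl) hfg (hne g hg) (hne f hf)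
      rw [eq_empty_iff_forall_notMem] at this
      exact this _ ⟨⟨hzf, hzg⟩, hr⟩
    have hrest := e3 t t' h1 htt' h4 h5.le h6
    -- `k` crosses the old edge and one of the new edges, or both new edges
    rcases e2 t t' h1 h2 h3 h4 with h7 | ⟨h7, h8⟩
    · refine VI_path_planar hL hpq h5 htt' h6 g g' (fun f hf => ?_) hnc
      by_cases hfk : f = k
      · exact Or.inr (hfk ▸ h7)
      · exact hrest f hf hfk
    · exact VI_path_two hL hpq h5 htt' h6 g g' hkS h7 h8 hrest hnc
  · push Not at hk
    have htame' := eventually_all_tame (P := fun _ => True) hgS.finite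
      fun f hf _ => htame f hf (hk f hf)
    by_cases hpair : ∃ f ∈ S, ∃ g ∈ S, f ≠ g ∧ ∃ z, z ∈ openSeg f ∧ z ∈ openSeg g ∧
        z ∈ seg (F.pt t₀, F.C)
    · obtain ⟨k, hkS, l, hlS, hkl, z, hzk, hzl, hzr⟩ := hpair
      filter_upwards [hcE, htame'] with ε e1 e3 t t' h1 h2 h3 h4 h5 h6 g g'
      have htt' := h2.trans h3
      refine VI_path_three hL hpq h5 htt' h6 g g' hkS hlS hkl ?_
        (fun f hf => e3 t t' h1 htt' h4 h5.le h6 f hf trivial) ?_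
      · refine ⟨z, ⟨hzk, hzl⟩, ?_⟩
        obtain ⟨hb, hl0, hl1⟩ := F.mem_seg_ray.1 hzr
        exact (F.mem_sector htt').2 ⟨hl0, hl1, by nlinarith, by nlinarith⟩
      · intro f hf g hg hfg hc
        obtain ⟨y, hyf, hyg, hyr⟩ := e1 t t' h1 htt' h4 f hf g hg hfg hc
        obtain rfl : y = z := hev y ⟨f, hS' hf, g, hS' hg, hfg, hyf, hyg⟩ z
          ⟨k, hS' hkS, l, hS' hlS, hkl, hzk, hzl⟩ hyr hzr
        have key : ∀ e ∈ S, y ∈ openSeg e → e = k ∨ e = l := by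
          intro e he hye
          by_contra hcon
          push Not at hcon
          have := hgS.no_triple k hkS l hlS e he hkl hcon.2.symm hcon.1.symm
          rw [eq_empty_iff_forall_notMem] at this
          exact this y ⟨⟨hzk, hzl⟩, hye⟩
        rcases key f hf hyf with rfl | rfl <;> rcases key g hg hyg with rfl | rfl
        · exact absurd rfl hfg
        · exact Or.inl ⟨rfl, rfl⟩
        · exact Or.inr ⟨rfl, rfl⟩
        · exact absurd rfl hfg
    · filter_upwards [eventually_VI_planar hL hpq hgS (fun f hf => htame f hf (hk f hf))
        fun f hf g hg hfg z hzf hzg hz => hpair ⟨f, hf, g, hg, hfg, z, hzf, hzg, hz⟩]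
        with ε e t t' h1 h2 h3
      exact e t t' h1 (h2.trans h3)

end Frame

/-! ### Cutting off a corner of the link -/

theorem fst_mem_triangle (a b c : Plane) : a ∈ triangle a b c :=
  subset_convexHull ℝ _ (by simp)

theorem snd_mem_triangle (a b c : Plane) : b ∈ triangle a b c :=
  subset_convexHull ℝ _ (by simp)

theorem trd_mem_triangle (a b c : Plane) : c ∈ triangle a b c :=
  subset_convexHull ℝ _ (by simp)

theorem seg_subset_triangle {a b c x y : Plane} (hx : x ∈ triangle a b c)
    (hy : y ∈ triangle a b c) : seg (x, y) ⊆ triangle a b c :=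
  (convex_convexHull ℝ _).segment_subset hx hy

/-- A triangle that shrinks to the point `v` is eventually contained in any neighbourhood. -/
theorem eventually_triangle_subset {v : Plane} {U : Set Plane} (hU : U ∈ 𝓝 v) (x y w : Plane) :
    ∀ᶠ δ in 𝓝[>] (0 : ℝ), triangle (v + δ • x) (v + δ • y) (v + δ • w) ⊆ U := by
  obtain ⟨r, hr, hball⟩ := Metric.mem_nhds_iff.1 hU
  have key : ∀ x : Plane, ∀ᶠ δ in 𝓝[>] (0 : ℝ), v + δ • x ∈ Metric.ball v r := by
    intro x
    have hc : ContinuousAt (fun δ : ℝ => v + δ • x) 0 := by fun_prop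
    have : ∀ᶠ δ in 𝓝 (0 : ℝ), v + δ • x ∈ Metric.ball v r :=
      hc.eventually_mem (by simpa using Metric.ball_mem_nhds v hr)
    exact this.filter_mono nhdsWithin_le_nhds
  filter_upwards [key x, key y, key w] with δ h1 h2 h3
  refine (convexHull_min ?_ (convex_ball v r)).trans hball
  rintro z (rfl | rfl | rfl)
  · exact h1
  · exact h2
  · exact h3

theorem eventually_triangle_notMem {v : Plane} {K : Set Plane} (hK : IsClosed K) (hv : v ∉ K)
    (x y w : Plane) :
    ∀ᶠ δ in 𝓝[>] (0 : ℝ), ∀ z ∈ K, z ∉ triangle (v + δ • x) (v + δ • y) (v + δ • w) := by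
  filter_upwards [eventually_triangle_subset (hK.isOpen_compl.mem_nhds hv) x y w] with δ h z hz hzt
  exact h hzt hz

/-- After its end at `v` is cut off, the edge `u → v` meets the cut off triangle in one point only.
-/
theorem eq_of_mem_corner {u v w z : Plane} {δ : ℝ} (h0 : 0 < δ) (h1 : δ < 1) (huv : u ≠ v)
    (hu : u ∉ seg (v, w)) (hz : z ∈ seg (u, v + δ • (u - v)))
    (hzt : z ∈ triangle (v + δ • (u - v)) (v + δ • (w - v)) v) : z = v + δ • (u - v) := by
  obtain ⟨r, hr0, hr1, hr⟩ := mem_seg.1 hz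
  obtain ⟨s, t, hs, ht, hst, hz'⟩ := mem_triangle.1 hzt
  have e : (1 - r * (1 - δ) - δ * (1 - s - t)) • (u - v) = (δ * s) • (w - v) := by
    have e1 : z - v = (1 - r * (1 - δ)) • (u - v) := by rw [hr]; dsimp only; module
    have e2 : z - v = (δ * (1 - s - t)) • (u - v) + (δ * s) • (w - v) := by rw [hz']; module
    rw [sub_smul, ← e1, e2, add_sub_cancel_left]
  rcases hs.eq_or_lt with rfl | hs
  · rw [mul_zero, zero_smul, smul_eq_zero] at e
    have e := e.resolve_right (sub_ne_zero.2 huv)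
    have : r = 1 := by nlinarith
    rw [hr, this]; dsimp only; module
  · exfalso
    set κ := 1 - r * (1 - δ) - δ * (1 - s - t) with hκ
    have hκ' : δ * s ≤ κ := by rw [hκ]; nlinarith
    have hδs : 0 < δ * s := by positivity
    have hκ0 : 0 < κ := lt_of_lt_of_le hδs hκ'
    apply hu
    refine mem_seg.2 ⟨(δ * s) / κ, by positivity, (div_le_one hκ0).2 hκ', ?_⟩
    dsimp only
    rw [div_eq_inv_mul, mul_smul, ← e, smul_smul, inv_mul_cancel₀ hκ0.ne', one_smul]
    module

section corner

variable {L : Markers} {T : Set Edge} {u v w : Plane} {ρ : Edge} {δ : ℝ} {σ : Plane → ℝ}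

/-- Two consecutive edges `u → v → w` may be replaced by `u → u' → w' → w`, where `u'` and `w'` are
close to `v`, if the small triangle met by this is clear except for one edge `ρ` that runs
across it along the line `σ = 0`. The edges may have classical crossings away from `v`. -/
theorem cut_corner (hL : Functional L) (h0 : 0 < δ) (h1 : δ < 1)
    (hd : Diag (insert (u, v) (insert (v, w) T))) (huvT : (u, v) ∉ T) (hvwT : (v, w) ∉ T)
    (hρ : ρ ∈ T)
    (htri : ∀ f ∈ T, f ≠ ρ → ∀ z ∈ seg f, z ∉ triangle (v + δ • (u - v)) (v + δ • (w - v)) v)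
    (hρ1 : ρ.1 ∉ triangle (v + δ • (u - v)) (v + δ • (w - v)) v)
    (hρ2 : ρ.2 ∉ triangle (v + δ • (u - v)) (v + δ • (w - v)) v)
    (hσ : ∀ (x y : Plane) (s : ℝ), σ (x + s • (y - x)) = σ x + s * (σ y - σ x))
    (hv0 : σ v ≠ 0) (hu0 : σ (v + δ • (u - v)) ≠ 0) (hw0 : σ (v + δ • (w - v)) ≠ 0)
    (hσρ : ∀ z ∈ triangle (v + δ • (u - v)) (v + δ • (w - v)) v, z ∈ seg ρ ↔ σ z = 0)
    (hm : ∀ m ∈ L, m.1 ∉ triangle (v + δ • (u - v)) (v + δ • (w - v)) v) :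
    Diag (insert (u, v + δ • (u - v)) (insert (v + δ • (u - v), v + δ • (w - v))
      (insert (v + δ • (w - v), w) T))) ∧
    VI L (insert (u, v) (insert (v, w) T))
      (insert (u, v + δ • (u - v)) (insert (v + δ • (u - v), v + δ • (w - v))
      (insert (v + δ • (w - v), w) T))) := by
  have huv : u ≠ v := hd.gen.ne (u, v) (Or.inl rfl)
  have hvw : v ≠ w := hd.gen.ne (v, w) (Or.inr (Or.inl rfl))
  have huw : u ≠ w := by
    rintro rfl
    exact hd.gen.not_opposite (u, v) (Or.inl rfl) (Or.inr (Or.inl rfl))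
  have hne : ((u, v) : Edge) ≠ (v, w) := fun h => huv (congrArg Prod.fst h)
  have hu_vw : u ∉ seg (v, w) := by
    intro h
    rcases hd.gen.eq_of_mem (fst_mem_verts (mem_insert (u, v) _)) (Or.inr (Or.inl rfl)) h with h | h
    · exact huv h
    · exact huw h
  have hw_uv : w ∉ seg (v, u) := by
    intro h
    rw [← seg_swap] at h
    rcases hd.gen.eq_of_mem (snd_mem_verts (Or.inr (Or.inl rfl) :
      (v, w) ∈ insert (u, v) (insert (v, w) T))) (Or.inl rfl) h with h | h
    · exact huw h.symm
    · exact hvw h.symm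
  set u' := v + δ • (u - v) with hu'
  set w' := v + δ • (w - v) with hw'
  set Δ := triangle u' w' v with hΔ
  have huΔ : u' ∈ Δ := fst_mem_triangle _ _ _
  have hwΔ : w' ∈ Δ := snd_mem_triangle _ _ _
  have hvΔ : v ∈ Δ := trd_mem_triangle _ _ _
  have hu'o : u' ∈ openSeg (u, v) :=
    mem_openSeg.2 ⟨1 - δ, by linarith, by linarith, by rw [hu']; dsimp only; module⟩
  have hw'o : w' ∈ openSeg (v, w) := mem_openSeg.2 ⟨δ, h0, h1, by rw [hw']⟩
  have hu'v : u' ≠ v := fun h => snd_notMem_openSeg (e := (u, v)) huv (h ▸ hu'o)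
  have hu'u : u' ≠ u := fun h => fst_notMem_openSeg (e := (u, v)) huv (h ▸ hu'o)
  have hw'v : w' ≠ v := fun h => fst_notMem_openSeg (e := (v, w)) hvw (h ▸ hw'o)
  have hw'w : w' ≠ w := fun h => snd_notMem_openSeg (e := (v, w)) hvw (h ▸ hw'o)
  -- the two edges at `v` meet in `v` only
  have hmeet : ∀ z, z ∈ seg (u, v) → z ∈ seg (v, w) → z = v := by
    intro z hz1 hz2
    rcases mem_seg_iff.1 hz1 with h | h | h
    · exact absurd ((show z = u from h) ▸ hz2) hu_vw
    · exact h
    rcases mem_seg_iff.1 hz2 with h' | h' | h'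
    · exact h'
    · refine absurd ?_ hw_uv
      rw [← seg_swap]; exact (show z = w from h') ▸ hz1
    · exact hd.gen.eq_of_mem_openSeg (Or.inl rfl) (Or.inr (Or.inl rfl)) hne h h'
        (snd_mem_seg (u, v)) (fst_mem_seg (v, w))
  have hTu : ∀ f ∈ T, u' ∉ seg f := by
    intro f hf h
    by_cases hfρ : f = ρ
    · exact hu0 ((hσρ u' huΔ).1 (hfρ ▸ h))
    · exact htri f hf hfρ u' h huΔ
  have hTw : ∀ f ∈ T, w' ∉ seg f := by
    intro f hf h
    by_cases hfρ : f = ρ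
    · exact hw0 ((hσρ w' hwΔ).1 (hfρ ▸ h))
    · exact htri f hf hfρ w' h hwΔ
  have hu'vw : u' ∉ seg (v, w) := fun h => hu'v (hmeet u' (openSeg_subset _ hu'o) h)
  have hw'uv : w' ∉ seg (u, v) := fun h => hw'v (hmeet w' h (openSeg_subset _ hw'o))
  have huvT' : (u, v) ∉ insert (v, w) T := by
    rintro (h | h)
    · exact hne h
    · exact huvT h
  have hd1S : ∀ f ∈ insert (v, w) T, u' ∉ seg f := by
    rintro f (rfl | hf)
    · exact hu'vw
    · exact hTu f hf
  have vi1 := VI.subdivide hu'o hL hd huvT' hd1S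
  have hd1 := hd.subdivide hu'o huvT' hd1S
  have e1 : insert (u, u') (insert (u', v) (insert (v, w) T)) =
      insert (v, w) (insert (u, u') (insert (u', v) T)) := by
    rw [insert_comm (u', v), insert_comm (u, u')]
  rw [e1] at vi1 hd1
  have hvwT' : (v, w) ∉ insert (u, u') (insert (u', v) T) := by
    rintro (h | h | h)
    · exact huv (congrArg Prod.fst h).symm
    · exact hu'v (congrArg Prod.fst h).symm
    · exact hvwT h
  have hd2S : ∀ f ∈ insert (u, u') (insert (u', v) T), w' ∉ seg f := by
    rintro f (rfl | rfl | hf)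
    · exact fun h => hw'uv (seg_left_subset hu'o h)
    · exact fun h => hw'uv (seg_right_subset hu'o h)
    · exact hTw f hf
  have vi2 := VI.subdivide hw'o hL hd1 hvwT' hd2S
  have hd2 := hd1.subdivide hw'o hvwT' hd2S
  set R := insert (u, u') (insert (w', w) T) with hR
  have e2 : insert (v, w') (insert (w', w) (insert (u, u') (insert (u', v) T))) =
      insert (u', v) (insert (v, w') R) := by
    rw [hR, insert_comm (u', v) (v, w'), insert_comm (u', v) (u, u'), insert_comm (u', v) (w', w),
      insert_comm (w', w) (u, u')]
  rw [e2] at vi2 hd2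
  have e3 : insert (u, u') (insert (u', w') (insert (w', w) T)) = insert (u', w') R := by
    rw [hR, insert_comm]
  rw [e3]
  -- the only edge of `R` with interior points in the small triangle is `ρ`
  have hcu : ∀ z ∈ seg (u, u'), z ∈ Δ → z = u' := fun z hz hzt =>
    eq_of_mem_corner h0 h1 huv hu_vw hz hzt
  have hcw : ∀ z ∈ seg (w', w), z ∈ Δ → z = w' := fun z hz hzt => by
    rw [hΔ, triangle_swap] at hzt
    rw [← seg_swap] at hz
    exact eq_of_mem_corner h0 h1 hvw.symm hw_uv hz hzt
  have only : ∀ f ∈ R, ∀ z ∈ openSeg f, z ∈ Δ → f = ρ := by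
    rintro f (rfl | rfl | hf) z hz hzt
    · rw [hcu z (openSeg_subset _ hz) hzt] at hz
      exact absurd hz (snd_notMem_openSeg (e := (u, u')) hu'u.symm)
    · rw [hcw z (openSeg_subset _ hz) hzt] at hz
      exact absurd hz (fst_notMem_openSeg (e := (w', w)) hw'w)
    · by_contra hfρ
      exact htri f hf hfρ z (openSeg_subset _ hz) hzt
  have hTverts : ∀ x ∈ verts T, x ∉ Δ := by
    rintro x ⟨f, hf, hx⟩
    by_cases hfρ : f = ρ
    · subst hfρ
      rcases hx with rfl | rfl
      · exact hρ1
      · exact hρ2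
    · rcases hx with rfl | rfl
      · exact htri f hf hfρ _ (fst_mem_seg f)
      · exact htri f hf hfρ _ (snd_mem_seg f)
  have hsub : seg (u', w') ⊆ Δ := seg_subset_triangle huΔ hwΔ
  have hRsub : R ⊆ insert (u', v) (insert (v, w') R) :=
    (subset_insert _ _).trans (subset_insert _ _)
  have hu'w' : u' ≠ w' := by
    intro h
    have : δ • (u - w) = 0 := by
      have := sub_eq_zero.2 h
      rw [hu', hw'] at this
      rw [← this]; module
    rcases smul_eq_zero.1 this with h | h
    · exact h0.ne' h
    · exact huw (sub_eq_zero.1 h)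
  have huΔ' : u ∉ Δ := fun h => hu'u (hcu u (fst_mem_seg (u, u')) h).symm
  have hwΔ' : w ∉ Δ := fun h => hw'w (hcw w (snd_mem_seg (w', w)) h).symm
  have hd3 : Diag (insert (u', w') R) := by
    refine ⟨(hd2.gen.mono hRsub).insert_edge hu'w' ?_ ?_ ?_ ?_ ?_, hd2.link.merge ?_ hu'v.symm
        hw'v.symm⟩
    · rintro (h | h | h)
      · exact huΔ' ((show w' = u from congrArg Prod.fst h) ▸ hwΔ)
      · exact hwΔ' ((show u' = w from congrArg Prod.snd h) ▸ huΔ)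
      · exact hTu _ h (snd_mem_seg (w', u'))
    · rw [hR, verts_insert, verts_insert]
      rintro x (rfl | rfl | rfl | rfl | hx) hx'
      · exact absurd (hsub hx') huΔ'
      · exact Or.inl rfl
      · exact Or.inr rfl
      · exact absurd (hsub hx') hwΔ'
      · exact absurd (hsub hx') (hTverts x hx)
    · rintro f (rfl | rfl | hf) hf'
      · exact Or.inr rfl
      · exact absurd (seg_right_subset hw'o hf') hu'vw
      · exact absurd hf' (hTu f hf)
    · rintro f (rfl | rfl | hf) hf'
      · exact absurd (seg_left_subset hu'o hf') hw'uv
      · exact Or.inl rfl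
      · exact absurd hf' (hTw f hf)
    · rintro z ⟨e, he, f, hf, hef, hze, hzf⟩ hz
      have hzΔ := hsub (openSeg_subset _ hz)
      exact hef ((only e he z hze hzΔ).trans (only f hf z hzf hzΔ).symm)
    · rw [hR, verts_insert, verts_insert]
      rintro (h | h | h | h | ⟨f, hf, h | h⟩)
      · exact huv h.symm
      · exact hu'v h.symm
      · exact hw'v h.symm
      · exact hvw h
      · have := hd.link.outInj f (Or.inr (Or.inr hf)) (v, w) (Or.inr (Or.inl rfl)) h.symm
        exact hvwT (this ▸ hf)
      · have := hd.link.inInj f (Or.inr (Or.inr hf)) (u, v) (Or.inl rfl) h.symm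
        exact huvT (this ▸ hf)
  refine ⟨hd3, vi1.trans (vi2.trans (VI.symm ?_))⟩
  have free : ∀ x y, x ∈ Δ → y ∈ Δ → Free L (x, y) := fun x y hx hy m hm' h =>
    hm m hm' (seg_subset_triangle hx hy (openSeg_subset _ h))
  have f1 := free u' w' huΔ hwΔ
  have f2 := free u' v huΔ hvΔ
  have f3 := free v w' hvΔ hwΔ
  have hρo : ∀ z ∈ Δ, z ∈ seg ρ → z ∈ openSeg ρ := by
    intro z hz hzρ
    rcases mem_seg_iff.1 hzρ with h | h | h
    · exact absurd (h ▸ hz) hρ1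
    · exact absurd (h ▸ hz) hρ2
    · exact h
  have hρR : ρ ∈ R := Or.inr (Or.inr hρ)
  have hav : ∀ f ∈ R, f ≠ ρ → Avoids u' w' v f := by
    rintro f (rfl | rfl | hf) hfρ z hz hzt
    · exact Or.inl (hcu z hz hzt)
    · exact Or.inr (hcw z hz hzt)
    · exact absurd hzt (htri f hf hfρ z hz)
  have hnc : ∀ f ∈ R, ∀ g ∈ R, f ≠ g → ¬ CrossInside u' w' v f g := by
    rintro f hf g hg hfg ⟨z, ⟨hzf, hzg⟩, hzt⟩
    exact hfg ((only f hf z hzf hzt).trans (only g hg z hzg hzt).symm)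
  have cr : ∀ x y, x ∈ Δ → y ∈ Δ → σ x * σ y < 0 → Crosses ρ (x, y) := by
    intro x y hx hy hxy
    have hne : σ x - σ y ≠ 0 := by
      intro h
      have : σ x = σ y := by linarith
      rw [this] at hxy
      nlinarith [sq_nonneg (σ y)]
    have hpos : 0 < σ x / (σ x - σ y) ∧ σ x / (σ x - σ y) < 1 := by
      rcases lt_or_gt_of_ne hne with h | h
      · exact ⟨div_pos_of_neg_of_neg (by nlinarith) h, (div_lt_one_of_neg h).2 (by nlinarith)⟩
      · exact ⟨div_pos (by nlinarith) h, (div_lt_one h).2 (by nlinarith)⟩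
    have hz : x + (σ x / (σ x - σ y)) • (y - x) ∈ openSeg (x, y) :=
      mem_openSeg.2 ⟨_, hpos.1, hpos.2, rfl⟩
    have hzΔ := seg_subset_triangle hx hy (openSeg_subset _ hz)
    refine ⟨_, hρo _ hzΔ ((hσρ _ hzΔ).2 ?_), hz⟩
    rw [hσ]; field_simp; ring
  have ncr : ∀ x y, x ∈ Δ → y ∈ Δ → 0 < σ x * σ y → ¬ Crosses ρ (x, y) := by
    rintro x y hx hy hxy ⟨z, hzρ, hz⟩
    have hzΔ := seg_subset_triangle hx hy (openSeg_subset _ hz)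
    have h3 := (hσρ z hzΔ).1 (openSeg_subset _ hzρ)
    obtain ⟨s, hs0, hs1, rfl⟩ := mem_openSeg.1 hz
    dsimp only at h3
    rw [hσ] at h3
    have h4 : (σ x + s * (σ y - σ x)) * σ x = 0 := by rw [h3, zero_mul]
    have h5 : (σ x + s * (σ y - σ x)) * σ y = 0 := by rw [h3, zero_mul]
    have hx2 : 0 < σ x ^ 2 := by
      have : σ x ≠ 0 := by rintro h; rw [h] at hxy; simp at hxy
      positivity
    nlinarith
  have sgn : ∀ x y z : ℝ, x ≠ 0 → y ≠ 0 → z ≠ 0 → x * y < 0 →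
      (x * z < 0 ∧ 0 < z * y) ∨ (0 < x * z ∧ z * y < 0) := by
    intro x y z hx hy hz hxy
    rcases lt_or_gt_of_ne hx with h | h <;> rcases lt_or_gt_of_ne hz with h' | h' <;>
      rcases lt_or_gt_of_ne hy with h'' | h''
    · nlinarith
    · right; constructor <;> nlinarith
    · nlinarith
    · left; constructor <;> nlinarith
    · left; constructor <;> nlinarith
    · nlinarith
    · right; constructor <;> nlinarith
    · nlinarith
  rcases lt_or_gt_of_ne (mul_ne_zero hu0 hw0) with hs | hs
  · refine VI.planar hL hd3 hd2 f1 f2 f3 (fun f hf => ?_) hnc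
    by_cases hfρ : f = ρ
    · right
      subst hfρ
      refine ⟨cr _ _ huΔ hwΔ hs, ?_⟩
      rcases sgn _ _ _ hu0 hw0 hv0 hs with ⟨h3, h4⟩ | ⟨h3, h4⟩
      · exact Or.inl ⟨cr _ _ huΔ hvΔ h3, ncr _ _ hvΔ hwΔ h4⟩
      · exact Or.inr ⟨cr _ _ hvΔ hwΔ h4, ncr _ _ huΔ hvΔ h3⟩
    · exact Or.inl (hav f hf hfρ)
  · rcases lt_or_gt_of_ne (mul_ne_zero hu0 hv0) with hs' | hs'
    · refine VI.two hL hd3 hd2 f1 f2 f3 hρR (cr _ _ huΔ hvΔ hs') (cr _ _ hvΔ hwΔ ?_)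
        (fun f hf hfρ => Or.inl (hav f hf hfρ)) hnc
      rcases lt_or_gt_of_ne hu0 with h | h
      · nlinarith [pos_of_mul_neg_right hs' h.le, neg_of_mul_pos_right hs h.le]
      · nlinarith [neg_of_mul_neg_right hs' h.le, pos_of_mul_pos_right hs h.le]
    · refine VI.planar hL hd3 hd2 f1 f2 f3 (fun f hf => ?_) hnc
      by_cases hfρ : f = ρ
      · left
        subst hfρ
        intro z hz hzt
        exfalso
        have h3 := (hσρ z hzt).1 hz
        obtain ⟨s, t, hs0, ht0, hst, rfl⟩ := mem_triangle.1 hzt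
        have h4 : σ (u' + s • (w' - u') + t • (v - u')) =
            σ u' + s * (σ w' - σ u') + t * (σ v - σ u') := by
          have e := hσ (u' + s • (w' - u')) (u' + s • (w' - u') + (v - u')) t
          have e' := hσ u' (u' + s • (w' - u') + (v - u')) (1 / 2)
          have e'' : u' + (1 / 2 : ℝ) • (u' + s • (w' - u') + (v - u') - u') =
              (u' + s • (w' - u')) + (1 / 2 : ℝ) • (v - (u' + s • (w' - u'))) := by module
          rw [e'', hσ, hσ] at e'
          rw [add_sub_cancel_left, hσ] at e
          rw [e]
          linear_combination -2 * t * e'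
        rw [h4] at h3
        have h5 : (σ u' + s * (σ w' - σ u') + t * (σ v - σ u')) * σ u' = 0 := by
          rw [h3, zero_mul]
        have hx2 : 0 < σ u' ^ 2 := by positivity
        rcases hs0.eq_or_lt with rfl | hs0
        · rcases ht0.eq_or_lt with rfl | ht0
          · nlinarith
          · nlinarith
        · nlinarith
      · exact Or.inl (hav f hf hfρ)

end corner

/-! ### Events of a sweep -/

/-- The points that matter when an edge is moved across a diagram: vertices, double points, and
marked points. -/
def events (S : Set Edge) (L : Markers) : Set Plane := verts S ∪ crossPts S ∪ Prod.fst '' L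

theorem events_mono {S T : Set Edge} (h : S ⊆ T) (L : Markers) : events S L ⊆ events T L :=
  union_subset_union_left _ (union_subset_union (verts_mono h) (crossPts_mono h))

theorem verts_subset_events (S : Set Edge) (L : Markers) : verts S ⊆ events S L :=
  fun _ h => Or.inl (Or.inl h)

theorem crossPts_subset_events (S : Set Edge) (L : Markers) : crossPts S ⊆ events S L :=
  fun _ h => Or.inl (Or.inr h)

theorem GenPos.finite_events {S : Set Edge} (h : GenPos S) {L : Markers} (hL : L.Finite) :
    (events S L).Finite :=
  (h.finite_verts.union h.finite_crossPts).union (hL.image _)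

namespace Frame

/-- The hypotheses under which `p → C` can be swept across the triangle to `p → q → C`: at the apex
the link enters the triangle nowhere, and all events in the triangle lie on different rays. -/
structure Sweepable (F : Frame) (S : Set Edge) (L : Markers) : Prop where
  functional : Functional L
  finite : L.Finite
  diag_zero : Diag (insert (F.p, F.C) S)
  diag_one : Diag (insert (F.p, F.q) (insert (F.q, F.C) S))
  apex : ∀ f ∈ S, f.1 = F.C → ∀ z ∈ seg f, z ∈ triangle F.p F.C F.q → z = F.C
  event : ∀ x ∈ events (insert (F.p, F.q) S) L, ∀ y ∈ events (insert (F.p, F.q) S) L,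
    x ∈ triangle F.p F.C F.q → y ∈ triangle F.p F.C F.q → x ≠ F.C → y ≠ F.C →
    det (x - F.C) (y - F.C) = 0 → x = y
  marks : ∀ m ∈ L, m.1 ∉ verts (insert (F.p, F.q) S)
  free_side : Free L (F.p, F.q)
  free_zero : Free L (F.p, F.C)
  free_one : Free L (F.q, F.C)

variable {F : Frame} {S : Set Edge} {L : Markers}

theorem mem_triangle_of_mem_ray {t : ℝ} (h0 : 0 ≤ t) (h1 : t ≤ 1) {z : Plane}
    (hz : z ∈ seg (F.pt t, F.C)) : z ∈ triangle F.p F.C F.q := by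
  obtain ⟨hb, hl0, hl1⟩ := F.mem_seg_ray.1 hz
  have := (F.mem_sector (zero_lt_one' ℝ) (z := z)).2 ⟨hl0, hl1, by nlinarith, by nlinarith⟩
  simpa using this

theorem sub_eq_of_mem_ray {t : ℝ} {z : Plane} (hz : z ∈ seg (F.pt t, F.C)) :
    z - F.C = F.lam z • (F.pt t - F.C) := by
  obtain ⟨hb, -, -⟩ := F.mem_seg_ray.1 hz
  have h := F.eq_comb z
  rw [hb] at h
  have h' := sub_eq_iff_eq_add'.2 (h.trans (add_assoc _ _ _))
  rw [h', pt]; module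

theorem mem_openSeg_side_of_lt {t : ℝ} (h0 : 0 < t) (h1 : t < 1) :
    F.pt t ∈ openSeg (F.p, F.q) := by
  have := (F.mem_openSeg_side (zero_lt_one' ℝ) (z := F.pt t)).2 ⟨by simp, by simpa, by simpa⟩
  simpa using this

namespace Sweepable

variable (h : F.Sweepable S L)
include h

theorem notMem_zero : (F.p, F.C) ∉ S := fun hS => by
  have := h.diag_one.link.outInj (F.p, F.C) (Or.inr (Or.inr hS)) (F.p, F.q) (Or.inl rfl) rfl
  exact F.q_ne_C (congrArg Prod.snd this).symm

theorem notMem_side : (F.p, F.q) ∉ S := fun hS => by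
  have := h.diag_zero.link.outInj (F.p, F.q) (Or.inr hS) (F.p, F.C) (Or.inl rfl) rfl
  exact F.q_ne_C (congrArg Prod.snd this)

theorem notMem_one : (F.q, F.C) ∉ S := fun hS => by
  have := h.diag_zero.link.inInj (F.q, F.C) (Or.inr hS) (F.p, F.C) (Or.inl rfl) rfl
  exact F.p_ne_q (congrArg Prod.fst this).symm

theorem genPos_side : GenPos (insert (F.p, F.q) S) :=
  h.diag_one.gen.mono (insert_subset_insert (subset_insert _ _))

theorem genPos : GenPos S := h.genPos_side.mono (subset_insert _ _)

theorem fst_ne_p {f : Edge} (hf : f ∈ S) : f.1 ≠ F.p := fun hfp => by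
  have := h.diag_zero.link.outInj f (Or.inr hf) (F.p, F.C) (Or.inl rfl) hfp
  exact h.notMem_zero (this ▸ hf)

theorem snd_ne_C {f : Edge} (hf : f ∈ S) : f.2 ≠ F.C := fun hfp => by
  have := h.diag_zero.link.inInj f (Or.inr hf) (F.p, F.C) (Or.inl rfl) hfp
  exact h.notMem_zero (this ▸ hf)

theorem q_notMem {f : Edge} (hf : f ∈ S) : F.q ∉ seg f := fun hq => by
  rcases h.diag_one.gen.eq_of_mem (snd_mem_verts (mem_insert (F.p, F.q) _)) (Or.inr (Or.inr hf)) hq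
    with h' | h'
  · have := h.diag_one.link.outInj f (Or.inr (Or.inr hf)) (F.q, F.C) (Or.inr (Or.inl rfl)) h'.symm
    exact h.notMem_one (this ▸ hf)
  · have := h.diag_one.link.inInj f (Or.inr (Or.inr hf)) (F.p, F.q) (Or.inl rfl) h'.symm
    exact h.notMem_side (this ▸ hf)

theorem C_mem_verts : F.C ∈ verts S := by
  obtain ⟨f, rfl | hf, hfC⟩ := h.diag_zero.link.succ (F.p, F.C) (Or.inl rfl)
  · exact absurd hfC F.p_ne_C
  · have : f.1 = F.C := hfC
    rw [← this]; exact fst_mem_verts hf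

theorem apex_of_mem {f : Edge} (hf : f ∈ S) (hC : F.C ∈ seg f) :
    ∀ z ∈ seg f, z ∈ triangle F.p F.C F.q → z = F.C := by
  rcases h.genPos.eq_of_mem h.C_mem_verts hf hC with h' | h'
  · exact h.apex f hf h'.symm
  · exact absurd h'.symm (h.snd_ne_C hf)

theorem unique_on_ray {t : ℝ} (h0 : 0 ≤ t) (h1 : t ≤ 1) {x y : Plane}
    (hx : x ∈ events (insert (F.p, F.q) S) L) (hy : y ∈ events (insert (F.p, F.q) S) L)
    (hxr : x ∈ seg (F.pt t, F.C)) (hyr : y ∈ seg (F.pt t, F.C)) (hxC : x ≠ F.C) (hyC : y ≠ F.C) :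
    x = y := by
  refine h.event x hx y hy (mem_triangle_of_mem_ray h0 h1 hxr) (mem_triangle_of_mem_ray h0 h1 hyr)
    hxC hyC ?_
  rw [sub_eq_of_mem_ray hxr, sub_eq_of_mem_ray hyr]
  simp

theorem good_one : F.Good S L 1 where
  diag := by
    have := h.diag_one
    rwa [path, pt_one]
  notMem f hf := by rw [pt_one]; exact h.q_notMem hf
  free := by rw [pt_one]; exact h.free_one

/-- A parameter is good if no event lies on the line of its ray. -/
theorem good_of {t : ℝ} (h0 : 0 < t) (h1 : t < 1)
    (ht : ∀ x ∈ events (insert (F.p, F.q) S) L, x ≠ F.C → F.bet x ≠ t * F.lam x) :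
    F.Good S L t := by
  have hW := h.genPos_side
  have hev : F.pt t ∉ events (insert (F.p, F.q) S) L := fun h' =>
    ht _ h' (F.pt_ne_C t) (by simp)
  have hside := F.mem_openSeg_side_of_lt h0 h1
  have hnot : ∀ f ∈ S, F.pt t ∉ seg f := by
    intro f hf hmem
    rcases mem_seg_iff.1 hmem with h' | h' | h'
    · exact hev (verts_subset_events _ _ (h' ▸ verts_mono (subset_insert _ _) (fst_mem_verts hf)))
    · exact hev (verts_subset_events _ _ (h' ▸ verts_mono (subset_insert _ _) (snd_mem_verts hf)))
    · exact hev (crossPts_subset_events _ _ ⟨f, Or.inr hf, _, Or.inl rfl,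
        fun h'' => h.notMem_side (h'' ▸ hf), h', hside⟩)
  refine ⟨⟨?_, ?_⟩, hnot, ?_⟩
  · have hWt := hW.subdivide hside h.notMem_side hnot
    have hsub : F.path S t ⊆
        insert (F.pt t, F.C) (insert (F.p, F.pt t) (insert (F.pt t, F.q) S)) := by
      rw [path, insert_comm]
      exact insert_subset_insert (insert_subset_insert (subset_insert _ _))
    refine GenPos.mono ?_ hsub
    have hCW : F.C ∈ verts (insert (F.p, F.pt t) (insert (F.pt t, F.q) S)) :=
      verts_mono ((subset_insert _ _).trans (subset_insert _ _)) h.C_mem_verts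
    have hray : ∀ z ∈ events (insert (F.p, F.q) S) L, z ∈ seg (F.pt t, F.C) → z = F.C := by
      intro z hz hzr
      by_contra hzC
      exact ht z hz hzC (F.mem_seg_ray.1 hzr).1
    refine hWt.insert_edge (F.pt_ne_C t) ?_ ?_ ?_ ?_ ?_
    · rintro (h' | h' | h')
      · exact F.p_ne_C (congrArg Prod.fst h').symm
      · exact F.pt_ne_C t (congrArg Prod.fst h').symm
      · exact hnot _ h' (snd_mem_seg (F.C, F.pt t))
    · rw [verts_insert, verts_insert]
      have key : ∀ x ∈ verts (insert (F.p, F.q) S), x ∈ seg (F.pt t, F.C) →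
          x = F.pt t ∨ x = F.C := fun x hx hx' => Or.inr (hray x (verts_subset_events _ _ hx) hx')
      rintro x (rfl | rfl | rfl | rfl | hx) hx'
      · exact key F.p (fst_mem_verts (mem_insert (F.p, F.q) S)) hx'
      · exact Or.inl rfl
      · exact Or.inl rfl
      · exact key F.q (snd_mem_verts (mem_insert (F.p, F.q) S)) hx'
      · exact key _ (verts_mono (subset_insert _ _) hx) hx'
    · intro f hf hf'
      exact hWt.eq_of_mem (snd_mem_verts (mem_insert (F.p, F.pt t) _)) hf hf'
    · intro f hf hf'
      exact hWt.eq_of_mem hCW hf hf'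
    · rintro z ⟨e, he, f, hf, hef, hze, hzf⟩ hz
      have hz' := F.mem_openSeg_ray.1 hz
      have hzC : z ≠ F.C := by
        rintro rfl
        simp at hz'
      have keyc : z ∉ crossPts (insert (F.p, F.q) S) := fun hzc =>
        hzC (hray z (crossPts_subset_events _ _ hzc) (openSeg_subset _ hz))
      have hd := fun h1 => openSeg_disjoint hside F.p_ne_q (z := z) h1
      have mv : ∀ g ∈ insert (F.p, F.pt t) (insert (F.pt t, F.q) S), z ∈ openSeg g → g ∉ S →
          z ∈ openSeg (F.p, F.q) := by
        rintro g (rfl | rfl | hg) hzg hgS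
        · exact openSeg_left_subset hside hzg
        · exact openSeg_right_subset hside hzg
        · exact absurd hg hgS
      by_cases heS : e ∈ S
      · by_cases hfS : f ∈ S
        · exact keyc ⟨e, Or.inr heS, f, Or.inr hfS, hef, hze, hzf⟩
        · exact keyc ⟨e, Or.inr heS, _, Or.inl rfl, fun h' => h.notMem_side (h' ▸ heS), hze,
            mv f hf hzf hfS⟩
      · by_cases hfS : f ∈ S
        · exact keyc ⟨f, Or.inr hfS, _, Or.inl rfl, fun h' => h.notMem_side (h' ▸ hfS), hzf,
            mv e he hze heS⟩
        · rcases he with rfl | rfl | he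
          · rcases hf with rfl | rfl | hf
            · exact hef rfl
            · exact hd (openSeg_subset _ hze) hzf
            · exact hfS hf
          · rcases hf with rfl | rfl | hf
            · exact hd (openSeg_subset _ hzf) hze
            · exact hef rfl
            · exact hfS hf
          · exact heS he
  · refine h.diag_zero.link.split h.notMem_zero ?_
    rw [verts_insert]
    rintro (h' | h' | h')
    · exact h0.ne' (F.pt_injective (h'.trans F.pt_zero.symm))
    · exact F.pt_ne_C t h'
    · exact hev (verts_subset_events _ _ (verts_mono (subset_insert _ _) h'))
  · intro m hm hmem
    have hz' := F.mem_openSeg_ray.1 hmem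
    refine ht m.1 (Or.inr ⟨m, hm, rfl⟩) ?_ hz'.1
    intro hmC
    rw [hmC] at hz'
    simp at hz'

/-- All but finitely many parameters are good. -/
theorem eventually_good (t₀ : ℝ) : ∀ᶠ t in 𝓝[≠] t₀, 0 < t → t < 1 → F.Good S L t := by
  have hfin := (h.genPos_side.finite_events h.finite).image fun x => F.bet x / F.lam x
  have : ∀ᶠ t in 𝓝[≠] t₀, t ∉ ((fun x => F.bet x / F.lam x) '' events (insert (F.p, F.q) S) L)
      \ {t₀} := by
    have := (hfin.subset (sdiff_subset (t := {t₀}))).isClosed.isOpen_compl.mem_nhds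
      (x := t₀) (fun h' => h'.2 rfl)
    exact nhdsWithin_le_nhds this
  filter_upwards [this, self_mem_nhdsWithin] with t ht hne h0 h1
  refine h.good_of h0 h1 fun x hx hxC hbt => ht ⟨⟨x, hx, ?_⟩, hne⟩
  have : F.lam x ≠ 0 := fun hl => hxC (F.ext_coord (by simp [hl]) (by simp [hbt, hl]))
  simp only [hbt]
  field_simp

/-! ### The two ends of the sweep -/

/-- An edge through neither end of a ray that belongs to the diagram is tame. -/
theorem tame_end {t : ℝ} (hgen : GenPos (insert (F.pt t, F.C) S)) {f : Edge}
    (hf : f ∈ S) (hr : F.pt t ∉ seg f) : F.Tame t f := by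
  have key : ∀ x, x ∈ verts S → x ∈ seg f → x ∈ seg (F.pt t, F.C) → x = F.C := by
    intro x hx hxf hxr
    rcases hgen.eq_of_mem (verts_mono (subset_insert _ _) hx) (Or.inl rfl) hxr with h' | h'
    · exact absurd ((show x = F.pt t from h') ▸ hxf) hr
    · exact h'
  exact tame_of_no_vertex (h.apex_of_mem hf) (key _ (fst_mem_verts hf) (fst_mem_seg f))
    (key _ (snd_mem_verts hf) (snd_mem_seg f)) hr

omit h in
theorem no_crossing_end {ρ : Edge} (hgen : GenPos (insert ρ S)) (hρ : ρ ∉ S) {f g : Edge}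
    (hf : f ∈ S) (hg : g ∈ S) (hfg : f ≠ g) {z : Plane} (hzf : z ∈ openSeg f)
    (hzg : z ∈ openSeg g) : z ∉ seg ρ := by
  intro hz
  rcases mem_seg_iff.1 hz with rfl | rfl | hz
  · exact hgen.notMem_openSeg (fst_mem_verts (mem_insert ρ S)) (Or.inr hf) hzf
  · exact hgen.notMem_openSeg (snd_mem_verts (mem_insert ρ S)) (Or.inr hf) hzf
  · have := hgen.no_triple f (Or.inr hf) g (Or.inr hg) ρ (Or.inl rfl) hfg
      (fun h' => hρ (h' ▸ hg)) (fun h' => hρ (h' ▸ hf))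
    rw [eq_empty_iff_forall_notMem] at this
    exact this z ⟨⟨hzf, hzg⟩, hz⟩

/-- The sweep can be completed once the ray is near `q`. -/
theorem eventually_end : ∀ᶠ ε in 𝓝[>] (0 : ℝ), ∀ t, 1 - ε < t → t < 1 → 0 < t → F.Good S L t →
    VI L (F.path S t) (F.path S 1) := by
  have hgen : GenPos (insert (F.q, F.C) S) := h.diag_one.gen.mono (subset_insert _ _)
  have := eventually_VI_planar h.functional h.free_side h.genPos (t₀ := 1)
    (fun f hf => h.tame_end (by rwa [pt_one]) hf (by rw [pt_one]; exact h.q_notMem hf))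
    (fun f hf g hg hfg z hzf hzg => by
      rw [pt_one]
      exact no_crossing_end hgen h.notMem_one hf hg hfg hzf hzg)
  filter_upwards [this, self_mem_nhdsWithin] with ε hε hpos t h1 h2 h3 g
  have hpos : 0 < ε := hpos
  exact hε t 1 h1 h2 (by linarith) h3 le_rfl g h.good_one

/-- Near `p` the preceding edge either stays outside the sectors or cuts through them, as in a first
Reidemeister move. -/
theorem eventually_pred {k : Edge} (hk : k ∈ S) (hkp : k.2 = F.p) :
    ∀ᶠ ε in 𝓝[>] (0 : ℝ), ∀ t', 0 < t' → t' < ε →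
      Avoids (F.pt 0) F.C (F.pt t') k ∨ Crosses k (F.pt t', F.C) := by
  obtain ⟨u, v⟩ := k
  obtain rfl : v = F.p := hkp
  have hp : F.p ∈ seg (u, F.p) := snd_mem_seg (u, F.p)
  have hup : u ≠ F.p := h.fst_ne_p hk
  have hl : ∀ s : ℝ, F.lam (u + s • (F.p - u)) = F.lam u + s * (1 - F.lam u) := by
    intro s; rw [lam_comb]; simp
  have hb : ∀ s : ℝ, F.bet (u + s • (F.p - u)) = F.bet u - s * F.bet u := by
    intro s; rw [bet_comb]; simp; ring
  have hCk : F.C ∉ seg (u, F.p) := by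
    intro hC
    exact F.p_ne_C (h.apex_of_mem hk hC F.p hp
      (mem_triangle_of_mem_ray le_rfl zero_le_one (by rw [pt_zero]; exact fst_mem_seg (F.p, F.C))))
  -- if only the end point `p` can lie in a sector then the edge avoids it
  have avoid : (∀ s : ℝ, 0 ≤ s → s ≤ 1 → F.lam u + s * (1 - F.lam u) ≤ 1 →
      0 ≤ F.bet u - s * F.bet u → s = 1) →
      ∀ᶠ ε in 𝓝[>] (0 : ℝ), ∀ t', 0 < t' → t' < ε →
        Avoids (F.pt 0) F.C (F.pt t') (u, F.p) ∨ Crosses (u, F.p) (F.pt t', F.C) := by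
    refine fun hs => Eventually.of_forall fun ε t' h0 _ => Or.inl fun z hz hzt => ?_
    obtain ⟨s, hs0, hs1, rfl⟩ := mem_seg.1 hz
    obtain ⟨-, h2, h3, -⟩ := (F.mem_sector h0).1 hzt
    dsimp only at h2 h3
    rw [hl] at h2
    rw [hb, zero_mul] at h3
    rw [hs s hs0 hs1 h2 h3]
    left; simp
  -- the position of `u` with respect to the lines `C p` and `p q` decides which case occurs
  rcases lt_trichotomy (F.bet u) 0 with hbu | hbu | hbu
  · exact avoid fun s h1 h2 _ h3 => by nlinarith
  · rcases le_or_gt (F.lam u) 1 with hlu | hlu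
    · exfalso
      rcases le_or_gt 0 (F.lam u) with hlu' | hlu'
      · have hmem : u ∈ seg (F.p, F.C) := by
          have := (F.mem_seg_ray (t := 0) (z := u)).2 ⟨by rw [hbu]; ring, hlu', hlu⟩
          simpa using this
        rcases h.diag_zero.gen.eq_of_mem (fst_mem_verts (Or.inr hk : (u, F.p) ∈ _)) (Or.inl rfl)
          hmem with h' | h'
        · exact hup h'
        · exact hCk ((show u = F.C from h') ▸ fst_mem_seg (u, F.p))
      · apply hCk
        have h1l : 0 < 1 - F.lam u := by linarith
        refine mem_seg.2 ⟨-F.lam u / (1 - F.lam u), div_nonneg (by linarith) h1l.le,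
          (div_le_one h1l).2 (by linarith), F.ext_coord ?_ ?_⟩
        · rw [hl, lam_C]; field_simp; ring
        · rw [hb, bet_C, hbu]; ring
    · exact avoid fun s h1 h2 h3 _ => by nlinarith
  · rcases lt_trichotomy (F.lam u) 1 with hlu | hlu | hlu
    · refine Frame.eventually_of_lt (δ := F.bet u / (|F.lam u| + 1)) (by positivity) ?_
      intro ε _ hε t' h0 hlt
      right
      have hlt' : t' * F.lam u < F.bet u := by
        have h3 : t' * (|F.lam u| + 1) < F.bet u := by
          have := hlt.trans hε
          rwa [lt_div_iff₀ (by positivity)] at this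
        nlinarith [le_abs_self (F.lam u)]
      have hden : 0 < F.bet u + t' * (1 - F.lam u) := by
        have : 0 < t' * (1 - F.lam u) := mul_pos h0 (by linarith)
        linarith
      have hne := hden.ne'
      have hz : F.lam u + (1 - t' / (F.bet u + t' * (1 - F.lam u))) * (1 - F.lam u) =
          F.bet u / (F.bet u + t' * (1 - F.lam u)) := by field_simp; ring
      refine ⟨u + (1 - t' / (F.bet u + t' * (1 - F.lam u))) • (F.p - u),
        mem_openSeg.2 ⟨_, ?_, ?_, rfl⟩, F.mem_openSeg_ray.2 ⟨?_, ?_, ?_⟩⟩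
      · rw [sub_pos, div_lt_one hden]; linarith
      · have : 0 < t' / (F.bet u + t' * (1 - F.lam u)) := div_pos h0 hden
        linarith
      · rw [hl, hb, hz]; field_simp; ring
      · rw [hl, hz]; positivity
      · rw [hl, hz, div_lt_one hden]
        have : 0 < t' * (1 - F.lam u) := mul_pos h0 (by linarith)
        linarith
    · exfalso
      rcases le_or_gt (F.bet u) 1 with hb1 | hb1
      · rcases hb1.eq_or_lt with hb1 | hb1
        · have : u = F.q := F.ext_coord (by simp [hlu]) (by simp [hb1])
          exact h.q_notMem hk (this ▸ fst_mem_seg (u, F.p))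
        · have : u ∈ openSeg (F.p, F.q) := by
            have := (F.mem_openSeg_side (zero_lt_one' ℝ) (z := u)).2 ⟨hlu, hbu, hb1⟩
            simpa using this
          exact h.genPos_side.notMem_openSeg (fst_mem_verts (Or.inr hk : (u, F.p) ∈ _))
            (Or.inl rfl) this
      · apply h.q_notMem hk
        refine mem_seg.2 ⟨1 - 1 / F.bet u, ?_, ?_, F.ext_coord ?_ ?_⟩
        · rw [sub_nonneg, div_le_one hbu]; exact hb1.le
        · have : 0 < 1 / F.bet u := by positivity
          linarith
        · rw [hl, hlu]; simp
        · rw [hb]; field_simp; simp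
    · exact avoid fun s h1 h2 h3 _ => by nlinarith

/-- The sweep can begin: the path `p → C` can be turned a little. -/
theorem eventually_start : ∀ᶠ ε in 𝓝[>] (0 : ℝ), ∀ t', 0 < t' → t' < ε → t' ≤ 1 →
    F.Good S L t' → VI L (insert (F.p, F.C) S) (F.path S t') := by
  obtain ⟨k, hk, hkp⟩ := h.diag_zero.link.pred (F.p, F.C) (Or.inl rfl)
  replace hk : k ∈ S := by
    rcases hk with rfl | hk
    · exact absurd hkp.symm F.p_ne_C
    · exact hk
  have hother : ∀ f ∈ S, f ≠ k → F.p ∉ seg f := by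
    intro f hf hfk hp
    rcases h.diag_zero.gen.eq_of_mem (fst_mem_verts (mem_insert (F.p, F.C) S)) (Or.inr hf) hp
      with h' | h'
    · exact h.fst_ne_p hf h'.symm
    · exact hfk (h.diag_zero.link.inInj f (Or.inr hf) k (Or.inr hk) (h'.symm.trans hkp.symm))
  have hgen : GenPos (insert (F.pt 0, F.C) S) := by rw [pt_zero]; exact h.diag_zero.gen
  filter_upwards [eventually_crossInside (F := F) h.genPos 0, h.eventually_pred hk hkp,
    eventually_all_tame (F := F) (t₀ := 0) (P := (· ≠ k)) h.genPos.finite fun f hf hfk =>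
      h.tame_end hgen hf (by rw [pt_zero]; exact hother f hf hfk), self_mem_nhdsWithin]
    with ε e1 e2 e3 hε t' h0 hlt h1 g
  have hε : 0 < ε := hε
  have hnc : ∀ f ∈ S, ∀ g ∈ S, f ≠ g → ¬ CrossInside (F.pt 0) F.C (F.pt t') f g := by
    intro f hf g hg hfg hc
    obtain ⟨z, hzf, hzg, hz⟩ := e1 0 t' (by linarith) h0 (by linarith) f hf g hg hfg hc
    refine no_crossing_end hgen ?_ hf hg hfg hzf hzg hz
    rw [pt_zero]; exact h.notMem_zero
  have hrest := e3 0 t' (by linarith) h0 (by linarith) le_rfl h1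
  have hd : Diag (insert (F.pt 0, F.C) S) := by rw [pt_zero]; exact h.diag_zero
  have hf1 : Free L (F.pt 0, F.C) := by rw [pt_zero]; exact h.free_zero
  have hf2 : Free L (F.pt 0, F.pt t') := Frame.free_side h.free_side le_rfl h0 h1
  have hd' : Diag (insert (F.pt 0, F.pt t') (insert (F.pt t', F.C) S)) := by
    have := g.diag
    rw [path] at this
    rwa [pt_zero]
  have goal : VI L (insert (F.pt 0, F.C) S)
      (insert (F.pt 0, F.pt t') (insert (F.pt t', F.C) S)) := by
    rcases e2 t' h0 hlt with h3 | h3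
    · refine VI.planar h.functional hd hd' hf1 hf2 g.free (fun f hf => ?_) hnc
      by_cases hfk : f = k
      · exact Or.inl (hfk ▸ h3)
      · exact hrest f hf hfk
    · exact VI.one h.functional hd hd' hf1 hf2 g.free hk
        (Or.inl ⟨by rw [pt_zero]; exact hkp, h3⟩) hrest hnc
  rw [pt_zero] at goal
  exact goal

end Sweepable

end Frame

namespace Frame

variable {F : Frame} {S : Set Edge} {L : Markers}

namespace Sweepable

variable (h : F.Sweepable S L)
include h

/-! ### Crossing a vertex, and the whole sweep -/

/-- The edges at the only event on a ray leave the line of the ray. -/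
theorem bet_ne_of_vertex {t₀ : ℝ} (ht0 : 0 < t₀) (ht1 : t₀ < 1) {v : Plane} (hv : v ∈ verts S)
    (hvr : v ∈ seg (F.pt t₀, F.C)) (hvC : v ≠ F.C) {f : Edge} (hf : f ∈ S) (hvf : v ∈ seg f)
    {x : Plane} (hx : x ∈ verts S) (hxf : x ∈ seg f) (hxv : x ≠ v) :
    F.bet x ≠ t₀ * F.lam x := by
  intro hbx
  have hS : S ⊆ insert (F.p, F.q) S := subset_insert _ _
  have hvE : v ∈ events (insert (F.p, F.q) S) L := verts_subset_events _ _ (verts_mono hS hv)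
  have hCf : F.C ∉ seg f := fun hC =>
    hvC (h.apex_of_mem hf hC v hvf (mem_triangle_of_mem_ray ht0.le ht1.le hvr))
  obtain ⟨hbv, hlv0, hlv1⟩ := F.mem_seg_ray.1 hvr
  have hlv : 0 < F.lam v := lt_of_le_of_ne hlv0 fun h' =>
    hvC (F.ext_coord (by simp [← h']) (by rw [hbv, ← h']; simp))
  have hseg : ∀ r : ℝ, 0 ≤ r → r ≤ 1 → v + r • (x - v) ∈ seg f := fun r h0 h1 =>
    (convex_segment f.1 f.2).segment_subset hvf hxf (mem_seg (e := (v, x)).2 ⟨r, h0, h1, rfl⟩)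
  have hlx : 0 < F.lam x := by
    by_contra hcon
    push Not at hcon
    have hpos : 0 < F.lam v - F.lam x := by linarith
    have := hseg (F.lam v / (F.lam v - F.lam x)) (by positivity) ((div_le_one hpos).2 (by linarith))
    apply hCf
    convert this using 1
    refine F.ext_coord ?_ ?_
    · rw [lam_comb, lam_C]; field_simp; ring
    · rw [bet_comb, bet_C, hbv, hbx]; field_simp; ring
  rcases le_or_gt (F.lam x) 1 with hle | hlt
  · refine hxv (h.unique_on_ray ht0.le ht1.le (verts_subset_events _ _ (verts_mono hS hx)) hvE
      (F.mem_seg_ray.2 ⟨hbx, hlx.le, hle⟩) hvr ?_ hvC)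
    rintro rfl
    simp at hlx
  · have hpos : 0 < F.lam x - F.lam v := by linarith
    have hmem := hseg ((1 - F.lam v) / (F.lam x - F.lam v)) (div_nonneg (by linarith) hpos.le)
      ((div_le_one hpos).2 (by linarith))
    have e : v + ((1 - F.lam v) / (F.lam x - F.lam v)) • (x - v) = F.pt t₀ := by
      refine F.ext_coord ?_ ?_
      · rw [lam_comb, lam_pt]; field_simp; ring
      · rw [bet_comb, bet_pt, hbv, hbx]; field_simp; ring
    rw [e] at hmem
    have hside := F.mem_openSeg_side_of_lt ht0 ht1
    have hnv : F.pt t₀ ∉ verts S := fun h' =>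
      h.genPos_side.notMem_openSeg (verts_mono hS h') (Or.inl rfl) hside
    have ho : F.pt t₀ ∈ openSeg f := by
      rcases mem_seg_iff.1 hmem with h' | h' | h'
      · exact absurd (h' ▸ fst_mem_verts hf) hnv
      · exact absurd (h' ▸ snd_mem_verts hf) hnv
      · exact h'
    have := h.unique_on_ray ht0.le ht1.le (crossPts_subset_events _ L
        ⟨f, hS hf, (F.p, F.q), Or.inl rfl,
      fun h' => h.notMem_side (h' ▸ hf), ho, hside⟩) hvE (fst_mem_seg (F.pt t₀, F.C)) hvr
      (F.pt_ne_C _) hvC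
    exact hnv (this ▸ hv)

/-- Local step of the sweep at a ray through a vertex: the corner at the vertex is cut off, the path
is turned, and the corner is restored on the other side of the path. -/
theorem eventually_VI_of_vertex {t₀ : ℝ} (ht0 : 0 < t₀) (ht1 : t₀ < 1) {v : Plane}
    (hv : v ∈ verts S) (hvr : v ∈ seg (F.pt t₀, F.C)) (hvC : v ≠ F.C) :
    ∀ᶠ ε in 𝓝[>] (0 : ℝ), ∀ t t', t₀ - ε < t → t < t₀ → t₀ < t' → t' < t₀ + ε → 0 < t → t' ≤ 1 →
      F.Good S L t → F.Good S L t' → VI L (F.path S t) (F.path S t') := by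
  have hS : S ⊆ insert (F.p, F.q) S := subset_insert _ _
  have hL := h.functional
  have hvE : v ∈ events (insert (F.p, F.q) S) L := verts_subset_events _ _ (verts_mono hS hv)
  obtain ⟨hbv, hlv0, hlv1⟩ := F.mem_seg_ray.1 hvr
  have hlv : 0 < F.lam v := lt_of_le_of_ne hlv0 fun h' =>
    hvC (F.ext_coord (by simp [← h']) (by rw [hbv, ← h']; simp))
  have hside := F.mem_openSeg_side_of_lt ht0 ht1
  have hvpt : v ≠ F.pt t₀ := fun h' =>
    h.genPos_side.notMem_openSeg (verts_mono hS hv) (Or.inl rfl) (h' ▸ hside)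
  have hlv' : F.lam v < 1 := lt_of_le_of_ne hlv1 fun h' =>
    hvpt (F.ext_coord (by simp [h']) (by simp [hbv, h']))
  have hvp : v ≠ F.p := by
    rintro rfl
    simp at hlv'
  -- the two edges at `v`
  obtain ⟨⟨u, hu⟩, ⟨w, hw⟩⟩ : (∃ u, (u, v) ∈ S) ∧ ∃ w, (v, w) ∈ S := by
    have hin : ∀ e ∈ insert (F.p, F.C) S, e.2 = v → ∃ u, (u, v) ∈ S := by
      rintro e (rfl | he) rfl
      · exact absurd rfl hvC
      · exact ⟨e.1, he⟩
    have hout : ∀ e ∈ insert (F.p, F.C) S, e.1 = v → ∃ w, (v, w) ∈ S := by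
      rintro e (rfl | he) rfl
      · exact absurd rfl hvp
      · exact ⟨e.2, he⟩
    obtain ⟨f, hf, rfl | rfl⟩ := hv
    · obtain ⟨e, he, hef⟩ := h.diag_zero.link.pred f (Or.inr hf)
      exact ⟨hin e he hef, hout f (Or.inr hf) rfl⟩
    · obtain ⟨e, he, hef⟩ := h.diag_zero.link.succ f (Or.inr hf)
      exact ⟨hin f (Or.inr hf) rfl, hout e he hef⟩
  have huv : u ≠ v := h.genPos.ne _ hu
  have hvw : v ≠ w := h.genPos.ne _ hw
  set S₂ := S \ {(u, v), (v, w)} with hS₂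
  have hS₂S : S₂ ⊆ S := sdiff_subset
  have hu₂ : (u, v) ∉ S₂ := fun h' => h'.2 (Or.inl rfl)
  have hw₂ : (v, w) ∉ S₂ := fun h' => h'.2 (Or.inr rfl)
  have hSeq : S = insert (u, v) (insert (v, w) S₂) := by
    ext e
    simp only [hS₂, mem_insert_iff, Set.mem_sdiff, mem_singleton_iff]
    constructor
    · intro he
      by_cases h1 : e = (u, v)
      · exact Or.inl h1
      by_cases h2 : e = (v, w)
      · exact Or.inr (Or.inl h2)
      · exact Or.inr (Or.inr ⟨he, by tauto⟩)
    · rintro (rfl | rfl | h')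
      · exact hu
      · exact hw
      · exact h'.1
  have hpathS : ∀ t, F.path S t = insert (u, v) (insert (v, w) (F.path S₂ t)) := by
    intro t
    rw [path, hSeq, path]
    ext e
    simp only [mem_insert_iff]
    tauto
  have hv₂ : ∀ f ∈ S₂, v ∉ seg f := by
    intro f hf hvf
    rcases h.genPos.eq_of_mem hv (hS₂S hf) hvf with h' | h'
    · have := h.diag_zero.link.outInj f (Or.inr (hS₂S hf)) (v, w) (Or.inr hw) h'.symm
      exact hw₂ (this ▸ hf)
    · have := h.diag_zero.link.inInj f (Or.inr (hS₂S hf)) (u, v) (Or.inr hu) h'.symm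
      exact hu₂ (this ▸ hf)
  have hvside : v ∉ seg (F.p, F.q) := by
    intro h'
    have : v ∈ seg (F.pt 0, F.pt 1) := by simpa using h'
    linarith [(F.mem_seg_side zero_le_one this).1]
  have hσu : F.bet u ≠ t₀ * F.lam u := h.bet_ne_of_vertex ht0 ht1 hv hvr hvC hu
    (snd_mem_seg (u, v)) (fst_mem_verts hu) (fst_mem_seg (u, v)) huv
  have hσw : F.bet w ≠ t₀ * F.lam w := h.bet_ne_of_vertex ht0 ht1 hv hvr hvC hw
    (fst_mem_seg (v, w)) (snd_mem_verts hw) (snd_mem_seg (v, w)) hvw.symm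
  -- a small triangle at `v`
  obtain ⟨δ, hδ0, hδ1, hδS, hδside, hδlam, hδm⟩ : ∃ δ : ℝ, 0 < δ ∧ δ < 1 ∧
      (∀ f ∈ S₂, ∀ z ∈ seg f, z ∉ triangle (v + δ • (u - v)) (v + δ • (w - v)) v) ∧
      (∀ z ∈ seg (F.p, F.q), z ∉ triangle (v + δ • (u - v)) (v + δ • (w - v)) v) ∧
      (∀ z ∈ triangle (v + δ • (u - v)) (v + δ • (w - v)) v, 0 < F.lam z ∧ F.lam z < 1) ∧
      ∀ m ∈ L, m.1 ∉ triangle (v + δ • (u - v)) (v + δ • (w - v)) v := by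
    have hfin₂ := h.genPos.finite.subset hS₂S
    have e1 : ∀ᶠ δ in 𝓝[>] (0 : ℝ), ∀ f ∈ S₂, ∀ z ∈ seg f,
        z ∉ triangle (v + δ • (u - v)) (v + δ • (w - v)) (v + δ • (0 : Plane)) := by
      rw [eventually_all_finite hfin₂]
      exact fun f hf => eventually_triangle_notMem (isCompact_seg f).isClosed (hv₂ f hf) _ _ _
    have e2 := eventually_triangle_notMem (isCompact_seg (F.p, F.q)).isClosed hvside (u - v) (w - v)
        0
    have e3 := eventually_triangle_subset (v := v) (U := {z | 0 < F.lam z ∧ F.lam z < 1})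
      (F.continuous_lam.continuousAt.eventually_mem (Ioo_mem_nhds hlv hlv')) (u - v) (w - v) 0
    have e4 : ∀ᶠ δ in 𝓝[>] (0 : ℝ), ∀ m ∈ L,
        m.1 ∉ triangle (v + δ • (u - v)) (v + δ • (w - v)) (v + δ • (0 : Plane)) := by
      rw [eventually_all_finite h.finite]
      intro m hm
      have hvm : v ∉ ({m.1} : Set Plane) := by
        rintro rfl
        exact h.marks m hm (verts_mono hS hv)
      filter_upwards [eventually_triangle_notMem isClosed_singleton hvm (u - v) (w - v) 0]
        with δ hδ using hδ m.1 rfl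
    have e5 : ∀ᶠ δ in 𝓝[>] (0 : ℝ), 0 < δ ∧ δ < 1 := Ioo_mem_nhdsGT one_pos
    obtain ⟨δ, h1, h2, h3, h4, h5⟩ := (e1.and (e2.and (e3.and (e4.and e5)))).exists
    rw [smul_zero, add_zero] at h1 h2 h3 h4
    exact ⟨δ, h5.1, h5.2, h1, h2, h3, h4⟩
  set u' := v + δ • (u - v) with hu'
  set w' := v + δ • (w - v) with hw'
  have huΔ : u' ∈ triangle u' w' v := fst_mem_triangle _ _ _
  have hwΔ : w' ∈ triangle u' w' v := snd_mem_triangle _ _ _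
  have hsubΔ : seg (u', w') ⊆ triangle u' w' v := seg_subset_triangle huΔ hwΔ
  have hu'o : u' ∈ openSeg (u, v) :=
    mem_openSeg.2 ⟨1 - δ, by linarith, by linarith, by rw [hu']; dsimp only; module⟩
  have hw'o : w' ∈ openSeg (v, w) := mem_openSeg.2 ⟨δ, hδ0, hδ1, by rw [hw']⟩
  set S' := insert (u, u') (insert (u', w') (insert (w', w) S₂)) with hS'
  have hpathS' : ∀ t, insert (u, u') (insert (u', w') (insert (w', w) (F.path S₂ t))) =
      F.path S' t := by
    intro t
    rw [path, path, hS']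
    ext e
    simp only [mem_insert_iff]
    tauto
  -- the corner can be cut off as long as the path stays near the ray
  have hcut : ∀ᶠ t in 𝓝 t₀, t ≠ t₀ → 0 < t → t < 1 → F.Good S L t →
      F.Good S' L t ∧ VI L (F.path S t) (F.path S' t) := by
    have c1 : ∀ᶠ t in 𝓝 t₀, F.bet u' - t * F.lam u' ≠ 0 := by
      have hc : ContinuousAt (fun t => F.bet u' - t * F.lam u') t₀ := by fun_prop
      refine hc.eventually_ne ?_
      have : F.bet u' - t₀ * F.lam u' = δ * (F.bet u - t₀ * F.lam u) := by
        rw [hu', lam_comb, bet_comb, hbv]; ring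
      rw [this]
      exact mul_ne_zero hδ0.ne' (sub_ne_zero.2 hσu)
    have c2 : ∀ᶠ t in 𝓝 t₀, F.bet w' - t * F.lam w' ≠ 0 := by
      have hc : ContinuousAt (fun t => F.bet w' - t * F.lam w') t₀ := by fun_prop
      refine hc.eventually_ne ?_
      have : F.bet w' - t₀ * F.lam w' = δ * (F.bet w - t₀ * F.lam w) := by
        rw [hw', lam_comb, bet_comb, hbv]; ring
      rw [this]
      exact mul_ne_zero hδ0.ne' (sub_ne_zero.2 hσw)
    filter_upwards [c1, c2] with t hu0 hw0 hne h0 h1 g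
    have hd := g.diag
    rw [hpathS t] at hd
    have hptΔ : F.pt t ∉ triangle u' w' v := fun h' => by simpa using (hδlam _ h').2
    have hCΔ : F.C ∉ triangle u' w' v := fun h' => by simpa using (hδlam _ h').1
    have hptv : F.pt t ≠ v := fun h' => hptΔ (h' ▸ trd_mem_triangle _ _ _)
    have key := cut_corner (T := F.path S₂ t) (ρ := (F.pt t, F.C))
      (σ := fun z => F.bet z - t * F.lam z) hL hδ0 hδ1 hd ?_ ?_ (Or.inr (Or.inl rfl)) ?_ hptΔ hCΔ
      ?_ ?_ hu0 hw0 ?_ hδm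
    · rw [hpathS', ← hpathS] at key
      refine ⟨⟨key.1, ?_, g.free⟩, key.2⟩
      rintro f (rfl | rfl | rfl | hf)
      · exact fun h' => g.notMem _ hu (seg_left_subset hu'o h')
      · exact fun h' => hptΔ (hsubΔ h')
      · exact fun h' => g.notMem _ hw (seg_right_subset hw'o h')
      · exact g.notMem f (hS₂S hf)
    · rintro (h' | h' | h')
      · exact hptv (congrArg Prod.snd h').symm
      · exact hvC (congrArg Prod.snd h')
      · exact hu₂ h'
    · rintro (h' | h' | h')
      · exact hvp (congrArg Prod.fst h')
      · exact hptv (congrArg Prod.fst h').symm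
      · exact hw₂ h'
    · rintro f (rfl | rfl | hf) hfρ z hz
      · exact hδside z (seg_left_subset (F.mem_openSeg_side_of_lt h0 h1) hz)
      · exact absurd rfl hfρ
      · exact hδS f hf z hz
    · intro x y s
      simp only [lam_comb, bet_comb]; ring
    · rw [hbv]
      have : t₀ * F.lam v - t * F.lam v = (t₀ - t) * F.lam v := by ring
      rw [this]
      exact mul_ne_zero (sub_ne_zero.2 hne.symm) hlv.ne'
    · intro z hz
      obtain ⟨h3, h4⟩ := hδlam z hz
      rw [F.mem_seg_ray, sub_eq_zero]
      exact ⟨fun h' => h'.1, fun h' => ⟨h', h3.le, h4.le⟩⟩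
  -- after the corner is cut off, the ray carries no events
  have hgS' : GenPos S' := by
    have hI : ∀ᶠ t in 𝓝[≠] t₀, 0 < t ∧ t < 1 :=
      nhdsWithin_le_nhds (Ioo_mem_nhds ht0 ht1)
    obtain ⟨t, ⟨h1, h2⟩, h3, h4, h5⟩ := ((hI.and ((h.eventually_good t₀).and
      ((hcut.filter_mono nhdsWithin_le_nhds).and self_mem_nhdsWithin))).exists :
      ∃ t, _ ∧ _ ∧ _ ∧ t ∈ ({t₀}ᶜ : Set ℝ))
    refine (h4 h5 h1 h2 (h3 h1 h2)).1.diag.gen.mono ?_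
    rw [path]
    exact (subset_insert _ _).trans (subset_insert _ _)
  have ray_u : ∀ z ∈ seg (u, u'), z ∉ seg (F.pt t₀, F.C) := by
    intro z hz hzr
    obtain ⟨r, hr0, hr1, rfl⟩ := mem_seg.1 hz
    have h1 := (F.mem_seg_ray.1 hzr).1
    dsimp only at h1
    have e : u + r • (u' - u) = v + (1 - r * (1 - δ)) • (u - v) := by rw [hu']; module
    rw [e, lam_comb, bet_comb, hbv] at h1
    have h2 : (1 - r * (1 - δ)) * (F.bet u - t₀ * F.lam u) = 0 := by linear_combination h1
    rcases mul_eq_zero.1 h2 with h3 | h3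
    · nlinarith
    · exact hσu (by linarith)
  have ray_w : ∀ z ∈ seg (w', w), z ∉ seg (F.pt t₀, F.C) := by
    intro z hz hzr
    rw [← seg_swap] at hz
    obtain ⟨r, hr0, hr1, rfl⟩ := mem_seg.1 hz
    have h1 := (F.mem_seg_ray.1 hzr).1
    dsimp only [Prod.fst_swap, Prod.snd_swap] at h1
    have e : w + r • (w' - w) = v + (1 - r * (1 - δ)) • (w - v) := by rw [hw']; module
    rw [e, lam_comb, bet_comb, hbv] at h1
    have h2 : (1 - r * (1 - δ)) * (F.bet w - t₀ * F.lam w) = 0 := by linear_combination h1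
    rcases mul_eq_zero.1 h2 with h3 | h3
    · nlinarith
    · exact hσw (by linarith)
  have tame_u'w' : F.Tame t₀ (u', w') := by
    refine tame_of_no_vertex (f := (u', w')) ?_ ?_ ?_ ?_
    · exact fun h' => absurd (hδlam _ (hsubΔ h')).1 (by simp)
    · exact fun h' => absurd h' (ray_u u' (snd_mem_seg (u, u')))
    · exact fun h' => absurd h' (ray_w w' (fst_mem_seg (w', w)))
    · exact fun h' => absurd (hδlam _ (hsubΔ h')).2 (by simp)
  have tame₂ : ∀ f ∈ S₂, F.Tame t₀ f := by
    intro f hf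
    have key : ∀ x ∈ verts S, x ∈ seg f → x ∈ seg (F.pt t₀, F.C) → x = F.C := by
      intro x hx hxf hxr
      by_contra hxC
      have := h.unique_on_ray ht0.le ht1.le (verts_subset_events _ L (verts_mono hS hx)) hvE hxr hvr
        hxC hvC
      exact hv₂ f hf (this ▸ hxf)
    have hfS := hS₂S hf
    refine tame_of_no_vertex (h.apex_of_mem hfS) (key _ (fst_mem_verts hfS) (fst_mem_seg f))
      (key _ (snd_mem_verts hfS) (snd_mem_seg f)) ?_
    intro hr
    have hrr := fst_mem_seg (F.pt t₀, F.C)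
    rcases mem_seg_iff.1 hr with h' | h' | h'
    · exact F.pt_ne_C _ (key _ (h' ▸ fst_mem_verts hfS) hr hrr)
    · exact F.pt_ne_C _ (key _ (h' ▸ snd_mem_verts hfS) hr hrr)
    · refine hvpt (h.unique_on_ray ht0.le ht1.le hvE (crossPts_subset_events _ L ⟨f, hS hfS,
        (F.p, F.q), Or.inl rfl, fun h'' => h.notMem_side (h'' ▸ hfS), h', hside⟩) hvr hrr hvC
        (F.pt_ne_C _))
  have hnc : ∀ f ∈ S', ∀ g ∈ S', f ≠ g → ∀ z, z ∈ openSeg f → z ∈ openSeg g →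
      z ∉ seg (F.pt t₀, F.C) := by
    have k2 : ∀ f ∈ S₂, ∀ g ∈ S₂, f ≠ g → ∀ z, z ∈ openSeg f → z ∈ openSeg g →
        z ∉ seg (F.pt t₀, F.C) := by
      intro f hf g hg hfg z hzf hzg hz
      have hzC : z ≠ F.C := by
        rintro rfl
        exact h.genPos.notMem_openSeg h.C_mem_verts (hS₂S hf) hzf
      have := h.unique_on_ray ht0.le ht1.le (crossPts_subset_events _ L (crossPts_mono hS
        ⟨f, hS₂S hf, g, hS₂S hg, hfg, hzf, hzg⟩)) hvE hz hvr hzC hvC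
      exact hv₂ f hf (this ▸ openSeg_subset _ hzf)
    rintro f (rfl | rfl | rfl | hf) g hg hfg z hzf hzg
    · exact ray_u z (openSeg_subset _ hzf)
    · rcases hg with rfl | rfl | rfl | hg
      · exact ray_u z (openSeg_subset _ hzg)
      · exact absurd rfl hfg
      · exact ray_w z (openSeg_subset _ hzg)
      · exact absurd (hsubΔ (openSeg_subset _ hzf)) (hδS g hg z (openSeg_subset _ hzg))
    · exact ray_w z (openSeg_subset _ hzf)
    · rcases hg with rfl | rfl | rfl | hg
      · exact ray_u z (openSeg_subset _ hzg)
      · exact absurd (hsubΔ (openSeg_subset _ hzg)) (hδS f hf z (openSeg_subset _ hzf))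
      · exact ray_w z (openSeg_subset _ hzg)
      · exact k2 f hf g hg hfg z hzf hzg
  have hplanar := eventually_VI_planar (t₀ := t₀) hL h.free_side hgS' (by
    rintro f (rfl | rfl | rfl | hf)
    · exact Or.inl ray_u
    · exact tame_u'w'
    · exact Or.inl ray_w
    · exact tame₂ f hf) hnc
  filter_upwards [hplanar, eventually_of_nhds hcut, eventually_of_lt (sub_pos.2 ht1) fun ε _ h' =>
      h']
    with ε e1 e2 e3 t t' h1 h2 h3 h4 h5 h6 g g'
  obtain ⟨k1, k2⟩ := e2 t h1 (by linarith) h2.ne h5 (by linarith) g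
  obtain ⟨k1', k2'⟩ := e2 t' (by linarith) h4 h3.ne' (by linarith) (by linarith) g'
  exact k2.trans ((e1 t t' h1 (h2.trans h3) h4 h5 h6 k1 k1').trans k2'.symm)

/-- Local step of the sweep at any ray in the interior of the triangle. -/
theorem eventually_VI {t₀ : ℝ} (ht0 : 0 < t₀) (ht1 : t₀ < 1) :
    ∀ᶠ ε in 𝓝[>] (0 : ℝ), ∀ t t', t₀ - ε < t → t < t₀ → t₀ < t' → t' < t₀ + ε → 0 < t → t' ≤ 1 →
      F.Good S L t → F.Good S L t' → VI L (F.path S t) (F.path S t') := by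
  by_cases hex : ∃ v ∈ verts S, v ∈ seg (F.pt t₀, F.C) ∧ v ≠ F.C
  · obtain ⟨v, hv, hvr, hvC⟩ := hex
    exact h.eventually_VI_of_vertex ht0 ht1 hv hvr hvC
  · push Not at hex
    refine eventually_VI_of_no_vertex h.functional h.free_side h.genPos_side h.notMem_side
      (fun f hf => h.apex_of_mem hf) ht0 ht1 hex fun x hx y hy hxr hyr => ?_
    have hCv := verts_mono (subset_insert (F.p, F.q) S) h.C_mem_verts
    exact h.unique_on_ray ht0.le ht1.le (crossPts_subset_events _ L hx)
      (crossPts_subset_events _ L hy) hxr hyr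
      (fun h' => h.genPos_side.crossPts_disjoint_verts hCv (h' ▸ hx))
      (fun h' => h.genPos_side.crossPts_disjoint_verts hCv (h' ▸ hy))

/-- An edge with virtual crossings only can be swept across a triangle. The parameters up to which
the sweep succeeds have a supremum; by the local steps it is `1`, and the end of the sweep applies.
-/
theorem VI : VI L (insert (F.p, F.C) S) (insert (F.p, F.q) (insert (F.q, F.C) S)) := by
  have hpath1 : F.path S 1 = insert (F.p, F.q) (insert (F.q, F.C) S) := by rw [path, pt_one]
  rw [← hpath1]
  set A : Set ℝ := {x | 0 < x ∧ x ≤ 1 ∧ ∀ᶠ t in 𝓝[<] x, F.Good S L t →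
    VirtualLink.VI L (insert (F.p, F.C) S) (F.path S t)} with hA
  have good_left : ∀ x, 0 < x → x ≤ 1 → ∀ᶠ t in 𝓝[<] x, F.Good S L t := by
    intro x h0 h1
    filter_upwards [(h.eventually_good x).filter_mono (nhdsWithin_mono x fun y hy => ne_of_lt hy),
      Ioo_mem_nhdsLT h0] with t ht htI
    exact ht htI.1 (htI.2.trans_le h1)
  obtain ⟨ε₀, hs, hε₀⟩ := (h.eventually_start.and self_mem_nhdsWithin).exists
  have hε₀ : 0 < ε₀ := hε₀
  have hA0 : min ε₀ 1 ∈ A := by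
    have hpos : 0 < min ε₀ 1 := lt_min hε₀ one_pos
    refine ⟨hpos, min_le_right _ _, ?_⟩
    filter_upwards [Ioo_mem_nhdsLT hpos] with t ht g
    exact hs t ht.1 (ht.2.trans_le (min_le_left _ _)) (ht.2.le.trans (min_le_right _ _)) g
  have hbdd : BddAbove A := ⟨1, fun x hx => hx.2.1⟩
  set y := sSup A with hy
  have hy0 : 0 < y := hA0.1.trans_le (le_csSup hbdd hA0)
  have hy1 : y ≤ 1 := csSup_le ⟨_, hA0⟩ fun x hx => hx.2.1
  have hreach : ∀ ε > 0, ∃ t, y - ε < t ∧ t < y ∧ 0 < t ∧ F.Good S L t ∧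
      VirtualLink.VI L (insert (F.p, F.C) S) (F.path S t) := by
    intro ε hε
    obtain ⟨a, ha, hay⟩ := exists_lt_of_lt_csSup ⟨_, hA0⟩ (show y - ε < sSup A by linarith)
    have hmax : max (y - ε) 0 < a := max_lt hay ha.1
    obtain ⟨t, h1, h2, h3⟩ := (ha.2.2.and ((good_left a ha.1 ha.2.1).and
        (Ioo_mem_nhdsLT hmax))).exists
    exact ⟨t, (le_max_left _ _).trans_lt h3.1, h3.2.trans_le (le_csSup hbdd ha),
      (le_max_right _ _).trans_lt h3.1, h2, h1 h2⟩
  rcases hy1.eq_or_lt with hy1 | hy1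
  · obtain ⟨ε, he, hε⟩ := (h.eventually_end.and self_mem_nhdsWithin).exists
    obtain ⟨t, h1, h2, h3, h4, h5⟩ := hreach ε hε
    rw [hy1] at h1 h2
    exact h5.trans (he t h1 h2 h3 h4)
  · exfalso
    obtain ⟨ε, he, hε⟩ := ((h.eventually_VI hy0 hy1).and self_mem_nhdsWithin).exists
    have hε : 0 < ε := hε
    obtain ⟨t, h1, h2, h3, h4, h5⟩ := hreach ε hε
    have hlt : y < min (y + ε) 1 := lt_min (by linarith) hy1
    have hmem : min (y + ε) 1 ∈ A := by
      refine ⟨hy0.trans hlt, min_le_right _ _, ?_⟩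
      filter_upwards [Ioo_mem_nhdsLT hlt] with t' ht' g'
      exact h5.trans (he t t' h1 h2 ht'.1 (ht'.2.trans_le (min_le_left _ _)) h3
        (ht'.2.le.trans (min_le_right _ _)) h4 g')
    exact absurd (le_csSup hbdd hmem) (not_le.2 hlt)

end Sweepable

end Frame

/-! ### Points in general position to a diagram -/

/-- The point `c` lies on no line through two events. -/
def GenericPoint (S : Set Edge) (L : Markers) (c : Plane) : Prop :=
  ∀ x ∈ events S L, ∀ y ∈ events S L, x ≠ y → det (x - c) (y - c) ≠ 0

/-- In any box there are points on no line through two of finitely many given points. -/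
theorem exists_det_ne {E : Set Plane} (hE : E.Finite) {X X' h h' : ℝ} (hX : X < X') (hh : h < h') :
    ∃ c : Plane, X < c.1 ∧ c.1 < X' ∧ h < c.2 ∧ c.2 < h' ∧ c.1 ∉ Prod.fst '' E ∧
      ∀ x ∈ E, ∀ y ∈ E, x ≠ y → det (x - c) (y - c) ≠ 0 := by
  obtain ⟨k, ⟨hk, hk'⟩, hkE⟩ :=
    ((Ioo_infinite hh).sdiff (hE.image Prod.snd)).nonempty
  -- at a fixed height the determinant is an affine function of the abscissa
  have hfin : ((fun z : Plane × Plane =>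
      (z.1.1 * (z.2.2 - k) - (z.1.2 - k) * z.2.1) / (z.2.2 - z.1.2)) '' (E ×ˢ E)).Finite :=
    (hE.prod hE).image _
  obtain ⟨s, ⟨hs1, hs2⟩, hs⟩ :=
    ((Ioo_infinite hX).sdiff (hfin.union (hE.image Prod.fst))).nonempty
  refine ⟨(s, k), hs1, hs2, hk, hk', fun h => hs (Or.inr h), fun x hx y hy hxy h0 => ?_⟩
  simp only [det, Prod.fst_sub, Prod.snd_sub] at h0
  by_cases h2 : y.2 = x.2
  · have h3 : (x.1 - y.1) * (x.2 - k) = 0 := by rw [h2] at h0; linarith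
    rcases mul_eq_zero.1 h3 with h4 | h4
    · exact hxy (Prod.ext (sub_eq_zero.1 h4) h2.symm)
    · exact hkE ⟨x, hx, sub_eq_zero.1 h4⟩
  · refine hs (Or.inl ⟨(x, y), ⟨hx, hy⟩, ?_⟩)
    have : y.2 - x.2 ≠ 0 := sub_ne_zero.2 h2
    field_simp
    linarith

theorem exists_genericPoint {S : Set Edge} {L : Markers} (hS : GenPos S) (hL : L.Finite) {h h' : ℝ}
    (hh : h < h') : ∃ c : Plane, h < c.2 ∧ c.2 < h' ∧ GenericPoint S L c := by
  obtain ⟨c, -, -, h1, h2, -, h3⟩ := exists_det_ne (hS.finite_events hL) zero_lt_one hh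
  exact ⟨c, h1, h2, h3⟩

theorem det_of_mem_seg {x c z : Plane} (hz : z ∈ seg (x, c)) : det (x - c) (z - c) = 0 := by
  obtain ⟨s, -, -, rfl⟩ := mem_seg.1 hz
  have : x + s • (c - x) - c = (1 - s) • (x - c) := by module
  dsimp only
  rw [this]; simp

theorem det_of_mem_seg' {x c z : Plane} (hz : z ∈ seg (c, x)) : det (x - c) (z - c) = 0 :=
  det_of_mem_seg (by rw [← seg_swap]; exact hz)

namespace GenericPoint

variable {S T : Set Edge} {L : Markers} {c : Plane}

theorem mono (h : GenericPoint T L c) (hST : S ⊆ T) : GenericPoint S L c :=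
  fun x hx y hy => h x (events_mono hST L hx) y (events_mono hST L hy)

theorem notMem_events (h : GenericPoint S L c) (hS : GenPos S) {e : Edge} (he : e ∈ S) :
    c ∉ events S L := by
  intro hc
  have key : ∀ x ∈ events S L, c = x := by
    intro x hx
    by_contra hcx
    exact h c hc x hx hcx (by simp)
  apply hS.ne e he
  rw [← key _ (verts_subset_events _ _ (fst_mem_verts he)),
    ← key _ (verts_subset_events _ _ (snd_mem_verts he))]

theorem notMem_verts (h : GenericPoint S L c) (hS : GenPos S) : c ∉ verts S := by
  rintro ⟨e, he, hce⟩
  exact h.notMem_events hS he (verts_subset_events _ _ ⟨e, he, hce⟩)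

theorem notMem_seg (h : GenericPoint S L c) (hS : GenPos S) {e : Edge} (he : e ∈ S) :
    c ∉ seg e := by
  intro hc
  refine h _ (verts_subset_events _ _ (fst_mem_verts he)) _
    (verts_subset_events _ _ (snd_mem_verts he)) (hS.ne e he) ?_
  obtain ⟨s, -, -, rfl⟩ := mem_seg.1 hc
  have h1 : e.1 - (e.1 + s • (e.2 - e.1)) = (-s) • (e.2 - e.1) := by module
  have h2 : e.2 - (e.1 + s • (e.2 - e.1)) = (1 - s) • (e.2 - e.1) := by module
  rw [h1, h2, det_smul_left, det_smul_right, det_self]; ring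

theorem eq_of_mem_seg (h : GenericPoint S L c) {x z : Plane} (hx : x ∈ events S L)
    (hz : z ∈ events S L) (hzx : z ∈ seg (x, c)) : z = x := by
  by_contra hne
  exact h x hx z hz (Ne.symm hne) (det_of_mem_seg hzx)

theorem genPos_insert (h : GenericPoint S L c) (hS : GenPos S) {x : Plane} (hx : x ∈ verts S) :
    GenPos (insert (x, c) S) := by
  have hxE := verts_subset_events S L hx
  refine hS.insert_edge ?_ ?_ ?_ ?_ ?_ ?_
  · rintro (rfl : x = c)
    exact h.notMem_verts hS hx
  · exact fun h' => h.notMem_verts hS (fst_mem_verts h')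
  · exact fun v hv hv' => Or.inl (h.eq_of_mem_seg hxE (verts_subset_events _ _ hv) hv')
  · exact fun f hf hf' => hS.eq_of_mem hx hf hf'
  · exact fun f hf hf' => absurd hf' (h.notMem_seg hS hf)
  · intro z hz hzx
    have := h.eq_of_mem_seg hxE (crossPts_subset_events _ _ hz) (openSeg_subset _ hzx)
    exact hS.crossPts_disjoint_verts (this ▸ hx) hz

/-- A generic point may be joined to two vertices. -/
theorem genPos_insert_insert (h : GenericPoint S L c) (hS : GenPos S) {x y : Plane}
    (hx : x ∈ verts S)
    (hy : y ∈ verts S) (hxy : x ≠ y) : GenPos (insert (x, c) (insert (c, y) S)) := by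
  have hxE := verts_subset_events S L hx
  have hyE := verts_subset_events S L hy
  have hc := h.notMem_verts hS
  rw [insert_comm]
  have h1 := h.genPos_insert hS hx
  have hyc : ∀ z, z ∈ seg (c, y) → z ∈ seg (y, c) := fun z hz => by rw [← seg_swap]; exact hz
  refine h1.insert_edge ?_ ?_ ?_ ?_ ?_ ?_
  · rintro (rfl : c = y)
    exact hc hy
  · rintro (h' | h')
    · exact hxy (congrArg Prod.fst h').symm
    · exact hc (snd_mem_verts h')
  · rw [verts_insert]
    rintro v (rfl | rfl | hv) hv'
    · exact Or.inr (h.eq_of_mem_seg hyE hxE (hyc _ hv'))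
    · exact Or.inl rfl
    · exact Or.inr (h.eq_of_mem_seg hyE (verts_subset_events _ _ hv) (hyc _ hv'))
  · intro f hf hf'
    exact h1.eq_of_mem (snd_mem_verts (mem_insert (x, c) S)) hf hf'
  · intro f hf hf'
    exact h1.eq_of_mem (verts_mono (subset_insert _ _) hy) hf hf'
  · have key : ∀ z, z ∈ openSeg (x, c) → z ∉ openSeg (c, y) := by
      intro z hz hz'
      obtain ⟨s, hs0, hs1, rfl⟩ := mem_openSeg.1 hz
      have hd := det_of_mem_seg (hyc _ (openSeg_subset _ hz'))
      have e : (x, c).1 + s • ((x, c).2 - (x, c).1) - c = (1 - s) • (x - c) := by module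
      rw [e, det_smul_right] at hd
      rcases mul_eq_zero.1 hd with h3 | h3
      · linarith
      · exact h y hyE x hxE hxy.symm h3
    have keyS : ∀ z ∈ crossPts S, z ∉ openSeg (c, y) := by
      intro z hz hzx
      have := h.eq_of_mem_seg hyE (crossPts_subset_events _ _ hz) (hyc _ (openSeg_subset _ hzx))
      exact hS.crossPts_disjoint_verts (this ▸ hy) hz
    rintro z ⟨e, rfl | he, f, rfl | hf, hef, hze, hzf⟩
    · exact absurd rfl hef
    · exact key z hze
    · exact key z hzf
    · exact keyS z ⟨e, he, f, hf, hef, hze, hzf⟩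

theorem free (h : GenericPoint S L c) (hm : ∀ m ∈ L, m.1 ∉ verts S) {x : Plane} (hx : x ∈ verts S) :
    Free L (x, c) := by
  intro m hmL hmx
  have := h.eq_of_mem_seg (verts_subset_events _ _ hx) (Or.inr ⟨m, hmL, rfl⟩)
    (openSeg_subset _ hmx)
  exact hm m hmL (this ▸ hx)

end GenericPoint

theorem Free.reverse {L : Markers} {x y : Plane} (h : Free L (x, y)) : Free L (y, x) := by
  intro m hm hmx
  rw [← openSeg_swap] at hmx
  exact h m hm hmx

/-! ### Inserting a generic point into an edge -/

theorem events_reverse (S : Set Edge) (L : Markers) : events (Prod.swap ⁻¹' S) L = events S L := by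
  rw [events, events, verts_reverse, crossPts_reverse]

theorem preimage_swap_swap (S : Set Edge) : Prod.swap ⁻¹' (Prod.swap ⁻¹' S) = S := rfl

theorem crossPts_subdivide {a b d : Plane} (hd : d ∈ openSeg (a, b)) (hab : a ≠ b) {S : Set Edge}
    (hS : (a, b) ∉ S) :
    crossPts (insert (a, d) (insert (d, b) S)) ⊆ crossPts (insert (a, b) S) := by
  have mv : ∀ {z : Plane} {e : Edge}, e = (a, d) ∨ e = (d, b) → z ∈ openSeg e →
      z ∈ openSeg (a, b) := by
    rintro z e (rfl | rfl) hz
    · exact openSeg_left_subset hd hz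
    · exact openSeg_right_subset hd hz
  rintro z ⟨e, he, f, hf, hef, hze, hzf⟩
  have he' : (e = (a, d) ∨ e = (d, b)) ∨ e ∈ S := by
    rcases he with h | h | h
    · exact Or.inl (Or.inl h)
    · exact Or.inl (Or.inr h)
    · exact Or.inr h
  have hf' : (f = (a, d) ∨ f = (d, b)) ∨ f ∈ S := by
    rcases hf with h | h | h
    · exact Or.inl (Or.inl h)
    · exact Or.inl (Or.inr h)
    · exact Or.inr h
  rcases he' with he' | he' <;> rcases hf' with hf' | hf'
  · rcases he' with rfl | rfl <;> rcases hf' with rfl | rfl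
    · exact absurd rfl hef
    · exact absurd hzf (openSeg_disjoint hd hab (openSeg_subset _ hze))
    · exact absurd hze (openSeg_disjoint hd hab (openSeg_subset _ hzf))
    · exact absurd rfl hef
  · exact ⟨_, Or.inl rfl, f, Or.inr hf', fun h => hS (h ▸ hf'), mv he' hze, hzf⟩
  · exact ⟨e, Or.inr he', _, Or.inl rfl, fun h => hS (h ▸ he'), hze, mv hf' hzf⟩
  · exact ⟨e, Or.inr he', f, Or.inr hf', hef, hze, hzf⟩

/-- Points of the edge `p q` near `q`, but different from `q`, do not lie on the line `x y`, unless
it is the line `p q`. -/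
theorem eventually_det_ne {p q x y : Plane} (hxy : x ≠ y)
    (h : det (q - p) (x - p) ≠ 0 ∨ det (q - p) (y - p) ≠ 0) :
    ∀ᶠ δ in 𝓝[>] (0 : ℝ), det (x - (q + δ • (p - q))) (y - (q + δ • (p - q))) ≠ 0 := by
  have e : ∀ δ : ℝ, det (x - (q + δ • (p - q))) (y - (q + δ • (p - q))) =
      det (x - q) (y - q) + δ * det (p - q) (x - y) := by
    intro δ; simp [det]; ring
  simp only [e]
  by_cases h0 : det (x - q) (y - q) = 0
  · have hk : det (p - q) (x - y) ≠ 0 := by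
      intro hk
      have hxy' : x - y ≠ 0 := sub_ne_zero.2 hxy
      have h1 : det (x - y) (x - q) = 0 := by simp [det] at h0 ⊢; linarith
      have h2 : det (x - y) (y - q) = 0 := by simp [det] at h0 ⊢; linarith
      have h3 := det_eq_zero_trans hxy' hk h1
      have h4 := det_eq_zero_trans hxy' hk h2
      rcases h with h | h <;> apply h
      · simp [det] at h3 ⊢; linarith
      · simp [det] at h4 ⊢; linarith
    filter_upwards [self_mem_nhdsWithin] with δ hδ
    rw [h0, zero_add]
    exact mul_ne_zero (ne_of_gt hδ) hk
  · have hc : ContinuousAt (fun δ : ℝ => det (x - q) (y - q) + δ * det (p - q) (x - y)) 0 := by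
      fun_prop
    exact nhdsWithin_le_nhds (hc.eventually_ne (by simpa using h0))

/-- An edge with virtual crossings only may be replaced by the two edges through a generic point:
subdivide it at a point `r` near its end, sweep from `r`, and sweep back from the generic point. -/
theorem VI.insert_generic {L : Markers} {S : Set Edge} {p q c : Plane} (hL : Functional L)
    (hfin : L.Finite) (hd : Diag (insert (p, q) S)) (hpq : (p, q) ∉ S)
    (hm : ∀ m ∈ L, m.1 ∉ verts (insert (p, q) S)) (hfree : Free L (p, q))
    (hc : GenericPoint (insert (p, q) S) L c) :
    Diag (insert (p, c) (insert (c, q) S)) ∧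
      VI L (insert (p, q) S) (insert (p, c) (insert (c, q) S)) := by
  set W := insert (p, q) S with hW
  have hne : p ≠ q := hd.gen.ne _ (Or.inl rfl)
  have hpW : p ∈ verts W := fst_mem_verts (mem_insert (p, q) S)
  have hqW : q ∈ verts W := snd_mem_verts (mem_insert (p, q) S)
  have hcV : c ∉ verts W := hc.notMem_verts hd.gen
  have hcE : c ∉ events W L := hc.notMem_events hd.gen (mem_insert (p, q) S)
  have hpc : p ≠ c := fun h => hcV (h ▸ hpW)
  have hqc : q ≠ c := fun h => hcV (h ▸ hqW)
  set U := insert (p, c) (insert (c, q) W) with hU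
  have hUg : GenPos U := hc.genPos_insert_insert hd.gen hpW hqW hne
  have hWU : W ⊆ U := (subset_insert _ _).trans (subset_insert _ _)
  have hEfin := hUg.finite_events hfin
  have hd0 : Diag (insert (p, c) (insert (c, q) S)) :=
    ⟨hUg.mono (insert_subset_insert (insert_subset_insert (subset_insert _ _))),
      hd.link.split hpq hcV⟩
  refine ⟨hd0, ?_⟩
  have hcline : det (q - p) (c - p) ≠ 0 := by
    have := hc p (verts_subset_events _ _ hpW) q (verts_subset_events _ _ hqW) hne
    simp [det] at this ⊢
    intro h; apply this; linarith
  have hcU : c ∈ events U L := verts_subset_events _ _ (snd_mem_verts (mem_insert (p, c) _))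
  have hpU : p ∈ events U L := verts_subset_events _ _ (verts_mono hWU hpW)
  have hqU : q ∈ events U L := verts_subset_events _ _ (verts_mono hWU hqW)
  obtain ⟨δ, ⟨hδ0, hδ1⟩, hA, hB⟩ : ∃ δ : ℝ, (0 < δ ∧ δ < 1) ∧
      (∀ x ∈ events U L, ∀ y ∈ events U L, x ≠ y →
        (det (q - p) (x - p) ≠ 0 ∨ det (q - p) (y - p) ≠ 0) →
        det (x - (q + δ • (p - q))) (y - (q + δ • (p - q))) ≠ 0) ∧
      ∀ x ∈ events U L, x ≠ q → x ∉ seg (q, q + δ • (p - q)) := by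
    have e1 : ∀ᶠ δ in 𝓝[>] (0 : ℝ), 0 < δ ∧ δ < 1 := Ioo_mem_nhdsGT one_pos
    have e2 : ∀ᶠ δ in 𝓝[>] (0 : ℝ), ∀ x ∈ events U L, ∀ y ∈ events U L, x ≠ y →
        (det (q - p) (x - p) ≠ 0 ∨ det (q - p) (y - p) ≠ 0) →
        det (x - (q + δ • (p - q))) (y - (q + δ • (p - q))) ≠ 0 := by
      rw [eventually_all_finite hEfin]
      intro x hx
      rw [eventually_all_finite hEfin]
      intro y hy
      rw [eventually_imp_distrib_left]
      intro hxy
      rw [eventually_imp_distrib_left]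
      exact fun h => eventually_det_ne hxy h
    have e3 : ∀ᶠ δ in 𝓝[>] (0 : ℝ), ∀ x ∈ events U L, x ≠ q → x ∉ seg (q, q + δ • (p - q)) := by
      rw [eventually_all_finite hEfin]
      intro x hx
      rw [eventually_imp_distrib_left]
      intro hxq
      filter_upwards [eventually_triangle_notMem isClosed_singleton
        (show q ∉ ({x} : Set Plane) from fun h => hxq h.symm) 0 (p - q) 0] with δ hδ hxs
      refine hδ x rfl (seg_subset_triangle ?_ ?_ hxs)
      · simpa using fst_mem_triangle q (q + δ • (p - q)) q
      · simpa using snd_mem_triangle q (q + δ • (p - q)) q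
    exact (e1.and (e2.and e3)).exists
  set r := q + δ • (p - q) with hr
  have hro : r ∈ openSeg (p, q) :=
    mem_openSeg.2 ⟨1 - δ, by linarith, by linarith, by rw [hr]; dsimp only; module⟩
  have hrc : r ≠ c := fun h => hc.notMem_seg hd.gen (mem_insert (p, q) S) (h ▸ openSeg_subset _ hro)
  have hdc : ∀ x ∈ events U L, x ≠ c → det (x - r) (c - r) ≠ 0 := fun x hx hxc =>
    hA x hx c hcU hxc (Or.inr hcline)
  have hrE : r ∉ events U L := fun h => hdc r h hrc (by simp)
  have hrV : r ∉ verts U := fun h => hrE (verts_subset_events _ _ h)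
  have hrS : ∀ f ∈ S, r ∉ seg f := by
    intro f hf hrf
    have hfU : f ∈ U := hWU (Or.inr hf)
    rcases mem_seg_iff.1 hrf with h | h | h
    · exact hrV (h ▸ fst_mem_verts hfU)
    · exact hrV (h ▸ snd_mem_verts hfU)
    · exact hrE (crossPts_subset_events _ _ ⟨f, hfU, (p, q), hWU (Or.inl rfl),
        fun h' => hpq (h' ▸ hf), h, hro⟩)
  have hrpc : r ∉ seg (p, c) := by
    intro h
    apply hdc p hpU hpc
    have := det_of_mem_seg h
    simp [det] at this ⊢; linarith
  have hrcq : r ∉ seg (c, q) := by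
    intro h
    apply hdc q hqU hqc
    have := det_of_mem_seg' h
    simp [det] at this ⊢; linarith
  have hsub : crossPts (insert (p, r) (insert (r, q) (insert (p, c) (insert (c, q) S)))) ⊆
      crossPts U := by
    refine (crossPts_subdivide hro hne ?_).trans (crossPts_mono ?_)
    · rintro (h | h | h)
      · exact hqc (congrArg Prod.snd h)
      · exact hpc (congrArg Prod.fst h)
      · exact hpq h
    · rw [hU, insert_comm (p, q), insert_comm (p, q)]
  have hpqU : (p, q) ∉ insert (p, c) (insert (c, q) S) := by
    rintro (h | h | h)
    · exact hqc (congrArg Prod.snd h)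
    · exact hpc (congrArg Prod.fst h)
    · exact hpq h
  have hUr : GenPos (insert (p, r) (insert (r, q) (insert (p, c) (insert (c, q) S)))) := by
    refine GenPos.subdivide hro (S := insert (p, c) (insert (c, q) S)) ?_ hpqU ?_
    · rwa [insert_comm (p, q), insert_comm (p, q)]
    · rintro f (rfl | rfl | hf)
      · exact hrpc
      · exact hrcq
      · exact hrS f hf
  have hVr : ∀ v ∈ verts (insert (p, r) (insert (r, q) (insert (p, c) (insert (c, q) S)))),
      v = r ∨ v ∈ events U L := by
    have hS : verts S ⊆ events U L := fun v hv => verts_subset_events _ _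
      (verts_mono ((subset_insert _ _).trans hWU) hv)
    simp only [verts_insert, mem_insert_iff]
    rintro v (rfl | rfl | rfl | rfl | rfl | rfl | rfl | rfl | hv)
    · exact Or.inr hpU
    · exact Or.inl rfl
    · exact Or.inl rfl
    · exact Or.inr hqU
    · exact Or.inr hpU
    · exact Or.inr hcU
    · exact Or.inr hcU
    · exact Or.inr hqU
    · exact Or.inr (hS hv)
  -- the edge from `r` to `c`
  have hd1 : Diag (insert (p, r) (insert (r, c) (insert (c, q) S))) := by
    refine ⟨?_, hd0.link.split ?_ ?_⟩
    · have : insert (p, r) (insert (r, c) (insert (c, q) S)) ⊆ insert (r, c)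
          (insert (p, r) (insert (r, q) (insert (p, c) (insert (c, q) S)))) := by
        rw [insert_comm]
        exact insert_subset_insert (insert_subset_insert
          ((subset_insert _ _).trans (subset_insert _ _)))
      refine GenPos.mono ?_ this
      refine hUr.insert_edge hrc ?_ ?_ ?_ ?_ ?_
      · rintro (h | h | h | h | h)
        · exact hpc (congrArg Prod.fst h).symm
        · exact hrc (congrArg Prod.fst h).symm
        · exact hpc (congrArg Prod.fst h).symm
        · exact hrV (verts_mono hWU ((show r = q from congrArg Prod.snd h) ▸ hqW))
        · exact hcV (fst_mem_verts (e := (c, r)) (Or.inr h))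
      · intro v hv hvs
        rcases hVr v hv with rfl | hv
        · exact Or.inl rfl
        · right
          by_contra hvc
          refine hdc v hv hvc ?_
          have := det_of_mem_seg' hvs
          rw [det_comm, this, neg_zero]
      · intro f hf hf'
        exact hUr.eq_of_mem (snd_mem_verts (mem_insert (p, r) _)) hf hf'
      · intro f hf hf'
        refine hUr.eq_of_mem (verts_mono ((subset_insert _ _).trans (subset_insert _ _))
          (snd_mem_verts (mem_insert (p, c) _))) hf hf'
      · intro z hz hzs
        have hzc : z ≠ c := by
          rintro rfl
          exact snd_notMem_openSeg (e := (r, z)) hrc hzs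
        refine hdc z (crossPts_subset_events _ _ (hsub hz)) hzc ?_
        have := det_of_mem_seg' (openSeg_subset _ hzs)
        rw [det_comm, this, neg_zero]
    · rintro (h | h)
      · exact hpc (congrArg Prod.fst h)
      · exact hcV (snd_mem_verts (e := (p, c)) (Or.inr h))
    · exact fun h => hrV (verts_mono (insert_subset_insert (insert_subset_insert
        (subset_insert _ _))) h)
  have hfrc : Free L (r, c) := by
    intro m hmL hms
    have hmc : m.1 ≠ c := fun h => hcE (h ▸ Or.inr ⟨m, hmL, rfl⟩)
    refine hdc m.1 (Or.inr ⟨m, hmL, rfl⟩) hmc ?_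
    have := det_of_mem_seg' (openSeg_subset _ hms)
    rw [det_comm, this, neg_zero]
  have hmr : ∀ m ∈ L, m.1 ≠ r := fun m hmL h => hrE (h ▸ Or.inr ⟨m, hmL, rfl⟩)
  have hmc : ∀ m ∈ L, m.1 ≠ c := fun m hmL h => hcE (h ▸ Or.inr ⟨m, hmL, rfl⟩)
  have hmp : ∀ m ∈ L, m.1 ≠ p := fun m hmL h => hm m hmL (h ▸ hpW)
  have hmq : ∀ m ∈ L, m.1 ≠ q := fun m hmL h => hm m hmL (h ▸ hqW)
  have hmS : ∀ m ∈ L, m.1 ∉ verts S := fun m hmL h =>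
    hm m hmL (verts_mono (subset_insert _ _) h)
  have s1 : VI L W (insert (p, r) (insert (r, q) S)) := VI.subdivide hro hL hd hpq hrS
  have hds := hd.subdivide hro hpq hrS
  have s2 : VI L (insert (p, r) (insert (r, q) S))
      (insert (p, r) (insert (r, c) (insert (c, q) S))) := by
    let F : Frame := ⟨r, q, c, hdc q hqU hqc⟩
    have hF : F.Sweepable (Prod.swap ⁻¹' (insert (p, r) S)) L := by
      refine ⟨hL, hfin, ?_, ?_, ?_, ?_, ?_, hc.free hm hqW, ?_, hfrc.reverse⟩
      · have := hds.reverse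
        rw [insert_comm, preimage_swap_insert] at this
        exact this
      · have := hd1.reverse
        rw [insert_comm (r, c), insert_comm (p, r), insert_comm (p, r), preimage_swap_insert,
          preimage_swap_insert] at this
        exact this
      · intro f hf hfr z hz hzt
        rw [preimage_swap_insert] at hf
        rcases hf with rfl | hf
        · obtain ⟨s, hs0, hs1, rfl⟩ := mem_seg.1 hz
          have hlp : F.lam p < 0 := by
            have : p = F.p + (1 / δ) • (F.C - F.p) := by
              change p = q + (1 / δ) • (r - q)
              rw [hr, add_sub_cancel_left, smul_smul, one_div_mul_cancel hδ0.ne']; module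
            rw [this, Frame.lam_comb, Frame.lam_C, Frame.lam_p]
            have : 1 < 1 / δ := by rw [lt_div_iff₀ hδ0]; linarith
            linarith
          have h0 : 0 ≤ F.lam (F.C + s • (p - F.C)) := by
            refine ((F.mem_sector (t := 0) (t' := 1) one_pos).1 ?_).1
            rwa [Frame.pt_zero, Frame.pt_one]
          rw [Frame.lam_comb, Frame.lam_C] at h0
          have : s = 0 := by nlinarith
          rw [this]; simp; rfl
        · exact absurd ((show f.1 = r from hfr) ▸ snd_mem_seg f.swap) (hrS f.swap hf)
      · have hsubE : ∀ x ∈ events (insert (q, c) (Prod.swap ⁻¹' (insert (p, r) S))) L, x ≠ r →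
            x ∈ events U L := by
          intro x hx hxr
          rw [← preimage_swap_insert, events_reverse] at hx
          rcases hx with (hx | hx) | hx
          · refine (hVr x (verts_mono ?_ hx)).resolve_left hxr
            intro e
            simp only [mem_insert_iff]
            tauto
          · refine crossPts_subset_events _ _ (hsub (crossPts_mono ?_ hx))
            intro e
            simp only [mem_insert_iff]
            tauto
          · exact Or.inr hx
        have hline : ∀ x ∈ events U L, x ∈ triangle q r c → det (q - p) (x - p) = 0 → x = q := by
          intro x hx hxt h0
          by_contra hxq
          refine hB x hx hxq ?_
          have h1 : det (F.pt 0 - F.C) (x - F.C) = 0 := by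
            rw [Frame.pt_zero]
            change det (q - r) (x - r) = 0
            rw [hr]
            simp [det] at h0 ⊢
            linear_combination δ * h0
          have h2 := (F.det_pt_eq_zero_iff 0 x).1 h1
          have h3 := (F.mem_sector (t := 0) (t' := 1) (z := x) one_pos).1 (by
            rwa [Frame.pt_zero, Frame.pt_one])
          have h4 := (F.mem_seg_ray (t := 0) (z := x)).2 ⟨h2, h3.1, h3.2.1⟩
          rwa [Frame.pt_zero] at h4
        intro x hx y hy hxt hyt hxr hyr h0
        have hx' := hsubE x hx hxr
        have hy' := hsubE y hy hyr
        by_contra hxy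
        by_cases hl : det (q - p) (x - p) ≠ 0 ∨ det (q - p) (y - p) ≠ 0
        · exact hA x hx' y hy' hxy hl h0
        · push Not at hl
          exact hxy ((hline x hx' hxt hl.1).trans (hline y hy' hyt hl.2).symm)
      · intro m hmL
        change m.1 ∉ verts (insert (q, c) (Prod.swap ⁻¹' (insert (p, r) S)))
        rw [← preimage_swap_insert, verts_reverse, verts_insert, verts_insert]
        rintro (h | h | h | h | h)
        · exact hmc m hmL h
        · exact hmq m hmL h
        · exact hmp m hmL h
        · exact hmr m hmL h
        · exact hmS m hmL h
      · intro m hmL hms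
        refine hfree m hmL (openSeg_right_subset hro ?_)
        rw [← openSeg_swap]
        exact hms
    have := hF.VI.reverse
    change VI L (Prod.swap ⁻¹' (insert (q, r) (Prod.swap ⁻¹' (insert (p, r) S))))
      (Prod.swap ⁻¹' (insert (q, c) (insert (c, r) (Prod.swap ⁻¹' (insert (p, r) S))))) at this
    simp only [preimage_swap_insert, preimage_swap_swap] at this
    rwa [insert_comm (p, r) (r, q), insert_comm (r, c) (c, q), insert_comm (p, r) (c, q),
      insert_comm (p, r) (r, c)]
  have s3 : VI L (insert (p, c) (insert (c, q) S))
      (insert (p, r) (insert (r, c) (insert (c, q) S))) := by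
    let F : Frame := ⟨c, p, r, by
      have := hdc p hpU hpc
      simp [det] at this ⊢
      intro h; apply this; linarith⟩
    have hapex : ∀ z ∈ seg (c, q), z ∈ triangle p c r → z = c := by
      intro z hz hzt
      obtain ⟨s, hs0, hs1, rfl⟩ := mem_seg.1 hz
      have e : q = F.pt (1 / (1 - δ)) := by
        change q = p + (1 / (1 - δ)) • (r - p)
        have : r - p = (1 - δ) • (q - p) := by rw [hr]; module
        rw [this, smul_smul, one_div_mul_cancel (by linarith)]; module
      have hτ : 1 < 1 / (1 - δ) := by rw [lt_div_iff₀ (by linarith)]; linarith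
      have h3 := (F.mem_sector (t := 0) (t' := 1) (z := F.C + s • (q - F.C)) one_pos).1 (by
            rwa [Frame.pt_zero, Frame.pt_one])
      rw [Frame.lam_comb, Frame.bet_comb, e, Frame.lam_pt, Frame.bet_pt, Frame.lam_C,
        Frame.bet_C] at h3
      have : s = 0 := by nlinarith [h3.2.2.2]
      rw [this]; simp
    have hF : F.Sweepable (insert (c, q) S) L := by
      refine ⟨hL, hfin, hd0, hd1, ?_, ?_, ?_, ?_, hc.free hm hpW, hfrc⟩
      · rintro f (rfl | hf) hfc
        · exact hapex
        · exact absurd ((show f.1 = c from hfc) ▸ fst_mem_verts (Or.inr hf : f ∈ W)) hcV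
      · have hsubE : ∀ x ∈ events (insert (p, r) (insert (c, q) S)) L, x ∈ triangle p c r → x ≠ c →
            x ∈ events W L ∨ x = r := by
          rintro x ((hx | hx) | hx) hxt hxc
          · rw [verts_insert, verts_insert] at hx
            rcases hx with rfl | rfl | rfl | rfl | hx
            · exact Or.inl (verts_subset_events _ _ hpW)
            · exact Or.inr rfl
            · exact absurd rfl hxc
            · exact Or.inl (verts_subset_events _ _ hqW)
            · exact Or.inl (verts_subset_events _ _ (verts_mono (subset_insert _ _) hx))
          · left
            obtain ⟨e, he, f, hf, hef, hxe, hxf⟩ := hx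
            have mv : ∀ g ∈ insert (p, r) (insert (c, q) S), x ∈ openSeg g →
                g ∈ insert (p, r) (insert (r, q) S) := by
              rintro g (rfl | rfl | hg) hxg
              · exact Or.inl rfl
              · exact absurd (hapex x (openSeg_subset _ hxg) hxt) hxc
              · exact Or.inr (Or.inr hg)
            exact crossPts_subset_events _ _ (crossPts_subdivide hro hne hpq
              ⟨e, mv e he hxe, f, mv f hf hxf, hef, hxe, hxf⟩)
          · exact Or.inl (Or.inr hx)
        intro x hx y hy hxt hyt hxc hyc h0
        change det (x - c) (y - c) = 0 at h0
        rcases hsubE x hx hxt hxc with hx' | rfl <;> rcases hsubE y hy hyt hyc with hy' | rfl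
        · by_contra hxy
          exact hc x hx' y hy' hxy h0
        · exfalso
          refine hdc x (events_mono hWU L hx') hxc ?_
          simp [det] at h0 ⊢; linarith
        · exfalso
          refine hdc y (events_mono hWU L hy') hyc ?_
          simp [det] at h0 ⊢; linarith
        · rfl
      · intro m hmL
        change m.1 ∉ verts (insert (p, r) (insert (c, q) S))
        rw [verts_insert, verts_insert]
        rintro (h | h | h | h | h)
        · exact hmp m hmL h
        · exact hmr m hmL h
        · exact hmc m hmL h
        · exact hmq m hmL h
        · exact hmS m hmL h
      · exact fun m hmL hms => hfree m hmL (openSeg_left_subset hro hms)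
    exact hF.VI
  exact s1.trans (s2.trans s3.symm)

/-! ### Replacing an edge by a polygonal path -/

/-- The edges of the polygonal path from `a` to `b` through the points of a list. -/
def chain : Plane → List Plane → Plane → Set Edge
  | a, [], b => {(a, b)}
  | a, P :: ps, b => insert (a, P) (chain P ps b)

/-- Replacing an edge by a path through new vertices keeps the combinatorial type of a link. -/
theorem LinkSet.chain {b : Plane} (ps : List Plane) : ∀ {S : Set Edge} {a : Plane},
    LinkSet (insert (a, b) S) → (a, b) ∉ S → ps.Nodup → (∀ P ∈ ps, P ∉ verts (insert (a, b) S)) →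
      LinkSet (S ∪ chain a ps b) := by
  induction ps with
  | nil =>
    intro S a h _ _ _
    rwa [VirtualLink.chain, union_singleton]
  | cons P ps ih =>
    intro S a h hab hnd hv
    have hP := hv P List.mem_cons_self
    have hPS : P ∉ verts S := fun h' => hP (verts_mono (subset_insert _ _) h')
    have hPa : P ≠ a := fun h' => hP (h' ▸ fst_mem_verts (mem_insert (a, b) S))
    have h1 := h.split hab hP
    rw [insert_comm] at h1
    have := ih h1 ?_ (List.nodup_cons.1 hnd).2 ?_
    · rwa [VirtualLink.chain, union_insert, ← insert_union]
    · rintro (h' | h')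
      · exact hPa (congrArg Prod.fst h')
      · exact hPS (fst_mem_verts h')
    · intro Q hQ
      have hQ' := hv Q (List.mem_cons_of_mem _ hQ)
      have hQP : Q ≠ P := fun h' => (List.nodup_cons.1 hnd).1 (h' ▸ hQ)
      rw [verts_insert] at hQ'
      rw [verts_insert, verts_insert]
      rintro (h' | h' | h' | h' | h')
      · exact hQP h'
      · exact hQ' (Or.inr (Or.inl h'))
      · exact hQ' (Or.inl h')
      · exact hQP h'
      · exact hQ' (Or.inr (Or.inr h'))

/-- Two generic points `C'`, `C` below a diagram, through which a strand ending at `b` can be led.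
-/
structure LowPair (U : Set Edge) (L : Markers) (b C C' : Plane) : Prop where
  functional : Functional L
  finite : L.Finite
  gen : GenPos U
  mem : b ∈ verts U
  marks : ∀ m ∈ L, m.1 ∉ verts U
  generic' : GenericPoint U L C'
  generic : ∀ x ∈ verts U, x ≠ b → GenericPoint (insert (x, C') (insert (C', b) U)) L C
  low : ∀ v ∈ verts U, C.2 < v.2
  lower : C'.2 < C.2

theorem exists_lowPair {U : Set Edge} {L : Markers} {b : Plane} (hL : Functional L)
    (hfin : L.Finite) (hU : GenPos U) (hb : b ∈ verts U) (hm : ∀ m ∈ L, m.1 ∉ verts U) :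
    ∃ C C' : Plane, LowPair U L b C C' := by
  obtain ⟨k, hk⟩ := (hU.finite_verts.image Prod.snd).bddBelow
  have hk' : ∀ v ∈ verts U, k ≤ v.2 := fun v hv => hk ⟨v, hv, rfl⟩
  obtain ⟨C', -, h2, h3⟩ := exists_genericPoint hU hfin (show k - 2 < k - 1 by linarith)
  have hE : (⋃ x ∈ {x ∈ verts U | x ≠ b}, events (insert (x, C') (insert (C', b) U)) L).Finite :=
    (hU.finite_verts.subset (sep_subset _ _)).biUnion fun x hx =>
      (h3.genPos_insert_insert hU hx.1 hb hx.2).finite_events hfin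
  obtain ⟨C, -, -, h4, h5, -, h6⟩ := exists_det_ne hE zero_lt_one (show k - 1 < k by linarith)
  refine ⟨C, C', hL, hfin, hU, hb, hm, h3, fun x hx hxb y hy z hz => ?_,
    fun v hv => h5.trans_le (hk' v hv), by linarith⟩
  refine h6 y ?_ z ?_
  · simp only [mem_iUnion]
    exact ⟨x, ⟨hx, hxb⟩, hy⟩
  · simp only [mem_iUnion]
    exact ⟨x, ⟨hx, hxb⟩, hz⟩

namespace LowPair

variable {U S : Set Edge} {L : Markers} {b C C' x P : Plane}

theorem notMem' (h : LowPair U L b C C') : C' ∉ verts U := h.generic'.notMem_verts h.gen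

theorem notMem (h : LowPair U L b C C') : C ∉ verts U := fun h' => lt_irrefl _ (h.low C h')

theorem ne (h : LowPair U L b C C') : C ≠ C' := fun h' => h.lower.ne (by rw [h'])

theorem marks_ne' (h : LowPair U L b C C') : ∀ m ∈ L, m.1 ≠ C' := by
  obtain ⟨e, he, -⟩ := h.mem
  exact fun m hm h' => h.generic'.notMem_events h.gen he (h' ▸ Or.inr ⟨m, hm, rfl⟩)

theorem generic_tail (h : LowPair U L b C C') (hx : x ∈ verts U) (hxb : x ≠ b) :
    GenericPoint (insert (C', b) U) L C := (h.generic x hx hxb).mono (subset_insert _ _)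

theorem gen_tail (h : LowPair U L b C C') (hx : x ∈ verts U) (hxb : x ≠ b) :
    GenPos (insert (x, C') (insert (C', b) U)) := h.generic'.genPos_insert_insert h.gen hx h.mem hxb

theorem marks_tail (h : LowPair U L b C C') : ∀ m ∈ L, m.1 ∉ verts (insert (C', b) U) := by
  intro m hm
  rw [verts_insert]
  rintro (h' | h' | h')
  · exact h.marks_ne' m hm h'
  · exact h.marks m hm (h' ▸ h.mem)
  · exact h.marks m hm h'

/-- The general position of the path through the two low points. -/
theorem gen_path (h : LowPair U L b C C') (hx : x ∈ verts U) (hxb : x ≠ b) (hS : S ⊆ U) :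
    GenPos (insert (x, C) (insert (C, C') (insert (C', b) S))) := by
  have hg := (h.gen_tail hx hxb).mono (subset_insert _ _)
  refine ((h.generic_tail hx hxb).genPos_insert_insert hg (verts_mono (subset_insert _ _) hx)
    (fst_mem_verts (mem_insert (C', b) U)) fun h' => h.notMem' ((show x = C' from h') ▸ hx)).mono ?_
  exact insert_subset_insert (insert_subset_insert (insert_subset_insert hS))

/-- The last edge of a path may be led through the two low points. -/
theorem VI_edge (h : LowPair U L b C C') (hS : insert (x, b) S ⊆ U) (hxS : (x, b) ∉ S)
    (hd : Diag (insert (x, b) S)) (hfree : Free L (x, b)) :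
    Diag (insert (x, C) (insert (C, C') (insert (C', b) S))) ∧
      VI L (insert (x, b) S) (insert (x, C) (insert (C, C') (insert (C', b) S))) := by
  have hx : x ∈ verts U := fst_mem_verts (hS (mem_insert (x, b) S))
  have hxb : x ≠ b := h.gen.ne _ (hS (mem_insert (x, b) S))
  have h1 := VI.insert_generic h.functional h.finite hd hxS
    (fun m hm h' => h.marks m hm (verts_mono hS h')) hfree (h.generic'.mono hS)
  have hsub : insert (x, C') (insert (C', b) S) ⊆ insert (x, C') (insert (C', b) U) :=
    insert_subset_insert (insert_subset_insert ((subset_insert _ _).trans hS))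
  have h2 := VI.insert_generic h.functional h.finite h1.1 ?_ ?_ (h.generic'.free h.marks hx)
    ((h.generic x hx hxb).mono hsub)
  · exact ⟨h2.1, h1.2.trans h2.2⟩
  · rintro (h' | h')
    · exact h.notMem' ((show x = C' from congrArg Prod.fst h') ▸ hx)
    · exact h.notMem' (snd_mem_verts (hS (Or.inr h')))
  · intro m hm h'
    rw [verts_insert] at h'
    rcases h' with h' | h' | h'
    · exact h.marks m hm (h' ▸ hx)
    · exact h.marks_ne' m hm h'
    · exact h.marks_tail m hm (verts_mono (insert_subset_insert ((subset_insert _ _).trans hS)) h')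

/-- One step along the path: the edge `x → C` is swept across the triangle to `x → P → C`. -/
theorem VI_step (h : LowPair U L b C C') (hS : insert (x, P) S ⊆ U) (hxb : x ≠ b) (hPb : P ≠ b)
    (hd : Diag (insert (x, C) (insert (C, C') (insert (C', b) S))))
    (hP : P ∉ verts S) (hfree : Free L (x, P)) :
    Diag (insert (P, C) (insert (C, C') (insert (C', b) (insert (x, P) S)))) ∧
      VI L (insert (x, C) (insert (C, C') (insert (C', b) S)))
        (insert (P, C) (insert (C, C') (insert (C', b) (insert (x, P) S)))) := by
  have hxP := hS (mem_insert (x, P) S)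
  have hx : x ∈ verts U := fst_mem_verts hxP
  have hPU : P ∈ verts U := snd_mem_verts hxP
  have hne : x ≠ P := h.gen.ne _ hxP
  have hSU : S ⊆ U := (subset_insert _ _).trans hS
  have hgen := h.generic_tail hx hxb
  have hev : ∀ {v}, v ∈ verts U → v ∈ events (insert (C', b) U) L := fun hv =>
    verts_subset_events _ _ (verts_mono (subset_insert _ _) hv)
  have hset : insert (P, C) (insert (C, C') (insert (C', b) (insert (x, P) S))) =
      insert (x, P) (insert (P, C) (insert (C, C') (insert (C', b) S))) := by
    ext e
    simp only [mem_insert_iff]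
    tauto
  have hd1 : Diag (insert (P, C) (insert (C, C') (insert (C', b) (insert (x, P) S)))) := by
    refine ⟨h.gen_path hPU hPb hS, ?_⟩
    rw [hset]
    refine hd.link.split ?_ ?_
    · rintro (h' | h' | h')
      · exact h.notMem ((show x = C from congrArg Prod.fst h') ▸ hx)
      · exact h.notMem' ((show x = C' from congrArg Prod.fst h') ▸ hx)
      · exact h.notMem (snd_mem_verts (hSU h'))
    · rw [verts_insert, verts_insert, verts_insert]
      rintro (h' | h' | h' | h' | h' | h' | h')
      · exact hne h'.symm
      · exact h.notMem ((show P = C from h') ▸ hPU)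
      · exact h.notMem ((show P = C from h') ▸ hPU)
      · exact h.notMem' ((show P = C' from h') ▸ hPU)
      · exact h.notMem' ((show P = C' from h') ▸ hPU)
      · exact hPb h'
      · exact hP h'
  refine ⟨hd1, ?_⟩
  rw [hset] at hd1 ⊢
  let F : Frame := ⟨C, x, P, hgen x (hev hx) P (hev hPU) hne⟩
  -- the triangle lies above its apex, the next edge below it
  have hlow : ∀ z ∈ triangle x C P, z.2 ≤ C.2 → z = C := by
    intro z hz hzC
    have h1 := (F.mem_sector (t := 0) (t' := 1) (z := z) one_pos).1 (by
      rwa [Frame.pt_zero, Frame.pt_one])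
    have h2 : z = C + (F.lam z - F.bet z) • (x - C) + F.bet z • (P - C) := F.eq_comb z
    have h3 := congrArg Prod.snd h2
    simp only [Prod.snd_add, Prod.smul_snd, Prod.snd_sub, smul_eq_mul] at h3
    have h4 := h.low x hx
    have h5 := h.low P hPU
    have h6 : 0 ≤ F.lam z - F.bet z := by linarith [h1.2.2.2]
    have h7 : 0 ≤ F.bet z := by linarith [h1.2.2.1]
    have h8 : 0 ≤ (F.lam z - F.bet z) * (x.2 - C.2) := mul_nonneg h6 (by linarith)
    have h9 : 0 ≤ F.bet z * (P.2 - C.2) := mul_nonneg h7 (by linarith)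
    have h10 : (F.lam z - F.bet z) * (x.2 - C.2) = 0 := by linarith
    have h11 : F.bet z * (P.2 - C.2) = 0 := by linarith
    have h12 : F.lam z - F.bet z = 0 := (mul_eq_zero.1 h10).resolve_right (by linarith)
    have h13 : F.bet z = 0 := (mul_eq_zero.1 h11).resolve_right (by linarith)
    rw [h2, h12, h13]; simp
  have hnext : ∀ z ∈ seg (C, C'), z.2 ≤ C.2 := by
    intro z hz
    obtain ⟨s, hs0, hs1, rfl⟩ := mem_seg.1 hz
    simp only [Prod.snd_add, Prod.smul_snd, Prod.snd_sub, smul_eq_mul]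
    nlinarith [h.lower]
  have hF : F.Sweepable (insert (C, C') (insert (C', b) S)) L := by
    refine ⟨h.functional, h.finite, hd, hd1, ?_, ?_, ?_, hfree,
      hgen.free h.marks_tail (verts_mono (subset_insert _ _) hx),
      hgen.free h.marks_tail (verts_mono (subset_insert _ _) hPU)⟩
    · rintro f (rfl | rfl | hf) hfC z hz hzt
      · exact hlow z hzt (hnext z hz)
      · exact absurd (show C' = C from hfC).symm h.ne
      · exact absurd ((show f.1 = C from hfC) ▸ fst_mem_verts (hSU hf)) h.notMem
    · have hsub : ∀ y ∈ events (insert (x, P) (insert (C, C') (insert (C', b) S))) L,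
          y ∈ triangle x C P → y ≠ C → y ∈ events (insert (C', b) U) L := by
        rintro y ((hy | hy) | hy) hyt hyC
        · rw [verts_insert, verts_insert] at hy
          rcases hy with rfl | rfl | rfl | rfl | hy
          · exact hev hx
          · exact hev hPU
          · exact absurd rfl hyC
          · exact verts_subset_events _ _ (fst_mem_verts (mem_insert (y, b) U))
          · exact verts_subset_events _ _ (verts_mono (insert_subset_insert hSU) hy)
        · obtain ⟨e, he, f, hf, hef, hye, hyf⟩ := hy
          have mv : ∀ g ∈ insert (x, P) (insert (C, C') (insert (C', b) S)), y ∈ openSeg g →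
              g ∈ insert (C', b) U := by
            rintro g (rfl | rfl | rfl | hg) hyg
            · exact Or.inr hxP
            · exact absurd (hlow y hyt (hnext y (openSeg_subset _ hyg))) hyC
            · exact Or.inl rfl
            · exact Or.inr (hSU hg)
          exact crossPts_subset_events _ _ ⟨e, mv e he hye, f, mv f hf hyf, hef, hye, hyf⟩
        · exact Or.inr hy
      intro y hy z hz hyt hzt hyC hzC h0
      by_contra hyz
      exact hgen y (hsub y hy hyt hyC) z (hsub z hz hzt hzC) hyz h0
    · intro m hm
      change m.1 ∉ verts (insert (x, P) (insert (C, C') (insert (C', b) S)))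
      have hmC : m.1 ≠ C := fun h' => by
        refine hgen.notMem_events ((h.gen_tail hx hxb).mono (subset_insert _ _))
          (mem_insert (C', b) U) (h' ▸ Or.inr ⟨m, hm, rfl⟩)
      rw [verts_insert, verts_insert]
      rintro (h' | h' | h' | h' | h')
      · exact h.marks m hm (h' ▸ hx)
      · exact h.marks m hm (h' ▸ hPU)
      · exact hmC h'
      · exact h.marks_ne' m hm h'
      · exact h.marks_tail m hm (verts_mono (insert_subset_insert hSU) h')
  exact hF.VI

/-- The path through the two low points can be swept onto a given path, one vertex after the other.
-/
theorem VI_chain (h : LowPair U L b C C') (ps : List Plane) : ∀ {S : Set Edge} {x : Plane},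
    S ∪ chain x ps b ⊆ U → x ≠ b → ps.Nodup → x ∉ ps → b ∉ ps → (∀ P ∈ ps, P ∉ verts S) →
    (∀ e ∈ chain x ps b, Free L e) →
    Diag (insert (x, C) (insert (C, C') (insert (C', b) S))) →
    VI L (insert (x, C) (insert (C, C') (insert (C', b) S))) (S ∪ chain x ps b) := by
  induction ps with
  | nil =>
    intro S x hS hxb _ _ _ _ hfree hd
    rw [chain, union_singleton] at hS ⊢
    have hxU := hS (mem_insert (x, b) S)
    have hSU := (subset_insert _ _).trans hS
    have hx : x ∈ verts U := fst_mem_verts hxU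
    have hxS : (x, b) ∉ S := by
      intro h'
      have := hd.link.outInj (x, b) (Or.inr (Or.inr (Or.inr h'))) (x, C) (Or.inl rfl) rfl
      exact h.notMem ((show b = C from congrArg Prod.snd this) ▸ h.mem)
    refine (h.VI_edge hS hxS ⟨h.gen.mono hS, ?_⟩ (hfree _ rfl)).2.symm
    refine (hd.link.merge ?_ (fun h' => h.notMem (h' ▸ hx)) h.ne).merge
      (fun h' => h.notMem' (verts_mono hSU h')) (fun h' => h.notMem' (h' ▸ hx))
      (fun h' => h.notMem' (h' ▸ h.mem))
    rw [verts_insert]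
    rintro (h' | h' | h')
    · exact h.ne h'
    · exact h.notMem (h' ▸ h.mem)
    · exact h.notMem (verts_mono hSU h')
  | cons P ps ih =>
    intro S x hS hxb hnd hx hb hv hfree hd
    have hset : S ∪ chain x (P :: ps) b = insert (x, P) S ∪ chain P ps b := by
      rw [chain, union_insert, insert_union]
    rw [hset] at hS ⊢
    have hPb : P ≠ b := fun h' => hb (h' ▸ List.mem_cons_self)
    obtain ⟨h1, h2⟩ := h.VI_step (subset_union_left.trans hS) hxb hPb hd
      (hv P List.mem_cons_self) (hfree _ (Or.inl rfl))
    refine h2.trans (ih hS hPb (List.nodup_cons.1 hnd).2 (List.nodup_cons.1 hnd).1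
      (fun h' => hb (List.mem_cons_of_mem _ h')) ?_ (fun e he => hfree e (Or.inr he)) h1)
    intro Q hQ
    rw [verts_insert]
    rintro (h' | h' | h')
    · exact hx ((show Q = x from h') ▸ List.mem_cons_of_mem _ hQ)
    · exact (List.nodup_cons.1 hnd).1 ((show Q = P from h') ▸ hQ)
    · exact hv Q (List.mem_cons_of_mem _ hQ) h'

end LowPair

/-- The detour move: an edge with virtual crossings only can be replaced by any polygonal path with
the same end points and with virtual crossings only. -/
theorem VI.chain {S : Set Edge} {L : Markers} {a b : Plane} {ps : List Plane} (hL : Functional L)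
    (hfin : L.Finite) (hg : GenPos (insert (a, b) S ∪ chain a ps b)) (hd : Diag (insert (a, b) S))
    (hab : (a, b) ∉ S) (hm : ∀ m ∈ L, m.1 ∉ verts (insert (a, b) S ∪ chain a ps b))
    (hnd : ps.Nodup) (hv : ∀ P ∈ ps, P ∉ verts (insert (a, b) S)) (hfree : Free L (a, b))
    (hfree' : ∀ e ∈ chain a ps b, Free L e) :
    Diag (S ∪ chain a ps b) ∧ VI L (insert (a, b) S) (S ∪ chain a ps b) := by
  have hsub : S ∪ VirtualLink.chain a ps b ⊆ insert (a, b) S ∪ VirtualLink.chain a ps b :=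
    union_subset_union_left _ (subset_insert _ _)
  refine ⟨⟨hg.mono hsub, hd.link.chain ps hab hnd hv⟩, ?_⟩
  have hbU : b ∈ verts (insert (a, b) S ∪ VirtualLink.chain a ps b) :=
    verts_mono subset_union_left (snd_mem_verts (mem_insert (a, b) S))
  obtain ⟨C, C', h⟩ := exists_lowPair hL hfin hg hbU hm
  have h1 := h.VI_edge subset_union_left hab hd hfree
  refine h1.2.trans (h.VI_chain ps hsub (hd.gen.ne _ (Or.inl rfl)) hnd ?_ ?_ ?_ hfree' h1.1)
  · exact fun h' => hv a h' (fst_mem_verts (mem_insert (a, b) S))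
  · exact fun h' => hv b h' (snd_mem_verts (mem_insert (a, b) S))
  · exact fun P hP h' => hv P hP (verts_mono (subset_insert _ _) h')

/-! ### Moving a marked crossing along the other branch -/

theorem GenPos.isOver_iff {S : Set Edge} (hS : GenPos S) {L : Markers} (hL : Functional L)
    {e f : Edge} (he : e ∈ S) (hf : f ∈ S) (hef : e ≠ f) {m : Plane × Plane} (hm : m ∈ L)
    (h1 : m.1 ∈ openSeg e) (h2 : m.1 ∈ openSeg f) :
    (draw S L).isOver e f ↔ det (e.2 - e.1) m.2 = 0 ∧ det (f.2 - f.1) m.2 ≠ 0 := by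
  constructor
  · rintro ⟨-, -, m', hm', h1', h2', h3⟩
    have : m = m' := hL m hm m' hm' (hS.eq_of_mem_openSeg he hf hef h1 h2
      (openSeg_subset _ h1') (openSeg_subset _ h2'))
    rwa [this]
  · exact fun h3 => ⟨he, hf, m, hm, h1, h2, h3⟩

theorem mem_seg_of_det {a b c z : Plane} (h : det (b - a) (c - a) ≠ 0) (h1 : z ∈ seg (a, c))
    (h2 : z ∈ seg (c, b)) : z = c := by
  refine eq_of_mem_seg_of_det_ne (e := (a, c)) (f := (c, b)) ?_ h1 h2 (snd_mem_seg (a, c))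
    (fst_mem_seg (c, b))
  simp [det] at h ⊢
  intro h'; apply h; linarith

/-- The hypotheses of a planar isotopy from `a → b` to `a → c → b` across a triangle that contains
only a piece of the edge `f`. The crossing with `f` moves from `x` to the point `x'` of the new
edge `n`, and `f` misses the other new edge `o`. -/
structure Swing (S : Set Edge) (L : Markers) (a b c : Plane) (f n o : Edge) (x x' u : Plane) :
    Prop where
  functional : Functional L
  diag : Diag (insert (a, b) S)
  notMem : (a, b) ∉ S
  nondeg : det (b - a) (c - a) ≠ 0
  mem : f ∈ S
  fst_notMem : f.1 ∉ triangle a b c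
  snd_notMem : f.2 ∉ triangle a b c
  avoids : ∀ g ∈ S, g ≠ f → Avoids a b c g
  new : (n = (a, c) ∧ o = (c, b)) ∨ (n = (c, b) ∧ o = (a, c))
  disjoint : ∀ z ∈ seg f, z ∉ seg o
  mem_openSeg : x ∈ openSeg f
  mem_openSeg_old : x ∈ openSeg (a, b)
  mem_openSeg' : x' ∈ openSeg f
  mem_openSeg_new : x' ∈ openSeg n
  marker : (x, u) ∈ L
  marks : ∀ m ∈ L, m.1 ≠ x → m.1 ∉ triangle a b c

namespace Swing

variable {S : Set Edge} {L : Markers} {a b c : Plane} {f n o : Edge} {x x' u : Plane}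
  (h : Swing S L a b c f n o x x' u)
include h

theorem ne : c ≠ a ∧ c ≠ b ∧ a ≠ b :=
  ⟨fun h' => h.nondeg (by simp [h']), fun h' => h.nondeg (by simp [h']),
    fun h' => h.nondeg (by simp [h'])⟩

omit h in
theorem a_mem : a ∈ verts (insert (a, b) S) := fst_mem_verts (mem_insert (a, b) S)

omit h in
theorem b_mem : b ∈ verts (insert (a, b) S) := snd_mem_verts (mem_insert (a, b) S)

theorem new_eq {g : Edge} (hg : g = (a, c) ∨ g = (c, b)) : g = n ∨ g = o := by
  rcases h.new with ⟨rfl, rfl⟩ | ⟨rfl, rfl⟩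
  · exact hg
  · exact hg.symm

omit h in
theorem seg_subset {g : Edge} (hg : g = (a, b) ∨ g = (a, c) ∨ g = (c, b)) :
    seg g ⊆ triangle a b c := by
  rcases hg with rfl | rfl | rfl
  · exact seg_subset_triangle (fst_mem_triangle _ _ _) (snd_mem_triangle _ _ _)
  · exact seg_subset_triangle (fst_mem_triangle _ _ _) (trd_mem_triangle _ _ _)
  · exact seg_subset_triangle (trd_mem_triangle _ _ _) (snd_mem_triangle _ _ _)

theorem n_eq : n = (a, b) ∨ n = (a, c) ∨ n = (c, b) := by
  rcases h.new with ⟨rfl, rfl⟩ | ⟨rfl, rfl⟩ <;> simp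

theorem x_mem_triangle : x ∈ triangle a b c :=
  seg_subset (Or.inl rfl) (openSeg_subset _ h.mem_openSeg_old)

theorem x'_mem_triangle : x' ∈ triangle a b c :=
  seg_subset h.n_eq (openSeg_subset _ h.mem_openSeg_new)

theorem c_mem_o : c ∈ seg o := by
  rcases h.new with ⟨-, rfl⟩ | ⟨-, rfl⟩
  · exact fst_mem_seg (c, b)
  · exact snd_mem_seg (a, c)

theorem c_notMem {g : Edge} (hg : g ∈ S) : c ∉ seg g := by
  intro hc
  by_cases hgf : g = f
  · exact h.disjoint c (hgf ▸ hc) h.c_mem_o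
  · rcases h.avoids g hg hgf c hc (trd_mem_triangle _ _ _) with h' | h'
    · exact h.ne.1 h'
    · exact h.ne.2.1 h'

theorem c_notMem_verts : c ∉ verts S := by
  rintro ⟨g, hg, rfl | rfl⟩
  · exact h.c_notMem hg (fst_mem_seg g)
  · exact h.c_notMem hg (snd_mem_seg g)

theorem vert {v : Plane} (hv : v ∈ verts S) (hvt : v ∈ triangle a b c) : v = a ∨ v = b := by
  obtain ⟨g, hg, hvg⟩ := hv
  by_cases hgf : g = f
  · subst hgf
    rcases hvg with rfl | rfl
    · exact absurd hvt h.fst_notMem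
    · exact absurd hvt h.snd_notMem
  · refine h.avoids g hg hgf v ?_ hvt
    rcases hvg with rfl | rfl
    · exact fst_mem_seg g
    · exact snd_mem_seg g

/-- No two other edges cross inside the triangle. -/
theorem no_crossing {e g : Edge} (he : e ∈ S) (hg : g ∈ S) (heg : e ≠ g) {z : Plane}
    (hze : z ∈ openSeg e) (hzg : z ∈ openSeg g) : z ∉ triangle a b c := by
  intro hz
  have key : ∀ k ∈ S, k ≠ f → z ∈ openSeg k → False := by
    intro k hk hkf hzk
    rcases h.avoids k hk hkf z (openSeg_subset _ hzk) hz with rfl | rfl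
    · exact h.diag.gen.notMem_openSeg a_mem (Or.inr hk) hzk
    · exact h.diag.gen.notMem_openSeg b_mem (Or.inr hk) hzk
  by_cases hef : e = f
  · exact key g hg (fun h' => heg (hef.trans h'.symm)) hzg
  · exact key e he hef hze

theorem diag_new : Diag (insert (a, c) (insert (c, b) S)) := by
  obtain ⟨hca, hcb, hab⟩ := h.ne
  have hcV := h.c_notMem_verts
  have hS : GenPos S := h.diag.gen.mono (subset_insert _ _)
  refine ⟨?_, h.diag.link.split h.notMem ?_⟩
  · have hbc : b ∉ seg (a, c) := fun h' => hcb
      (mem_seg_of_det h.nondeg h' (snd_mem_seg (c, b))).symm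
    have hac : a ∉ seg (c, b) := fun h' => hca
      (mem_seg_of_det h.nondeg (fst_mem_seg (a, c)) h').symm
    have h1 : GenPos (insert (c, b) S) := by
      refine hS.insert_edge hcb (fun h' => hcV (snd_mem_verts h')) ?_ ?_ ?_ ?_
      · intro v hv hvs
        rcases h.vert hv (seg_subset (Or.inr (Or.inr rfl)) hvs) with rfl | rfl
        · exact absurd hvs hac
        · exact Or.inr rfl
      · exact fun g hg h' => absurd h' (h.c_notMem hg)
      · exact fun g hg h' => h.diag.gen.eq_of_mem b_mem (Or.inr hg) h'
      · rintro z ⟨e, he, g, hg, heg, hze, hzg⟩ hz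
        exact h.no_crossing he hg heg hze hzg
          (seg_subset (Or.inr (Or.inr rfl)) (openSeg_subset _ hz))
    refine h1.insert_edge hca.symm ?_ ?_ ?_ ?_ ?_
    · rintro (h' | h')
      · exact hab (congrArg Prod.snd h')
      · exact hcV (fst_mem_verts h')
    · intro v hv hvs
      rw [verts_insert] at hv
      rcases hv with rfl | rfl | hv
      · exact Or.inr rfl
      · exact absurd hvs hbc
      · rcases h.vert hv (seg_subset (Or.inr (Or.inl rfl)) hvs) with rfl | rfl
        · exact Or.inl rfl
        · exact absurd hvs hbc
    · rintro g (rfl | hg) h'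
      · exact absurd h' hac
      · exact h.diag.gen.eq_of_mem a_mem (Or.inr hg) h'
    · exact fun g hg h' => h1.eq_of_mem (fst_mem_verts (mem_insert (c, b) S)) hg h'
    · have key : ∀ z ∈ openSeg (c, b), z ∉ openSeg (a, c) := by
        intro z hz hz'
        have := mem_seg_of_det h.nondeg (openSeg_subset _ hz') (openSeg_subset _ hz)
        exact fst_notMem_openSeg (e := (c, b)) hcb (this ▸ hz)
      rintro z ⟨e, rfl | he, g, rfl | hg, heg, hze, hzg⟩ hz
      · exact heg rfl
      · exact key z hze hz
      · exact key z hzg hz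
      · exact h.no_crossing he hg heg hze hzg
          (seg_subset (Or.inr (Or.inl rfl)) (openSeg_subset _ hz))
  · rw [verts_insert]
    rintro (h' | h' | h')
    · exact hca h'
    · exact hcb h'
    · exact hcV h'

theorem functional_new (u' : Plane) : Functional (insert (x', u') (L \ {(x, u)})) := by
  have key : ∀ m ∈ L \ {(x, u)}, m.1 ≠ x' := by
    rintro m ⟨hm, hmx⟩ hmx'
    refine h.marks m hm ?_ (hmx' ▸ h.x'_mem_triangle)
    exact fun h' => hmx (h.functional m hm (x, u) h.marker h')
  rintro m (rfl | hm) m' (rfl | hm') hmm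
  · rfl
  · exact absurd hmm.symm (key m' hm')
  · exact absurd hmm (key m hm)
  · exact h.functional m hm.1 m' hm'.1 hmm

/-- The planar isotopy moves the crossing from `x` to `x'`. The direction `u'` of the new marker has
to designate the same over branch as `u`. -/
theorem isotopic {u' : Plane} (hf : det (f.2 - f.1) u' = 0 ↔ det (f.2 - f.1) u = 0)
    (hn : det (n.2 - n.1) u' = 0 ↔ det (b - a) u = 0) :
    VirtuallyIsotopic (draw (insert (a, b) S) L)
      (draw (insert (a, c) (insert (c, b) S)) (insert (x', u') (L \ {(x, u)}))) := by
  have hL' := h.functional_new u'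
  have hd' := h.diag_new
  have hnS : n ∈ insert (a, c) (insert (c, b) S) := by
    rcases h.new with ⟨rfl, -⟩ | ⟨rfl, -⟩
    · exact Or.inl rfl
    · exact Or.inr (Or.inl rfl)
  have hfS : f ∈ insert (a, c) (insert (c, b) S) := Or.inr (Or.inr h.mem)
  have hfab : f ≠ (a, b) := fun h' => h.notMem (h' ▸ h.mem)
  have hfn : f ≠ n := by
    rintro rfl
    rcases h.new with ⟨h', -⟩ | ⟨h', -⟩
    · exact h.fst_notMem (by rw [h']; exact fst_mem_triangle _ _ _)
    · exact h.fst_notMem (by rw [h']; exact trd_mem_triangle _ _ _)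
  have hcross : ∀ e ∈ S, ∀ g ∈ S, ∀ z, e ≠ g → z ∈ openSeg e → z ∈ openSeg g → z ≠ x ∧ z ≠ x' := by
    intro e he g hg z heg hze hzg
    have := h.no_crossing he hg heg hze hzg
    exact ⟨fun h' => this (h' ▸ h.x_mem_triangle), fun h' => this (h' ▸ h.x'_mem_triangle)⟩
  refine Relation.EqvGen.rel _ _ (Or.inl ⟨a, b, c, ⟨h.diag.isLinkDiagram h.functional,
    hd'.isLinkDiagram hL', Or.inl rfl, ?_, ?_⟩, ?_⟩) <;> rw [draw_rest h.notMem]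
  · ext e
    simp only [draw, mem_insert_iff, mem_union, mem_singleton_iff]
    tauto
  · intro e he g hg
    simp only [draw, mem_insert_iff, he, hg, or_true, true_and]
    have hne : ∀ w : Plane, det (e.2 - e.1) w = 0 → det (g.2 - g.1) w ≠ 0 → e ≠ g := by
      rintro w h1 h2 rfl
      exact h2 h1
    constructor
    · rintro ⟨m, rfl | ⟨hm, -⟩, h1, h2, h3, h4⟩
      · exact absurd rfl (hcross e he g hg x' (hne _ h3 h4) h1 h2).2
      · exact ⟨m, hm, h1, h2, h3, h4⟩
    · rintro ⟨m, hm, h1, h2, h3, h4⟩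
      refine ⟨m, Or.inr ⟨hm, ?_⟩, h1, h2, h3, h4⟩
      rintro rfl
      exact (hcross e he g hg x (hne _ h3 h4) h1 h2).1 rfl
  · refine ⟨fun g hg => ?_, fun e he g hg heg => ?_⟩
    · by_cases hgf : g = f
      · subst hgf
        right
        have hgn : Crosses g n := ⟨x', h.mem_openSeg', h.mem_openSeg_new⟩
        have hgo : ¬ Crosses g o := fun ⟨z, hz, hz'⟩ =>
          h.disjoint z (openSeg_subset _ hz) (openSeg_subset _ hz')
        refine ⟨⟨x, h.mem_openSeg, h.mem_openSeg_old⟩, ?_, ?_⟩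
        · rcases h.new with ⟨rfl, rfl⟩ | ⟨rfl, rfl⟩
          · exact Or.inl ⟨hgn, hgo⟩
          · exact Or.inr ⟨hgn, hgo⟩
        · intro k hk hgk
          rcases h.new_eq hk with rfl | rfl
          · rw [hd'.gen.isOver_iff hL' hnS hfS hfn.symm (mem_insert (x', u') _) h.mem_openSeg_new
              h.mem_openSeg', hd'.gen.isOver_iff hL' hfS hnS hfn (mem_insert (x', u') _)
              h.mem_openSeg' h.mem_openSeg_new, h.diag.gen.isOver_iff h.functional (Or.inl rfl)
              (Or.inr hg) hfab.symm h.marker h.mem_openSeg_old h.mem_openSeg,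
              h.diag.gen.isOver_iff h.functional (Or.inr hg) (Or.inl rfl) hfab h.marker
              h.mem_openSeg h.mem_openSeg_old]
            simp only [ne_eq, hf, hn, and_self]
          · exact absurd hgk hgo
      · exact Or.inl (h.avoids g hg hgf)
    · rintro ⟨z, ⟨h1, h2⟩, h3⟩
      exact h.no_crossing he hg heg h1 h2 h3

end Swing

/-! ### Turning one branch of a classical crossing -/

/-- The shear along `w` that takes `v` to `v + k • w`, where `v` and `w` are not parallel. -/
noncomputable def shear (v w : Plane) (k : ℝ) (u : Plane) : Plane :=
  u + (k * (det u w / det v w)) • w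

theorem det_shear (v w : Plane) (k : ℝ) (u : Plane) : det w (shear v w k u) = det w u := by
  simp [shear, det_add_right]

theorem det_shear' {v w : Plane} (h : det v w ≠ 0) (k : ℝ) (u : Plane) :
    det (v + k • w) (shear v w k u) = det v u := by
  simp only [shear, det_add_right, det_add_left, det_smul_left, det_smul_right, det_self]
  field_simp
  rw [det_comm w u]; ring

theorem coord_unique {v w : Plane} (h : det v w ≠ 0) {i j i' j' : ℝ}
    (hij : i • v + j • w = i' • v + j' • w) : i = i' ∧ j = j' := by
  have h1 := congrArg (fun z => det z w) hij
  have h2 := congrArg (fun z => det v z) hij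
  simp only [det_add_left, det_add_right, det_smul_left, det_smul_right, det_self, mul_zero,
    add_zero, zero_add] at h1 h2
  exact ⟨mul_right_cancel₀ h h1, mul_right_cancel₀ h h2⟩

/-- At a classical crossing of the edge `p → q` with an edge `f`, the branch of `p → q` can be
turned into a branch whose direction is changed by `k` times the direction of `f`. All other marked
points stay on edges of the same directions. -/
theorem exists_turned {S : Set Edge} {L : Markers} {p q x u : Plane} {f : Edge} (hL : Functional L)
    (hfin : L.Finite) (hd : Diag (insert (p, q) S)) (hpq : (p, q) ∉ S) (hf : f ∈ S)
    (hm : (x, u) ∈ L) (hx : x ∈ openSeg (p, q)) (hxf : x ∈ openSeg f) {k : ℝ} (hk : k ≠ 0) :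
    ∃ (T : Set Edge) (u' : Plane), Diag T ∧ Functional (insert (x, u') (L \ {(x, u)})) ∧
      VirtuallyIsotopic (draw (insert (p, q) S) L) (draw T (insert (x, u') (L \ {(x, u)}))) ∧
      (det (f.2 - f.1) u' = 0 ↔ det (f.2 - f.1) u = 0) ∧
      (det (q - p + k • (f.2 - f.1)) u' = 0 ↔ det (q - p) u = 0) ∧
      f ∈ T ∧
      (∃ n ∈ T, x ∈ openSeg n ∧ ∃ r : ℝ, 0 < r ∧ n.2 - n.1 = r • (q - p + k • (f.2 - f.1))) ∧
      (∀ m ∈ L, m.1 ≠ x → ∀ g ∈ insert (p, q) S, m.1 ∈ openSeg g →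
        ∃ g' ∈ T, m.1 ∈ openSeg g' ∧ ∃ r : ℝ, 0 < r ∧ g'.2 - g'.1 = r • (g.2 - g.1)) ∧
      (∀ m ∈ L, m.1 ≠ x → ∀ g' ∈ T, m.1 ∈ openSeg g' →
        ∃ g ∈ insert (p, q) S, m.1 ∈ openSeg g ∧
          ∃ r : ℝ, 0 < r ∧ g'.2 - g'.1 = r • (g.2 - g.1)) := by
  set v := q - p with hv
  set w := f.2 - f.1 with hw
  have hdet : det v w ≠ 0 := hd.gen.det_ne (Or.inl rfl : (p, q) ∈ insert (p, q) S) (Or.inr hf)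
    (fun h => hpq (h ▸ hf)) hx hxf
  have hS := hd.gen.mono (subset_insert (p, q) S)
  obtain ⟨s, hs0, hs1, hxs⟩ := mem_openSeg.1 hx
  obtain ⟨r₀, hr0, hr1, hxr⟩ := mem_openSeg.1 hxf
  dsimp only at hxs
  rw [← hv] at hxs
  rw [← hw] at hxr
  -- The edge is subdivided at `a` and `b` near the crossing, `a → b` is moved across the triangle
  -- `a b c`, and then `a → c` across `a c d`, which brings the crossing back to `x`, now on
  -- `d → c`. `K` is everything that must stay away from the crossing.
  let K : Set Plane := (⋃ g ∈ S \ {f}, seg g) ∪ {f.1, f.2} ∪ (Prod.fst '' L) \ {x}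
  have hKc : IsClosed K := by
    refine (IsClosed.union ?_ (toFinite _).isClosed).union
      ((hfin.image _).subset sdiff_subset).isClosed
    exact (hS.finite.subset sdiff_subset).isClosed_biUnion fun g _ => (isCompact_seg g).isClosed
  have hxK : x ∉ K := by
    rintro ((h | h | h) | h)
    · simp only [mem_iUnion] at h
      obtain ⟨g, ⟨hg, hgf⟩, hxg⟩ := h
      have hgf : g ≠ f := hgf
      have hxv : ∀ {y}, y ∈ verts S → x ≠ y := fun hy h' =>
        hS.notMem_openSeg hy hf (h' ▸ hxf)
      rcases mem_seg_iff.1 hxg with h | h | h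
      · exact hxv (fst_mem_verts hg) h
      · exact hxv (snd_mem_verts hg) h
      · have := hd.gen.no_triple (p, q) (Or.inl rfl) f (Or.inr hf) g (Or.inr hg)
          (fun h' => hpq (h' ▸ hf)) hgf.symm (fun h' => hpq (h' ▸ hg))
        rw [eq_empty_iff_forall_notMem] at this
        exact this x ⟨⟨hx, hxf⟩, h⟩
    · exact fst_notMem_openSeg (hS.ne f hf) (h ▸ hxf)
    · exact snd_notMem_openSeg (hS.ne f hf) ((show x = f.2 from h) ▸ hxf)
    · exact h.2 rfl
  obtain ⟨δ, hδ, hδ1, hδ2, hδ3, hδ4, hT1, hT2⟩ : ∃ δ : ℝ, 0 < δ ∧ δ < s ∧ δ < 1 - s ∧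
      0 < r₀ + δ * k / 2 ∧ r₀ + δ * k / 2 < 1 ∧
      (∀ z ∈ K, z ∉ triangle (x + δ • (-v)) (x + δ • v) (x + δ • (v + k • w))) ∧
      ∀ z ∈ K, z ∉ triangle (x + δ • (-v)) (x + δ • (v + k • w)) (x + δ • (-(v + k • w))) := by
    have e1 : ∀ᶠ δ in 𝓝[>] (0 : ℝ), 0 < δ := self_mem_nhdsWithin
    have e2 : ∀ᶠ δ in 𝓝[>] (0 : ℝ), δ < s := nhdsWithin_le_nhds (Iio_mem_nhds hs0)
    have e3 : ∀ᶠ δ in 𝓝[>] (0 : ℝ), δ < 1 - s := nhdsWithin_le_nhds (Iio_mem_nhds (by linarith))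
    have hc : ContinuousAt (fun δ : ℝ => r₀ + δ * k / 2) 0 := by fun_prop
    have e4 : ∀ᶠ δ in 𝓝[>] (0 : ℝ), r₀ + δ * k / 2 ∈ Ioo (0 : ℝ) 1 :=
      nhdsWithin_le_nhds (hc.eventually_mem (by simpa using Ioo_mem_nhds hr0 hr1))
    obtain ⟨δ, h1, h2, h3, h4, h5, h6⟩ := (e1.and (e2.and (e3.and (e4.and
      ((eventually_triangle_notMem hKc hxK (-v) v (v + k • w)).and
      (eventually_triangle_notMem hKc hxK (-v) (v + k • w) (-(v + k • w)))))))).exists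
    exact ⟨δ, h1, h2, h3, h4.1, h4.2, h5, h6⟩
  set a := x + δ • (-v) with ha
  set b := x + δ • v with hb
  set c := x + δ • (v + k • w) with hc
  set d := x + δ • (-(v + k • w)) with hd'
  have hδ0 : δ ≠ 0 := hδ.ne'
  -- coordinates with respect to `v` and `w`
  have hone : ∀ z ∈ triangle a b c, ∃ i j : ℝ, 0 ≤ i ∧ 0 ≤ j ∧ i + j ≤ 1 ∧
      z = x + ((δ * (2 * i + 2 * j - 1)) • v + (δ * (j * k)) • w) := by
    intro z hz
    obtain ⟨i, j, hi, hj, hij, rfl⟩ := mem_triangle.1 hz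
    exact ⟨i, j, hi, hj, hij, by rw [ha, hb, hc]; module⟩
  have htwo : ∀ z ∈ triangle a c d, ∃ i j : ℝ, 0 ≤ i ∧ 0 ≤ j ∧ i + j ≤ 1 ∧
      z = x + ((δ * (2 * i - 1)) • v + (δ * (i * k - j * k)) • w) := by
    intro z hz
    obtain ⟨i, j, hi, hj, hij, rfl⟩ := mem_triangle.1 hz
    exact ⟨i, j, hi, hj, hij, by rw [ha, hc, hd']; module⟩
  have hsegf : ∀ z ∈ seg f, ∃ j : ℝ, z = x + ((0 : ℝ) • v + j • w) := by
    intro z hz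
    obtain ⟨j, -, -, rfl⟩ := mem_seg.1 hz
    exact ⟨j - r₀, by rw [hxr, ← hw]; module⟩
  have hsegp : ∀ z ∈ seg (p, a), ∃ i : ℝ, i ≤ -δ ∧ z = x + (i • v + (0 : ℝ) • w) := by
    intro z hz
    obtain ⟨i, hi0, hi1, rfl⟩ := mem_seg.1 hz
    refine ⟨i * (s - δ) - s, by nlinarith, ?_⟩
    rw [ha, hxs]; dsimp only; module
  have hsegq : ∀ z ∈ seg (b, q), ∃ i : ℝ, δ ≤ i ∧ z = x + (i • v + (0 : ℝ) • w) := by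
    intro z hz
    obtain ⟨i, hi0, hi1, rfl⟩ := mem_seg.1 hz
    refine ⟨δ + i * (1 - s - δ), by nlinarith, ?_⟩
    have : q = p + v := by rw [hv]; module
    rw [hb, this, hxs]; dsimp only; module
  have hsegcb : ∀ z ∈ seg (c, b), ∃ j : ℝ, z = x + (δ • v + (δ * (j * k)) • w) := by
    intro z hz
    obtain ⟨i, hi0, hi1, rfl⟩ := mem_seg.1 hz
    exact ⟨1 - i, by rw [hb, hc]; dsimp only; module⟩
  have hsegad : ∀ z ∈ seg (a, d), ∃ j : ℝ, z = x + ((-δ) • v + j • w) := by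
    intro z hz
    obtain ⟨i, hi0, hi1, rfl⟩ := mem_seg.1 hz
    exact ⟨-(i * δ * k), by rw [ha, hd']; dsimp only; module⟩
  have uniq : ∀ {z : Plane} {i j i' j' : ℝ}, z = x + (i • v + j • w) → z = x + (i' • v + j' • w) →
      i = i' ∧ j = j' := fun h1 h2 => coord_unique hdet (add_left_cancel (h1.symm.trans h2))
  have hao : a ∈ openSeg (p, q) := mem_openSeg.2 ⟨s - δ, by linarith, by linarith, by
    rw [ha, hxs]; dsimp only; rw [← hv]; module⟩
  have hbo : b ∈ openSeg (a, q) := mem_openSeg.2 ⟨2 * δ / (1 - s + δ), by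
    have : 0 < 1 - s + δ := by linarith
    positivity, by rw [div_lt_one (by linarith)]; linarith, by
    have e1 : q - a = (1 - s + δ) • v := by
      have : q = p + v := by rw [hv]; module
      rw [ha, this, hxs]; module
    dsimp only
    rw [e1, smul_smul, div_mul_cancel₀ _ (by linarith), ha, hb]; module⟩
  have hane : a ≠ b := by
    intro h
    have := (uniq (z := a) (i := -δ) (j := 0) (i' := δ) (j' := 0) (by rw [ha]; module)
      (by rw [h, hb]; module)).1
    linarith
  have hgS : ∀ g ∈ S, g ≠ f → ∀ z ∈ seg g, z ∈ K := by
    intro g hg hgf z hz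
    refine Or.inl (Or.inl ?_)
    simp only [mem_iUnion]
    exact ⟨g, ⟨hg, hgf⟩, hz⟩
  have haS : ∀ g ∈ S, a ∉ seg g := by
    intro g hg hag
    by_cases hgf : g = f
    · obtain ⟨j, hj⟩ := hsegf a (hgf ▸ hag)
      have := (uniq (i := -δ) (j := 0) (show a = _ by rw [ha]; module) hj).1
      linarith
    · exact hT1 a (hgS g hg hgf a hag) (fst_mem_triangle _ _ _)
  have hbS : ∀ g ∈ S, b ∉ seg g := by
    intro g hg hag
    by_cases hgf : g = f
    · obtain ⟨j, hj⟩ := hsegf b (hgf ▸ hag)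
      have := (uniq (i := δ) (j := 0) (show b = _ by rw [hb]; module) hj).1
      linarith
    · exact hT1 b (hgS g hg hgf b hag) (snd_mem_triangle _ _ _)
  -- cutting out the piece from `a` to `b`
  have d1 := hd.subdivide hao hpq haS
  have i1 : VI L _ _ := VI.subdivide hao hL hd hpq haS
  rw [insert_comm] at d1 i1
  have haq : (a, q) ∉ insert (p, a) S := by
    rintro (h | h)
    · exact hd.gen.ne (p, q) (Or.inl rfl) (congrArg Prod.snd h ▸ (congrArg Prod.fst h).symm)
    · exact haS _ h (fst_mem_seg (a, q))
  have hbS' : ∀ g ∈ insert (p, a) S, b ∉ seg g := by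
    rintro g (rfl | hg)
    · intro h
      obtain ⟨i, hi, hi'⟩ := hsegp b h
      have := (uniq (i := δ) (j := 0) (show b = _ by rw [hb]; module) hi').1
      linarith
    · exact hbS g hg
  have d2 := d1.subdivide hbo haq hbS'
  have i2 : VI L _ _ := VI.subdivide hbo hL d1 haq hbS'
  have hab : (a, b) ∉ insert (b, q) (insert (p, a) S) := by
    rintro (h | h | h)
    · exact hane (congrArg Prod.fst h)
    · exact hane (congrArg Prod.snd h).symm
    · exact haS _ h (fst_mem_seg (a, b))
  have hf1K : f.1 ∈ K := Or.inl (Or.inr (Or.inl rfl))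
  have hf2K : f.2 ∈ K := Or.inl (Or.inr (Or.inr rfl))
  have hmK : ∀ m ∈ L, m.1 ≠ x → m.1 ∈ K := fun m hm hmx => Or.inr ⟨⟨m, hm, rfl⟩, hmx⟩
  -- the first planar isotopy
  set x' := x + (δ * k / 2) • w with hx'
  set u₁ := shear v w (k / 2) u with hu₁
  have sw1 : Swing (insert (b, q) (insert (p, a) S)) L a b c f (a, c) (c, b) x x' u := by
    refine ⟨hL, d2, hab, ?_, Or.inr (Or.inr hf), hT1 _ hf1K, hT1 _ hf2K, ?_, Or.inl ⟨rfl, rfl⟩, ?_,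
      hxf, ?_, ?_, ?_, hm, fun m hm hmx => hT1 _ (hmK m hm hmx)⟩
    · have e1 : b - a = (2 * δ) • v := by rw [ha, hb]; module
      have e2 : c - a = (2 * δ) • v + (δ * k) • w := by rw [ha, hc]; module
      rw [e1, e2, det_smul_left, det_add_right, det_smul_right, det_smul_right, det_self]
      simp [hδ0, hk, hdet]
    · rintro g (rfl | rfl | hg) hgf z hz hzt
      · obtain ⟨i, hi, e1⟩ := hsegq z hz
        obtain ⟨i', j', h1, h2, h3, e2⟩ := hone z hzt
        obtain ⟨h4, h5⟩ := uniq e1 e2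
        have h6 : j' = 0 := by simpa [hδ0, hk] using h5
        right
        have h7 : i = δ := by nlinarith
        rw [e1, h7, hb]; module
      · obtain ⟨i, hi, e1⟩ := hsegp z hz
        obtain ⟨i', j', h1, h2, h3, e2⟩ := hone z hzt
        obtain ⟨h4, h5⟩ := uniq e1 e2
        left
        have h7 : i = -δ := by nlinarith
        rw [e1, h7, ha]; module
      · exact absurd hzt (hT1 z (hgS g hg hgf z hz))
    · intro z hz hz'
      obtain ⟨j, e1⟩ := hsegf z hz
      obtain ⟨j', e2⟩ := hsegcb z hz'
      exact hδ0 (uniq e1 e2).1.symm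
    · exact mem_openSeg.2 ⟨1 / 2, by norm_num, by norm_num, by rw [ha, hb]; dsimp only; module⟩
    · exact mem_openSeg.2 ⟨r₀ + δ * k / 2, hδ3, hδ4, by rw [hx', ← hw, hxr]; module⟩
    · exact mem_openSeg.2 ⟨1 / 2, by norm_num, by norm_num, by
        rw [hx', ha, hc]; dsimp only; module⟩
  have hac : c - a = (2 * δ) • (v + (k / 2) • w) := by rw [ha, hc]; module
  have hba : b - a = (2 * δ) • v := by rw [ha, hb]; module
  have h2δ : 2 * δ ≠ 0 := by positivity
  have j1 := sw1.isotopic (u' := u₁) (by rw [hu₁, ← hw, det_shear]) (by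
    dsimp only
    rw [hac, hba, det_smul_left, det_smul_left, hu₁, det_shear' hdet])
  have d3 := sw1.diag_new
  have f1 := sw1.functional_new u₁
  -- the second planar isotopy
  set u₂ := shear v w k u with hu₂
  have hac' : (a, c) ∉ insert (c, b) (insert (b, q) (insert (p, a) S)) := by
    have hca := sw1.ne.1
    rintro (h | h | h | h)
    · exact hca (congrArg Prod.fst h).symm
    · exact hane (congrArg Prod.fst h)
    · exact hca (congrArg Prod.snd h)
    · exact haS _ h (fst_mem_seg (a, c))
  have sw2 : Swing (insert (c, b) (insert (b, q) (insert (p, a) S)))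
      (insert (x', u₁) (L \ {(x, u)})) a c d f (d, c) (a, d) x' x u₁ := by
    refine ⟨f1, d3, hac', ?_, Or.inr (Or.inr (Or.inr hf)), hT2 _ hf1K, hT2 _ hf2K, ?_,
      Or.inr ⟨rfl, rfl⟩, ?_, sw1.mem_openSeg', sw1.mem_openSeg_new, hxf, ?_, Or.inl rfl, ?_⟩
    · have e2 : d - a = (-(δ * k)) • w := by rw [ha, hd']; module
      rw [hac, e2, det_smul_left, det_smul_right, det_add_left, det_smul_left, det_self]
      simp [hδ0, hk, hdet]
    · rintro g (rfl | rfl | rfl | hg) hgf z hz hzt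
      · obtain ⟨j, e1⟩ := hsegcb z hz
        obtain ⟨i', j', h1, h2, h3, e2⟩ := htwo z hzt
        obtain ⟨h4, h5⟩ := uniq e1 e2
        right
        have h6 : i' = 1 := by
          have : δ * (2 - 2 * i') = 0 := by linarith
          rcases mul_eq_zero.1 this with h | h
          · exact absurd h hδ0
          · linarith
        have h7 : j' = 0 := by linarith
        rw [e2, h6, h7, hc]; module
      · obtain ⟨i, hi, e1⟩ := hsegq z hz
        obtain ⟨i', j', h1, h2, h3, e2⟩ := htwo z hzt
        obtain ⟨h4, h5⟩ := uniq e1 e2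
        exfalso
        have h6 : i' = 1 := by nlinarith
        have h7 : j' = 0 := by linarith
        rw [h6, h7] at h5
        have : δ * k = 0 := by linarith
        rcases mul_eq_zero.1 this with h | h
        · exact hδ0 h
        · exact hk h
      · obtain ⟨i, hi, e1⟩ := hsegp z hz
        obtain ⟨i', j', h1, h2, h3, e2⟩ := htwo z hzt
        obtain ⟨h4, h5⟩ := uniq e1 e2
        left
        have h6 : i' = 0 := by nlinarith
        rw [e1, ha]
        have h7 : i = -δ := by rw [h4, h6]; ring
        rw [h7]; module
      · exact absurd hzt (hT2 z (hgS g hg hgf z hz))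
    · intro z hz hz'
      obtain ⟨j, e1⟩ := hsegf z hz
      obtain ⟨j', e2⟩ := hsegad z hz'
      have := (uniq e1 e2).1
      linarith
    · exact mem_openSeg.2 ⟨1 / 2, by norm_num, by norm_num, by rw [hd', hc]; dsimp only; module⟩
    · rintro m (rfl | ⟨hmL, hmx⟩) hmx'
      · exact absurd rfl hmx'
      · exact hT2 _ (hmK m hmL fun h => hmx (hL m hmL (x, u) hm h))
  have hcd : c - d = (2 * δ) • (v + k • w) := by rw [hc, hd']; module
  have j2 := sw2.isotopic (u' := u₂) (by rw [hu₁, hu₂, ← hw, det_shear, det_shear]) (by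
    dsimp only
    rw [hac, hcd, det_smul_left, det_smul_left, hu₁, hu₂, det_shear' hdet, det_shear' hdet])
  have f2 := sw2.functional_new u₂
  have hLL : insert (x', u₁) (L \ {(x, u)}) \ {(x', u₁)} = L \ {(x, u)} := by
    refine insert_sdiff_self_of_notMem fun h => ?_
    have hxx' : x' ≠ x := by
      intro h'
      have := (uniq (z := x) (i := 0) (j := 0) (i' := 0) (j' := δ * k / 2) (by module)
        (by rw [zero_smul, zero_add]; exact h'.symm.trans hx')).2
      have h3 : δ * k = 0 := by linarith
      rcases mul_eq_zero.1 h3 with h | h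
      · exact hδ0 h
      · exact hk h
    exact sw1.marks _ h.1 hxx' sw1.x'_mem_triangle
  rw [hLL] at j2 f2
  refine ⟨_, u₂, sw2.diag_new, f2, ?_, by rw [hu₂, det_shear], by rw [hu₂, det_shear' hdet],
    Or.inr (Or.inr (Or.inr (Or.inr (Or.inr hf)))), ?_, ?_, ?_⟩
  · exact Relation.EqvGen.trans _ _ _ (i1.trans i2) (Relation.EqvGen.trans _ _ _ j1 j2)
  · exact ⟨(d, c), Or.inr (Or.inl rfl), sw2.mem_openSeg_new, 2 * δ, by positivity, hcd⟩
  · rintro m hmL hmx g (rfl | hg) hmg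
    · have hmT := sw1.marks m hmL hmx
      rcases mem_openSeg_cases hao hmg with h | h | h
      · refine ⟨(p, a), by simp, h, s - δ, by linarith, ?_⟩
        rw [ha, hxs]; dsimp only; rw [← hv]; module
      · exact absurd (h ▸ fst_mem_triangle a b c) hmT
      · rcases mem_openSeg_cases hbo h with h | h | h
        · exact absurd (Swing.seg_subset (Or.inl rfl) (openSeg_subset _ h)) hmT
        · exact absurd (h ▸ snd_mem_triangle a b c) hmT
        · refine ⟨(b, q), by simp, h, 1 - s - δ, by linarith, ?_⟩
          have : q = p + v := by rw [hv]; module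
          dsimp only
          rw [← hv, hb, hxs, this]; module
    · exact ⟨g, by simp [hg], hmg, 1, one_pos, by rw [one_smul]⟩
  · intro m hmL hmx g' hg' hmg
    have hmT := sw1.marks m hmL hmx
    have hmT2 := hT2 _ (hmK m hmL hmx)
    rcases hg' with rfl | rfl | rfl | rfl | rfl | hg
    · exact absurd (Swing.seg_subset (Or.inr (Or.inl rfl)) (openSeg_subset _ hmg)) hmT2
    · exact absurd (Swing.seg_subset (Or.inr (Or.inr rfl)) (openSeg_subset _ hmg)) hmT2
    · exact absurd (Swing.seg_subset (Or.inr (Or.inr rfl)) (openSeg_subset _ hmg)) hmT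
    · refine ⟨(p, q), Or.inl rfl, openSeg_right_subset hao (openSeg_right_subset hbo hmg),
        1 - s - δ, by linarith, ?_⟩
      have : q = p + v := by rw [hv]; module
      dsimp only
      rw [← hv, hb, hxs, this]; module
    · refine ⟨(p, q), Or.inl rfl, openSeg_left_subset hao hmg, s - δ, by linarith, ?_⟩
      rw [ha, hxs]; dsimp only; rw [← hv]; module
    · exact ⟨g', Or.inr hg, hmg, 1, one_pos, by rw [one_smul]⟩

/-! ### Making all classical crossings descend -/

/-- The branches at marked points that do not descend, given by the point and by the information
whether the branch is the over branch. -/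
def nonDescending (S : Set Edge) (L : Markers) : Set (Plane × Bool) :=
  {z | ∃ m ∈ L, m.1 = z.1 ∧ ∃ e ∈ S, m.1 ∈ openSeg e ∧ e.1.2 ≤ e.2.2 ∧
    (z.2 = true ↔ det (e.2 - e.1) m.2 = 0)}

theorem finite_nonDescending (S : Set Edge) {L : Markers} (hL : L.Finite) :
    (nonDescending S L).Finite := by
  refine ((hL.image Prod.fst).prod (finite_univ (α := Bool))).subset ?_
  rintro z ⟨m, hm, hmz, -⟩
  exact ⟨⟨m, hm, hmz⟩, mem_univ _⟩

theorem Realized.exists_other {S : Set Edge} {L : Markers} (hS : GenPos S) (hR : Realized S L)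
    {m : Plane × Plane} (hm : m ∈ L) {e : Edge} (he : e ∈ S) (hme : m.1 ∈ openSeg e) :
    ∃ f ∈ S, e ≠ f ∧ m.1 ∈ openSeg f ∧ (det (f.2 - f.1) m.2 = 0 ↔ ¬ det (e.2 - e.1) m.2 = 0) := by
  obtain ⟨g, hg, k, hk, hmg, hmk, h1, h2⟩ := hR m hm
  have hgk : g ≠ k := by
    rintro rfl
    exact h2 h1
  by_cases heg : e = g
  · subst heg
    exact ⟨k, hk, hgk, hmk, by simp [h1, h2]⟩
  · by_cases hek : e = k
    · subst hek
      exact ⟨g, hg, heg, hmg, by simp [h1, h2]⟩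
    · have := hS.no_triple e he g hg k hk heg hgk hek
      rw [eq_empty_iff_forall_notMem] at this
      exact absurd ⟨⟨hme, hmg⟩, hmk⟩ (this m.1)

/-- Every drawing can be changed so that all edges with classical crossings descend: the branches
that do not descend are turned around the other branches, one after the other. -/
theorem exists_descending (N : ℕ) : ∀ {S : Set Edge} {L : Markers}, (nonDescending S L).ncard = N →
    Diag S → Functional L → L.Finite → Realized S L →
    ∃ (T : Set Edge) (M : Markers), Diag T ∧ Functional M ∧ M.Finite ∧ Realized T M ∧
      VirtuallyIsotopic (draw S L) (draw T M) ∧ ∀ e ∈ T, ¬ Free M e → e.2.2 < e.1.2 := by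
  induction N using Nat.strong_induction_on with
  | _ N ih =>
  intro S L hN hd hL hfin hR
  by_cases hall : ∀ e ∈ S, ¬ Free L e → e.2.2 < e.1.2
  · exact ⟨S, L, hd, hL, hfin, hR, Relation.EqvGen.refl _, hall⟩
  -- a branch that does not descend, such that the other branch is not horizontal
  obtain ⟨m, hm, e, he, f, hf, hef, hme, hmf, hup, hf2, hpar⟩ : ∃ m ∈ L, ∃ e ∈ S, ∃ f ∈ S, e ≠ f ∧
      m.1 ∈ openSeg e ∧ m.1 ∈ openSeg f ∧ e.1.2 ≤ e.2.2 ∧ (f.2 - f.1).2 ≠ 0 ∧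
      (det (f.2 - f.1) m.2 = 0 ↔ ¬ det (e.2 - e.1) m.2 = 0) := by
    simp only [Free] at hall
    push Not at hall
    obtain ⟨e, he, ⟨m, hm, hme⟩, hup⟩ := hall
    obtain ⟨f, hf, hef, hmf, hpar⟩ := hR.exists_other hd.gen hm he hme
    by_cases hf2 : (f.2 - f.1).2 = 0
    · refine ⟨m, hm, f, hf, e, he, hef.symm, hmf, hme, ?_, ?_, by tauto⟩
      · simp only [Prod.snd_sub] at hf2
        linarith
      · intro he2
        apply hd.gen.det_ne he hf hef hme hmf
        rw [det, hf2, he2]; ring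
    · exact ⟨m, hm, e, he, f, hf, hef, hme, hmf, hup, hf2, hpar⟩
  obtain ⟨x, u⟩ := m
  obtain ⟨p, q⟩ := e
  have hSe : insert (p, q) (S \ {(p, q)}) = S := by
    rw [insert_sdiff_singleton, insert_eq_of_mem he]
  have hpq : (p, q) ∉ S \ {(p, q)} := fun h => h.2 rfl
  have hfS : f ∈ S \ {(p, q)} := ⟨hf, hef.symm⟩
  set v := q - p with hv
  set w := f.2 - f.1 with hw
  have hv2 : 0 ≤ v.2 := by
    rw [hv, Prod.snd_sub]; exact sub_nonneg.2 hup
  -- the factor is chosen such that the new direction `v + k • w` has the vertical component `-1`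
  obtain ⟨T, u', hdT, hL', hiso, hfu, hnu, hfT, ⟨n, hnT, hxn, r, hr, hnr⟩, hfor, hback⟩ :=
    exists_turned (k := -(v.2 + 1) / w.2) hL hfin (hSe.symm ▸ hd) hpq hfS hm hme hmf
      (div_ne_zero (by linarith) hf2)
  rw [hSe] at hiso hfor hback
  rw [← hv, ← hw] at hnr hnu
  rw [← hw] at hfu
  have hdown : n.2.2 < n.1.2 := by
    have := congrArg Prod.snd hnr
    simp only [Prod.snd_sub, Prod.smul_snd, Prod.snd_add, smul_eq_mul] at this
    rw [div_mul_cancel₀ _ hf2] at this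
    linarith
  have hdet : det v w ≠ 0 := hd.gen.det_ne he hf hef hme hmf
  have hnf : n ≠ f := by
    rintro rfl
    apply hdet
    rw [← hw] at hnr
    have h1 : det w w = r * det v w := by
      nth_rewrite 1 [hnr]
      rw [det_smul_left, det_add_left, det_smul_left, det_self]; ring
    rw [det_self] at h1
    exact (mul_eq_zero.1 h1.symm).resolve_left hr.ne'
  have hne : ∀ m ∈ L \ {(x, u)}, m.1 ≠ x := fun m hmL h => hmL.2 (hL m hmL.1 (x, u) hm h)
  have hdir : ∀ {g g' : Edge} {r : ℝ}, 0 < r → g'.2 - g'.1 = r • (g.2 - g.1) →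
      ∀ y, det (g'.2 - g'.1) y = 0 ↔ det (g.2 - g.1) y = 0 := by
    intro g g' r hr h y
    rw [h, det_smul_left, mul_eq_zero, or_iff_right hr.ne']
  have hbranch : det (n.2 - n.1) u' = 0 ↔ det v u = 0 := by
    rw [hnr, det_smul_left, mul_eq_zero, or_iff_right hr.ne', hnu]
  classical
  have hlt : nonDescending T (insert (x, u') (L \ {(x, u)})) ⊆
      nonDescending S L \ {(x, decide (det v u = 0))} := by
    rintro ⟨z, o⟩ ⟨m, rfl | hmL, rfl, g, hg, hmg, hgup, ho⟩
    · have hgf : g = f := by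
        by_contra hgf
        by_cases hgn : g = n
        · rw [hgn] at hgup
          linarith
        · have := hdT.gen.no_triple g hg n hnT f hfT hgn hnf hgf
          rw [eq_empty_iff_forall_notMem] at this
          exact this x ⟨⟨hmg, hxn⟩, hmf⟩
      subst hgf
      dsimp only at ho
      rw [← hw, hfu] at ho
      refine ⟨⟨(x, u), hm, rfl, g, hf, hmf, hgup, ho⟩, ?_⟩
      intro h
      have h1 : o = decide (det v u = 0) := congrArg Prod.snd h
      dsimp only at hpar
      rw [hpar, h1, decide_eq_true_eq] at ho
      tauto
    · obtain ⟨g', hg', hmg', r', hr', hgr'⟩ := hback m hmL.1 (hne m hmL) g hg hmg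
      refine ⟨⟨m, hmL.1, rfl, g', hg', hmg', ?_, ?_⟩, ?_⟩
      · have := congrArg Prod.snd hgr'
        simp only [Prod.snd_sub, Prod.smul_snd, smul_eq_mul] at this
        by_contra hlt
        push Not at hlt
        nlinarith
      · rw [ho, hdir hr' hgr']
      · exact fun h => hne m hmL (congrArg Prod.fst h)
  have hbad : (x, decide (det v u = 0)) ∈ nonDescending S L :=
    ⟨(x, u), hm, rfl, (p, q), he, hme, hup, by rw [decide_eq_true_eq]⟩
  have hcard : (nonDescending T (insert (x, u') (L \ {(x, u)}))).ncard < N := by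
    rw [← hN]
    refine ncard_lt_ncard (hlt.trans_ssubset ?_) (finite_nonDescending S hfin)
    exact sdiff_singleton_ssubset.2 hbad
  have hR' : Realized T (insert (x, u') (L \ {(x, u)})) := by
    rintro m (rfl | hmL)
    · dsimp only at hpar
      by_cases h0 : det v u = 0
      · refine ⟨n, hnT, f, hfT, hxn, hmf, hbranch.2 h0, ?_⟩
        dsimp only
        rw [← hw, ne_eq, hfu, hpar, not_not]
        exact h0
      · refine ⟨f, hfT, n, hnT, hmf, hxn, ?_, fun h => h0 (hbranch.1 h)⟩
        dsimp only
        rw [← hw, hfu, hpar]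
        exact h0
    · obtain ⟨g, hg, k, hk, hmg, hmk, h1, h2⟩ := hR m hmL.1
      obtain ⟨g', hg', hmg', r₁, hr₁, hgr⟩ := hfor m hmL.1 (hne m hmL) g hg hmg
      obtain ⟨k', hk', hmk', r₂, hr₂, hkr⟩ := hfor m hmL.1 (hne m hmL) k hk hmk
      exact ⟨g', hg', k', hk', hmg', hmk', (hdir hr₁ hgr _).2 h1, fun h => h2
          ((hdir hr₂ hkr _).1 h)⟩
  obtain ⟨T', M, h1, h2, h3, h4, h5, h6⟩ := ih _ hcard rfl hdT hL'
    ((hfin.subset sdiff_subset).insert _) hR'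
  exact ⟨T', M, h1, h2, h3, h4, Relation.EqvGen.trans _ _ _ hiso h5, h6⟩

/-! ### Generic end points for the strands -/

/-- On a vertical line that carries at most one of finitely many given points there are points on no
line through two of them. -/
theorem exists_det_ne_vertical {E : Set Plane} (hE : E.Finite) {s h h' : ℝ} (hh : h < h')
    (hs : ∀ x ∈ E, ∀ y ∈ E, x.1 = s → y.1 = s → x = y) :
    ∃ t : ℝ, h < t ∧ t < h' ∧ ∀ x ∈ E, ∀ y ∈ E, x ≠ y → det (x - (s, t)) (y - (s, t)) ≠ 0 := by
  have hfin : ((fun z : Plane × Plane =>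
      ((z.1.1 - s) * z.2.2 - z.1.2 * (z.2.1 - s)) / (z.1.1 - z.2.1)) '' (E ×ˢ E)).Finite :=
    (hE.prod hE).image _
  obtain ⟨t, ⟨ht1, ht2⟩, ht⟩ := ((Ioo_infinite hh).sdiff hfin).nonempty
  refine ⟨t, ht1, ht2, fun x hx y hy hxy h0 => ?_⟩
  simp only [det, Prod.fst_sub, Prod.snd_sub] at h0
  by_cases h1 : x.1 = y.1
  · have h3 : (x.1 - s) * (y.2 - x.2) = 0 := by rw [h1] at h0 ⊢; linarith
    rcases mul_eq_zero.1 h3 with h4 | h4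
    · exact hxy (hs x hx y hy (sub_eq_zero.1 h4) (h1 ▸ sub_eq_zero.1 h4))
    · exact hxy (Prod.ext h1 (sub_eq_zero.1 h4).symm)
  · refine ht ⟨(x, y), ⟨hx, hy⟩, ?_⟩
    have : x.1 - y.1 ≠ 0 := sub_ne_zero.2 h1
    field_simp
    linarith

/-- The edges of `T`, and for every `j ∈ s` an edge from the point `a j` down to the point
`(x j, c j)` and an edge from the point `(x j, g j)` down to the point `b j`. -/
def withStrands {n : ℕ} (T : Set Edge) (a b : Fin n → Plane) (x c g : Fin n → ℝ)
    (s : Set (Fin n)) : Set Edge :=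
  T ∪ {e | ∃ j ∈ s, e = (a j, (x j, c j)) ∨ e = ((x j, g j), b j)}

/-- The strand ends lie on vertical lines to the right of the link; the further to the right, the
nearer to the height of the link. -/
structure Bands {n : ℕ} (m M X : ℝ) (x c g : Fin n → ℝ) (j : Fin n) : Prop where
  x_gt : X + j < x j
  x_lt : x j < X + j + 1
  c_gt : m - closingOffset j < c j
  c_lt : c j < m - closingOffset j + 1
  g_gt : M + closingOffset j - 1 < g j
  g_lt : g j < M + closingOffset j

theorem GenPos.insert_fst {S : Set Edge} (hS : GenPos S) {c x : Plane} (hc : GenericPoint S ∅ c)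
    (hx : x ∈ verts S) : GenPos (insert (c, x) S) := by
  have h1 : GenericPoint (Prod.swap ⁻¹' S) ∅ c := by
    rw [GenericPoint, events_reverse]; exact hc
  have := (h1.genPos_insert hS.reverse (x := x) (by rwa [verts_reverse])).reverse
  rwa [preimage_swap_insert, preimage_swap_swap] at this

/-- Strand ends can be chosen one after the other such that the new edges are in general position;
both ends of a strand lie on the same vertical line. -/
theorem exists_strands {n : ℕ} {T : Set Edge} (hT : GenPos T) {m M X : ℝ}
    (hbox : ∀ v ∈ verts T, v.1 < X) {a b : Fin n → Plane} (ha : ∀ j, a j ∈ verts T)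
    (hb : ∀ j, b j ∈ verts T) (s : Finset (Fin n)) :
    ∃ x c g : Fin n → ℝ, (∀ j ∈ s, Bands m M X x c g j) ∧ GenPos (withStrands T a b x c g s) := by
  classical
  induction s using Finset.induction_on with
  | empty =>
    refine ⟨0, 0, 0, by simp, ?_⟩
    simpa [withStrands] using hT
  | insert k s hk ih =>
    obtain ⟨x, c, g, hband, hgen⟩ := ih
    set V := withStrands T a b x c g s with hV
    have hTV : verts T ⊆ verts V := verts_mono subset_union_left
    obtain ⟨C, h1, h2, h3, h4, h5, h6⟩ := exists_det_ne (hgen.finite_events (L := ∅) finite_empty)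
      (show X + (k : ℝ) < X + k + 1 by linarith)
      (show m - closingOffset k < m - closingOffset k + 1 by linarith)
    have hC : GenericPoint V ∅ C := h6
    have hgen' := hC.genPos_insert hgen (hTV (ha k))
    have haC : (a k).1 < C.1 := by
      have := hbox _ (ha k)
      have h0 : (0 : ℝ) ≤ (k : ℕ) := Nat.cast_nonneg _
      linarith
    -- the other strand end has to lie on the same vertical line, where `C` is the only event
    have hline : ∀ y ∈ events (insert (a k, C) V) ∅, y.1 = C.1 → y = C := by
      rintro y ((hy | hy) | ⟨_, h, _⟩) hyC
      · rw [verts_insert] at hy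
        rcases hy with rfl | rfl | hy
        · exact absurd hyC haC.ne
        · rfl
        · exact absurd ⟨y, verts_subset_events _ _ hy, hyC⟩ h5
      · exfalso
        have key : y ∉ openSeg (a k, C) := by
          intro hy'
          obtain ⟨t, ht0, ht1, rfl⟩ := mem_openSeg.1 hy'
          simp only [Prod.fst_add, Prod.smul_fst, Prod.fst_sub, smul_eq_mul] at hyC
          nlinarith
        obtain ⟨e, rfl | he, f, rfl | hf, hef, hye, hyf⟩ := hy
        · exact hef rfl
        · exact key hye
        · exact key hyf
        · exact h5 ⟨y, crossPts_subset_events _ _ ⟨e, he, f, hf, hef, hye, hyf⟩, hyC⟩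
      · exact absurd h (notMem_empty _)
    obtain ⟨t, ht1, ht2, ht3⟩ := exists_det_ne_vertical
      (hgen'.finite_events (L := ∅) finite_empty) (s := C.1)
      (show M + closingOffset k - 1 < M + closingOffset k by linarith)
      fun y hy z hz hyC hzC => (hline y hy hyC).trans (hline z hz hzC).symm
    have hG : GenericPoint (insert (a k, C) V) ∅ (C.1, t) := ht3
    have hgen2 := hgen'.insert_fst hG (verts_mono (subset_insert _ _) (hTV (hb k)))
    have hne : ∀ j ∈ s, j ≠ k := fun j hj h => hk (h ▸ hj)
    refine ⟨Function.update x k C.1, Function.update c k C.2, Function.update g k t, ?_, ?_⟩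
    · intro j hj
      rcases Finset.mem_insert.1 hj with rfl | hj
      · constructor <;> simpa
      · obtain ⟨b1, b2, b3, b4, b5, b6⟩ := hband j hj
        constructor <;> rwa [Function.update_of_ne (hne j hj)]
    · refine hgen2.mono ?_
      rintro e (he | ⟨j, hj, he⟩)
      · exact Or.inr (Or.inr (Or.inl he))
      · rcases Finset.mem_insert.1 hj with rfl | hj
        · simp only [Function.update_self] at he
          rcases he with rfl | rfl
          · exact Or.inr (Or.inl rfl)
          · exact Or.inl rfl
        · simp only [Function.update_of_ne (hne j hj)] at he
          exact Or.inr (Or.inr (Or.inr ⟨j, hj, he⟩))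

/-! ### Closing arcs -/

theorem mem_seg_vertical {x y y' : ℝ} (h : y ≤ y') {z : Plane}
    (hz : z ∈ seg ((x, y), (x, y')) ∨ z ∈ seg ((x, y'), (x, y))) :
    z.1 = x ∧ y ≤ z.2 ∧ z.2 ≤ y' := by
  rcases hz with hz | hz <;> obtain ⟨s, h0, h1, rfl⟩ := mem_seg.1 hz <;>
    simp only [Prod.fst_add, Prod.smul_fst, Prod.fst_sub, Prod.snd_add, Prod.smul_snd,
      Prod.snd_sub, smul_eq_mul] <;>
    refine ⟨by ring, by nlinarith, by nlinarith⟩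

theorem mem_seg_horizontal {x x' y : ℝ} (h : x ≤ x') {z : Plane}
    (hz : z ∈ seg ((x, y), (x', y)) ∨ z ∈ seg ((x', y), (x, y))) :
    z.2 = y ∧ x ≤ z.1 ∧ z.1 ≤ x' := by
  rcases hz with hz | hz <;> obtain ⟨s, h0, h1, rfl⟩ := mem_seg.1 hz <;>
    simp only [Prod.fst_add, Prod.smul_fst, Prod.fst_sub, Prod.snd_add, Prod.smul_snd,
      Prod.snd_sub, smul_eq_mul] <;>
    refine ⟨by ring, by nlinarith, by nlinarith⟩

/-- The corners of an arc around the right side of a braid, with its offset `o`. -/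
def arcCorners (x o bot top right : ℝ) : List Plane :=
  [(x, bot), (x, bot - o), (right + o, bot - o), (right + o, top + o), (x, top + o), (x, top)]

/-- An arc that joins the point `(x, c)` inside a braid to the point `(x, g)` above it, around the
right side of the braid. -/
def arc (x c g o bot top right : ℝ) : Set Edge :=
  chain (x, c) (arcCorners x o bot top right) (x, g)

section arc

variable {x c g o bot top right : ℝ} (hc : bot < c) (ho : 0 < o) (hx : x < right) (hg : g < top)
  (hcg : c < g)
include hc ho hx hg hcg

theorem arc_cases {e : Edge} (he : e ∈ arc x c g o bot top right) {z : Plane} (hz : z ∈ seg e) :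
    (e = ((x, c), (x, bot)) ∧ z.1 = x ∧ bot ≤ z.2 ∧ z.2 ≤ c) ∨
    (e = ((x, bot), (x, bot - o)) ∧ z.1 = x ∧ bot - o ≤ z.2 ∧ z.2 ≤ bot) ∨
    (e = ((x, bot - o), (right + o, bot - o)) ∧ z.2 = bot - o ∧ x ≤ z.1 ∧ z.1 ≤ right + o) ∨
    (e = ((right + o, bot - o), (right + o, top + o)) ∧ z.1 = right + o ∧ bot - o ≤ z.2 ∧
      z.2 ≤ top + o) ∨
    (e = ((right + o, top + o), (x, top + o)) ∧ z.2 = top + o ∧ x ≤ z.1 ∧ z.1 ≤ right + o) ∨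
    (e = ((x, top + o), (x, top)) ∧ z.1 = x ∧ top ≤ z.2 ∧ z.2 ≤ top + o) ∨
    (e = ((x, top), (x, g)) ∧ z.1 = x ∧ g ≤ z.2 ∧ z.2 ≤ top) := by
  simp only [arc, arcCorners, chain, mem_insert_iff, mem_singleton_iff] at he
  rcases he with rfl | rfl | rfl | rfl | rfl | rfl | rfl
  · exact Or.inl ⟨rfl, mem_seg_vertical (by linarith) (Or.inr hz)⟩
  · exact Or.inr (Or.inl ⟨rfl, mem_seg_vertical (by linarith) (Or.inr hz)⟩)
  · exact Or.inr (Or.inr (Or.inl ⟨rfl, mem_seg_horizontal (by linarith) (Or.inl hz)⟩))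
  · exact Or.inr (Or.inr (Or.inr (Or.inl ⟨rfl, mem_seg_vertical (by linarith) (Or.inl hz)⟩)))
  · exact Or.inr (Or.inr (Or.inr (Or.inr (Or.inl ⟨rfl,
      mem_seg_horizontal (by linarith) (Or.inr hz)⟩))))
  · exact Or.inr (Or.inr (Or.inr (Or.inr (Or.inr (Or.inl ⟨rfl,
      mem_seg_vertical (by linarith) (Or.inr hz)⟩)))))
  · exact Or.inr (Or.inr (Or.inr (Or.inr (Or.inr (Or.inr ⟨rfl,
      mem_seg_vertical (by linarith) (Or.inr hz)⟩)))))

theorem arc_ne {e : Edge} (he : e ∈ arc x c g o bot top right) : e.1 ≠ e.2 := by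
  simp only [arc, arcCorners, chain, mem_insert_iff, mem_singleton_iff] at he
  rcases he with rfl | rfl | rfl | rfl | rfl | rfl | rfl <;> intro h <;>
    have h1 := congrArg Prod.fst h <;> have h2 := congrArg Prod.snd h <;> dsimp only at h1 h2 <;>
    linarith

theorem arc_meet {e f : Edge} (he : e ∈ arc x c g o bot top right)
    (hf : f ∈ arc x c g o bot top right) (hef : e ≠ f) {z : Plane} (hze : z ∈ seg e)
    (hzf : z ∈ seg f) : (z = e.1 ∨ z = e.2) ∧ (z = f.1 ∨ z = f.2) := by
  rcases arc_cases hc ho hx hg hcg he hze with ⟨rfl, h1, h2, h3⟩ | ⟨rfl, h1, h2, h3⟩ |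
    ⟨rfl, h1, h2, h3⟩ | ⟨rfl, h1, h2, h3⟩ | ⟨rfl, h1, h2, h3⟩ | ⟨rfl, h1, h2, h3⟩ |
    ⟨rfl, h1, h2, h3⟩ <;>
  rcases arc_cases hc ho hx hg hcg hf hzf with ⟨rfl, k1, k2, k3⟩ | ⟨rfl, k1, k2, k3⟩ |
    ⟨rfl, k1, k2, k3⟩ | ⟨rfl, k1, k2, k3⟩ | ⟨rfl, k1, k2, k3⟩ | ⟨rfl, k1, k2, k3⟩ |
    ⟨rfl, k1, k2, k3⟩ <;>
  first
  | exact absurd rfl hef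
  | (exfalso; linarith)
  | exact ⟨Or.inr (Prod.ext (by dsimp only; linarith) (by dsimp only; linarith)),
      Or.inl (Prod.ext (by dsimp only; linarith) (by dsimp only; linarith))⟩
  | exact ⟨Or.inl (Prod.ext (by dsimp only; linarith) (by dsimp only; linarith)),
      Or.inr (Prod.ext (by dsimp only; linarith) (by dsimp only; linarith))⟩

/-- Arcs with different abscissas and offsets are disjoint. -/
theorem arc_disjoint {x' c' g' o' : ℝ} (hc' : bot < c') (ho' : 0 < o') (hx' : x' < right)
    (hg' : g' < top) (hcg' : c' < g') (hxx : x < x') (hoo : o' < o) {e f : Edge}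
    (he : e ∈ arc x c g o bot top right) (hf : f ∈ arc x' c' g' o' bot top right) {z : Plane}
    (hze : z ∈ seg e) (hzf : z ∈ seg f) : False := by
  rcases arc_cases hc ho hx hg hcg he hze with ⟨-, h1, h2, h3⟩ | ⟨-, h1, h2, h3⟩ |
    ⟨-, h1, h2, h3⟩ | ⟨-, h1, h2, h3⟩ | ⟨-, h1, h2, h3⟩ | ⟨-, h1, h2, h3⟩ | ⟨-, h1, h2, h3⟩ <;>
  rcases arc_cases hc' ho' hx' hg' hcg' hf hzf with ⟨-, k1, k2, k3⟩ | ⟨-, k1, k2, k3⟩ |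
    ⟨-, k1, k2, k3⟩ | ⟨-, k1, k2, k3⟩ | ⟨-, k1, k2, k3⟩ | ⟨-, k1, k2, k3⟩ | ⟨-, k1, k2, k3⟩ <;>
  linarith

end arc

/-- Edges that meet each other and the edges of `S` at most in common end points may be added to a
set in general position. -/
theorem GenPos.union {S R : Set Edge} (hS : GenPos S) (hR : R.Finite) (hne : ∀ e ∈ R, e.1 ≠ e.2)
    (h : ∀ e ∈ R, ∀ f ∈ S ∪ R, e ≠ f → ∀ z, z ∈ seg e → z ∈ seg f →
      (z = e.1 ∨ z = e.2) ∧ (z = f.1 ∨ z = f.2)) : GenPos (S ∪ R) := by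
  have hne' : ∀ e ∈ S ∪ R, e.1 ≠ e.2 := by
    rintro e (he | he)
    · exact hS.ne e he
    · exact hne e he
  have hdis : ∀ e ∈ R, ∀ f ∈ S ∪ R, e ≠ f → ∀ z, z ∈ openSeg e → z ∉ openSeg f := by
    intro e he f hf hef z hze hzf
    rcases (h e he f hf hef z (openSeg_subset _ hze) (openSeg_subset _ hzf)).1 with rfl | rfl
    · exact fst_notMem_openSeg (hne e he) hze
    · exact snd_notMem_openSeg (hne e he) hze
  refine ⟨hS.finite.union hR, hne', ?_, ?_, ?_⟩
  · have key : ∀ e ∈ R, (e.2, e.1) ∉ S ∪ R := by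
      intro e he hf
      have hmid : e.1 + (1 / 2 : ℝ) • (e.2 - e.1) ∈ openSeg e :=
        mem_openSeg.2 ⟨1 / 2, by norm_num, by norm_num, rfl⟩
      refine hdis e he _ hf (fun h' => hne e he (congrArg Prod.fst h')) _ hmid ?_
      change _ ∈ openSeg e.swap
      rwa [openSeg_swap]
    rintro e he hf
    rcases he with he | he
    · rcases hf with hf | hf
      · exact hS.not_opposite e he hf
      · exact key _ hf (Or.inl he)
    · exact key e he hf
  · intro e he f hf v hv hve
    by_cases hef : e = f
    · rw [hef]; exact hv
    have hvf : v ∈ seg f := by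
      rcases hv with rfl | rfl
      · exact fst_mem_seg f
      · exact snd_mem_seg f
    rcases he with he | he
    · rcases hf with hf | hf
      · exact hS.vertex e he f hf v hv hve
      · exact (h f hf e (Or.inl he) (Ne.symm hef) v hvf hve).2
    · exact (h e he f hf hef v hve hvf).1
  · intro e he f hf k hk hef hfk hek
    rw [eq_empty_iff_forall_notMem]
    rintro z ⟨⟨hze, hzf⟩, hzk⟩
    rcases he with he | he
    · rcases hf with hf | hf
      · rcases hk with hk | hk
        · have := hS.no_triple e he f hf k hk hef hfk hek
          rw [eq_empty_iff_forall_notMem] at this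
          exact this z ⟨⟨hze, hzf⟩, hzk⟩
        · exact hdis k hk f (Or.inl hf) hfk.symm z hzk hzf
      · exact hdis f hf e (Or.inl he) hef.symm z hzf hze
    · exact hdis e he f hf hef z hze hzf

theorem finite_chain (ps : List Plane) (a b : Plane) : (chain a ps b).Finite := by
  induction ps generalizing a with
  | nil => exact finite_singleton _
  | cons P ps ih => exact (ih P).insert _

/-- The first and the last edge of a path, split off. -/
theorem chain_cons_append (ps : List Plane) : ∀ (a b P Q : Plane),
    chain a (P :: (ps ++ [Q])) b = insert (a, P) (insert (Q, b) (chain P ps Q)) := by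
  induction ps with
  | nil =>
    intro a b P Q
    simp only [List.nil_append, chain]
    ext e
    simp only [mem_insert_iff, mem_singleton_iff]
    tauto
  | cons R ps ih =>
    intro a b P Q
    have := ih P b R Q
    rw [List.cons_append, chain, this, chain]
    ext e
    simp only [mem_insert_iff]
    tauto

theorem mem_or_mem_of_mem_chain {ps : List Plane} (hps : ps ≠ []) {a b : Plane} {e : Edge}
    (he : e ∈ chain a ps b) : e.1 ∈ ps ∨ e.2 ∈ ps := by
  induction ps generalizing a with
  | nil => exact absurd rfl hps
  | cons P ps ih =>
    rcases he with rfl | he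
    · exact Or.inr List.mem_cons_self
    · by_cases h : ps = []
      · subst h
        obtain rfl : e = (P, b) := he
        exact Or.inl List.mem_cons_self
      · exact (ih h he).imp (List.mem_cons_of_mem _) (List.mem_cons_of_mem _)

theorem verts_chain {ps : List Plane} {a b : Plane} {v : Plane} (hv : v ∈ verts (chain a ps b)) :
    v = a ∨ v = b ∨ v ∈ ps := by
  induction ps generalizing a with
  | nil =>
    obtain ⟨e, rfl, rfl | rfl⟩ := hv
    · exact Or.inl rfl
    · exact Or.inr (Or.inl rfl)
  | cons P ps ih =>
    rw [chain, verts_insert] at hv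
    rcases hv with rfl | rfl | hv
    · exact Or.inl rfl
    · exact Or.inr (Or.inr List.mem_cons_self)
    · rcases ih hv with rfl | rfl | h
      · exact Or.inr (Or.inr List.mem_cons_self)
      · exact Or.inr (Or.inl rfl)
      · exact Or.inr (Or.inr (List.mem_cons_of_mem _ h))

theorem exists_mem_chain {ps : List Plane} {a b : Plane} {v : Plane} (hv : v ∈ ps) :
    ∃ e ∈ chain a ps b, v = e.1 ∨ v = e.2 := by
  induction ps generalizing a with
  | nil => exact absurd hv List.not_mem_nil
  | cons P ps ih =>
    rcases List.mem_cons.1 hv with rfl | hv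
    · exact ⟨(a, v), Or.inl rfl, Or.inr rfl⟩
    · obtain ⟨e, he, h⟩ := ih (a := P) hv
      exact ⟨e, Or.inr he, h⟩

theorem fst_lt_of_mem_seg {e : Edge} {X : ℝ} (h1 : e.1.1 < X) (h2 : e.2.1 < X) {z : Plane}
    (hz : z ∈ seg e) : z.1 < X := by
  have hconv : Convex ℝ {z : Plane | z.1 < X} :=
    convex_halfSpace_lt (LinearMap.fst ℝ ℝ ℝ).isLinear _
  exact hconv.segment_subset h1 h2 hz

theorem snd_lt_of_mem_seg {e : Edge} {M : ℝ} (h1 : e.1.2 < M) (h2 : e.2.2 < M) {z : Plane}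
    (hz : z ∈ seg e) : z.2 < M := by
  have hconv : Convex ℝ {z : Plane | z.2 < M} :=
    convex_halfSpace_lt (LinearMap.snd ℝ ℝ ℝ).isLinear _
  exact hconv.segment_subset h1 h2 hz

theorem lt_snd_of_mem_seg {e : Edge} {m : ℝ} (h1 : m < e.1.2) (h2 : m < e.2.2) {z : Plane}
    (hz : z ∈ seg e) : m < z.2 := by
  have hconv : Convex ℝ {z : Plane | m < z.2} :=
    convex_halfSpace_gt (LinearMap.snd ℝ ℝ ℝ).isLinear _
  exact hconv.segment_subset h1 h2 hz

theorem closingOffset_bounds {n : ℕ} (j : Fin n) :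
    1 ≤ closingOffset j ∧ closingOffset j ≤ n := by
  have h1 : ((j : ℕ) : ℝ) + 1 ≤ n := by exact_mod_cast j.2
  have h2 : (0 : ℝ) ≤ (j : ℕ) := Nat.cast_nonneg _
  rw [closingOffset]
  constructor <;> linarith

/-! ### The strands and arcs around the axis -/

/-- A link in a box, with `n` of its edges `a j → b j` to be led around a braid axis: the strand
ends `(x j, c j)` and `(x j, g j)` lie below and above the link and to the right of it. -/
structure Layout {n : ℕ} (T : Set Edge) (a b : Fin n → Plane) (m M X : ℝ) (x c g : Fin n → ℝ) :
    Prop where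
  box : ∀ v ∈ verts T, m < v.2 ∧ v.2 < M ∧ v.1 < X
  mem : ∀ j, (a j, b j) ∈ T
  injective : Function.Injective fun j => (a j, b j)
  bands : ∀ j, Bands m M X x c g j
  gen : GenPos (withStrands T a b x c g univ)

namespace Layout

variable {n : ℕ} {T : Set Edge} {a b : Fin n → Plane} {m M X : ℝ} {x c g : Fin n → ℝ}

/-- The closing arc of the `j`-th strand. -/
def arcOf (m M X : ℝ) (x c g : Fin n → ℝ) (j : Fin n) : Set Edge :=
  arc (x j) (c j) (g j) (closingOffset j) (m - n - 1) (M + n + 1) (X + n + 1)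

/-- The inner vertices of the path that replaces the edge `a j → b j`. -/
def points (m M X : ℝ) (x c g : Fin n → ℝ) (j : Fin n) : List Plane :=
  (x j, c j) :: (arcCorners (x j) (closingOffset j) (m - n - 1) (M + n + 1) (X + n + 1) ++
    [(x j, g j)])

theorem chain_points (m M X : ℝ) (x c g : Fin n → ℝ) (j : Fin n) (p q : Plane) :
    chain p (points m M X x c g j) q =
      insert (p, (x j, c j)) (insert ((x j, g j), q) (arcOf m M X x c g j)) :=
  chain_cons_append _ _ _ _ _

variable (h : Layout T a b m M X x c g)
include h

theorem bounds (j : Fin n) : m - n - 1 < c j ∧ 0 < closingOffset j ∧ x j < X + n + 1 ∧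
    g j < M + n + 1 ∧ c j < g j ∧ c j < m ∧ M < g j ∧ X < x j ∧ m < M := by
  obtain ⟨h1, h2, h3, h4, h5, h6⟩ := h.bands j
  obtain ⟨h7, h8⟩ := closingOffset_bounds j
  obtain ⟨h9, h10, -⟩ := h.box _ (fst_mem_verts (h.mem j))
  have h11 : ((j : ℕ) : ℝ) + 1 ≤ n := by exact_mod_cast j.2
  have h12 : (0 : ℝ) ≤ (j : ℕ) := Nat.cast_nonneg _
  refine ⟨?_, ?_, ?_, ?_, ?_, ?_, ?_, ?_, ?_⟩ <;> linarith

theorem lt {i j : Fin n} (hij : i < j) :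
    x i < x j ∧ closingOffset j < closingOffset i ∧ c i < c j ∧ g j < g i := by
  obtain ⟨h1, h2, h3, h4, h5, h6⟩ := h.bands i
  obtain ⟨k1, k2, k3, k4, k5, k6⟩ := h.bands j
  have h11 : ((i : ℕ) : ℝ) + 1 ≤ (j : ℕ) := by exact_mod_cast (Fin.lt_def.1 hij)
  have e1 : closingOffset i = (n : ℝ) - (i : ℕ) := rfl
  have e2 : closingOffset j = (n : ℝ) - (j : ℕ) := rfl
  refine ⟨?_, ?_, ?_, ?_⟩ <;> linarith

theorem arcOf_cases {j : Fin n} {e : Edge} (he : e ∈ arcOf m M X x c g j) {z : Plane}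
    (hz : z ∈ seg e) :
    (e = ((x j, c j), (x j, m - n - 1)) ∧ z.1 = x j ∧ m - n - 1 ≤ z.2 ∧ z.2 ≤ c j) ∨
    (z.1 = x j ∧ m - n - 1 - closingOffset j ≤ z.2 ∧ z.2 ≤ m - n - 1) ∨
    (z.2 = m - n - 1 - closingOffset j ∧ x j ≤ z.1 ∧ z.1 ≤ X + n + 1 + closingOffset j) ∨
    (z.1 = X + n + 1 + closingOffset j ∧ m - n - 1 - closingOffset j ≤ z.2 ∧
      z.2 ≤ M + n + 1 + closingOffset j) ∨
    (z.2 = M + n + 1 + closingOffset j ∧ x j ≤ z.1 ∧ z.1 ≤ X + n + 1 + closingOffset j) ∨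
    (z.1 = x j ∧ M + n + 1 ≤ z.2 ∧ z.2 ≤ M + n + 1 + closingOffset j) ∨
    (e = ((x j, M + n + 1), (x j, g j)) ∧ z.1 = x j ∧ g j ≤ z.2 ∧ z.2 ≤ M + n + 1) := by
  obtain ⟨h1, h2, h3, h4, h5, -⟩ := h.bounds j
  exact (arc_cases h1 h2 h3 h4 h5 he hz).imp_right (Or.imp And.right (Or.imp And.right
    (Or.imp And.right (Or.imp And.right (Or.imp And.right id)))))

theorem arcOf_disjoint {i j : Fin n} (hij : i ≠ j) {e f : Edge} (he : e ∈ arcOf m M X x c g i)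
    (hf : f ∈ arcOf m M X x c g j) {z : Plane} (hze : z ∈ seg e) (hzf : z ∈ seg f) : False := by
  obtain ⟨h1, h2, h3, h4, h5, -⟩ := h.bounds i
  obtain ⟨k1, k2, k3, k4, k5, -⟩ := h.bounds j
  rcases lt_or_gt_of_ne hij with hlt | hlt
  · obtain ⟨l1, l2, -⟩ := h.lt hlt
    exact arc_disjoint h1 h2 h3 h4 h5 k1 k2 k3 k4 k5 l1 l2 he hf hze hzf
  · obtain ⟨l1, l2, -⟩ := h.lt hlt
    exact arc_disjoint k1 k2 k3 k4 k5 h1 h2 h3 h4 h5 l1 l2 hf he hzf hze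

/-- The closing arcs lie outside the box of the link. -/
theorem arcOf_outside {j : Fin n} {e : Edge} (he : e ∈ arcOf m M X x c g j) {z : Plane}
    (hz : z ∈ seg e) : ¬ (m < z.2 ∧ z.2 < M ∧ z.1 < X) := by
  rintro ⟨k1, k2, k3⟩
  obtain ⟨h1, h2, h3, h4, h5, h6, h7, h8, h9⟩ := h.bounds j
  have hn : (0 : ℝ) ≤ n := Nat.cast_nonneg n
  rcases h.arcOf_cases he hz with ⟨-, l1, l2, l3⟩ | ⟨l1, l2, l3⟩ | ⟨l1, l2, l3⟩ |
    ⟨l1, l2, l3⟩ | ⟨l1, l2, l3⟩ | ⟨l1, l2, l3⟩ | ⟨-, l1, l2, l3⟩ <;> linarith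

theorem seg_box {e : Edge} (he : e ∈ T) {z : Plane} (hz : z ∈ seg e) :
    m < z.2 ∧ z.2 < M ∧ z.1 < X := by
  obtain ⟨h1, h2, h3⟩ := h.box _ (fst_mem_verts he)
  obtain ⟨k1, k2, k3⟩ := h.box _ (snd_mem_verts he)
  exact ⟨lt_snd_of_mem_seg h1 k1 hz, snd_lt_of_mem_seg h2 k2 hz, fst_lt_of_mem_seg h3 k3 hz⟩

theorem bottom_cases (i : Fin n) {z : Plane} (hz : z ∈ seg (a i, (x i, c i))) :
    c i ≤ z.2 ∧ z.2 < M ∧ z.1 ≤ x i ∧ (z.1 = x i → z = (x i, c i)) := by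
  obtain ⟨h1, h2, h3, h4, h5, h6, h7, h8, h9⟩ := h.bounds i
  obtain ⟨k1, k2, k3⟩ := h.box _ (fst_mem_verts (h.mem i))
  obtain ⟨s, hs0, hs1, rfl⟩ := mem_seg.1 hz
  simp only [Prod.fst_add, Prod.smul_fst, Prod.fst_sub, Prod.snd_add, Prod.smul_snd,
    Prod.snd_sub, smul_eq_mul]
  dsimp only at k1 k2 k3
  refine ⟨by nlinarith, by nlinarith, by nlinarith, fun h' => ?_⟩
  have h10 : (1 - s) * (x i - (a i).1) = 0 := by linarith
  have h11 : 1 - s = 0 := (mul_eq_zero.1 h10).resolve_right (by linarith)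
  have : s = 1 := by linarith
  rw [this, one_smul]; abel

theorem top_cases (i : Fin n) {z : Plane} (hz : z ∈ seg ((x i, g i), b i)) :
    z.2 ≤ g i ∧ m < z.2 ∧ z.1 ≤ x i ∧ (z.1 = x i → z = (x i, g i)) := by
  obtain ⟨h1, h2, h3, h4, h5, h6, h7, h8, h9⟩ := h.bounds i
  obtain ⟨k1, k2, k3⟩ := h.box _ (snd_mem_verts (h.mem i))
  obtain ⟨s, hs0, hs1, rfl⟩ := mem_seg.1 hz
  simp only [Prod.fst_add, Prod.smul_fst, Prod.fst_sub, Prod.snd_add, Prod.smul_snd,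
    Prod.snd_sub, smul_eq_mul]
  dsimp only at k1 k2 k3
  refine ⟨by nlinarith, by nlinarith, by nlinarith, fun h' => ?_⟩
  have h10 : s * (x i - (b i).1) = 0 := by linarith
  have h11 : s = 0 := (mul_eq_zero.1 h10).resolve_right (by linarith)
  rw [h11, zero_smul, add_zero]

/-- The link, the strand ends and the closing arcs are in general position. -/
theorem genPos : GenPos (withStrands T a b x c g univ ∪ {e | ∃ j, e ∈ arcOf m M X x c g j}) := by
  refine h.gen.union ?_ ?_ ?_
  · have : {e | ∃ j, e ∈ arcOf m M X x c g j} = ⋃ j, arcOf m M X x c g j := by ext; simp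
    rw [this]
    exact finite_iUnion fun j => finite_chain _ _ _
  · rintro e ⟨j, he⟩
    obtain ⟨h1, h2, h3, h4, h5, -⟩ := h.bounds j
    exact arc_ne h1 h2 h3 h4 h5 he
  rintro e ⟨j, he⟩ f hf hef z hze hzf
  obtain ⟨h1, h2, h3, h4, h5, h6, h7, h8, h9⟩ := h.bounds j
  have hn : (0 : ℝ) ≤ n := Nat.cast_nonneg n
  rcases hf with (hf | ⟨i, -, rfl | rfl⟩) | ⟨i, hf⟩
  · exact absurd (h.seg_box hf hzf) (h.arcOf_outside he hze)
  · obtain ⟨k1, k2, k3, k4⟩ := h.bottom_cases i hzf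
    obtain ⟨m1, m2, m3, m4, m5, m6, m7, m8, m9⟩ := h.bounds i
    rcases h.arcOf_cases he hze with ⟨rfl, l1, l2, l3⟩ | ⟨l1, l2, l3⟩ | ⟨l1, l2, l3⟩ |
      ⟨l1, l2, l3⟩ | ⟨l1, l2, l3⟩ | ⟨l1, l2, l3⟩ | ⟨-, l1, l2, l3⟩
    · rcases lt_trichotomy i j with hij | rfl | hij
      · linarith [(h.lt hij).1]
      · exact ⟨Or.inl (k4 l1), Or.inr (k4 l1)⟩
      · linarith [(h.lt hij).2.2.1]
    all_goals exfalso; linarith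
  · obtain ⟨k1, k2, k3, k4⟩ := h.top_cases i hzf
    obtain ⟨m1, m2, m3, m4, m5, m6, m7, m8, m9⟩ := h.bounds i
    rcases h.arcOf_cases he hze with ⟨-, l1, l2, l3⟩ | ⟨l1, l2, l3⟩ | ⟨l1, l2, l3⟩ |
      ⟨l1, l2, l3⟩ | ⟨l1, l2, l3⟩ | ⟨l1, l2, l3⟩ | ⟨rfl, l1, l2, l3⟩
    on_goal 7 =>
      rcases lt_trichotomy i j with hij | rfl | hij
      · linarith [(h.lt hij).1]
      · exact ⟨Or.inr (k4 l1), Or.inl (k4 l1)⟩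
      · linarith [(h.lt hij).2.2.2]
    all_goals exfalso; linarith
  · by_cases hij : j = i
    · subst hij
      exact arc_meet h1 h2 h3 h4 h5 he hf hef hze hzf
    · exact (h.arcOf_disjoint hij he hf hze hzf).elim

omit h in
theorem mem_arcOf_of_mem_points {j : Fin n} {P : Plane} (hP : P ∈ points m M X x c g j) :
    ∃ e ∈ arcOf m M X x c g j, P ∈ seg e := by
  have hv : P = (x j, c j) ∨ P = (x j, g j) ∨
      P ∈ arcCorners (x j) (closingOffset j) (m - n - 1) (M + n + 1) (X + n + 1) := by
    rw [points, List.mem_cons, List.mem_append, List.mem_singleton] at hP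
    tauto
  rcases hv with rfl | rfl | hv
  · exact ⟨_, Or.inl rfl, fst_mem_seg _⟩
  · refine ⟨((x j, M + n + 1), (x j, g j)), ?_, snd_mem_seg _⟩
    simp [arcOf, arc, arcCorners, chain]
  · obtain ⟨e, he, rfl | rfl⟩ := exists_mem_chain (a := (x j, c j)) (b := (x j, g j)) hv
    · exact ⟨e, he, fst_mem_seg e⟩
    · exact ⟨e, he, snd_mem_seg e⟩

theorem notMem_verts {j : Fin n} {P : Plane} (hP : P ∈ points m M X x c g j) : P ∉ verts T := by
  obtain ⟨e, he, hPe⟩ := mem_arcOf_of_mem_points hP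
  exact fun h' => h.arcOf_outside he hPe (h.box P h')

theorem notMem_points {i j : Fin n} (hij : i ≠ j) {P : Plane} (hP : P ∈ points m M X x c g j) :
    P ∉ points m M X x c g i := by
  obtain ⟨e, he, hPe⟩ := mem_arcOf_of_mem_points hP
  intro hP'
  obtain ⟨f, hf, hPf⟩ := mem_arcOf_of_mem_points hP'
  exact h.arcOf_disjoint hij hf he hPf hPe

theorem nodup_points (j : Fin n) : (points m M X x c g j).Nodup := by
  obtain ⟨h1, h2, h3, h4, h5, h6, h7, h8, h9⟩ := h.bounds j
  have hn : (0 : ℝ) ≤ n := Nat.cast_nonneg n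
  simp only [points, arcCorners, List.cons_append, List.nil_append, List.nodup_cons, List.mem_cons,
    not_or, Prod.mk.injEq, List.not_mem_nil, not_false_eq_true, List.nodup_nil, and_true]
  repeat' apply And.intro
  all_goals
    intro k
    linarith

theorem chain_notMem {j : Fin n} {p q : Plane} {e : Edge}
    (he : e ∈ chain p (points m M X x c g j) q) : e ∉ T := by
  intro heT
  rcases mem_or_mem_of_mem_chain (List.cons_ne_nil _ _) he with h' | h'
  · exact h.notMem_verts h' (fst_mem_verts heT)
  · exact h.notMem_verts h' (snd_mem_verts heT)

end Layout

/-! ### The braid -/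

theorem realized_ne {S : Set Edge} {L : Markers} (hR : Realized S L) {m : Plane × Plane}
    (hm : m ∈ L) : ∃ e ∈ S, ∃ f ∈ S, e ≠ f ∧ m.1 ∈ openSeg e ∧ m.1 ∈ openSeg f := by
  obtain ⟨e, he, f, hf, h1, h2, h3, h4⟩ := hR m hm
  refine ⟨e, he, f, hf, ?_, h1, h2⟩
  rintro rfl
  exact h4 h3

/-- The edges obtained by leading the first `k` of the edges `a j → b j` around the axis. -/
def partiallyBraided {n : ℕ} (T : Set Edge) (a b : Fin n → Plane) (m M X : ℝ) (x c g : Fin n → ℝ)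
    (k : ℕ) : Set Edge :=
  {e ∈ T | ∀ i : Fin n, (i : ℕ) < k → e ≠ (a i, b i)} ∪
    {e | ∃ i : Fin n, (i : ℕ) < k ∧ e ∈ chain (a i) (Layout.points m M X x c g i) (b i)}

/-- The edges of the braid: the strands between the closing arcs. -/
def braidEdges {n : ℕ} (T : Set Edge) (a b : Fin n → Plane) (m M : ℝ) (x c g : Fin n → ℝ) :
    Set Edge :=
  {e ∈ T | ∀ i : Fin n, e ≠ (a i, b i)} ∪
    {e | ∃ i : Fin n, e = (a i, (x i, c i)) ∨ e = ((x i, c i), (x i, m - n - 1)) ∨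
      e = ((x i, M + n + 1), (x i, g i)) ∨ e = ((x i, g i), b i)}

namespace Layout

variable {n : ℕ} {T : Set Edge} {a b : Fin n → Plane} {m M X : ℝ} {x c g : Fin n → ℝ}

theorem lt_succ_iff_lt_or_eq {k : ℕ} (hk : k < n) {i : Fin n} :
    (i : ℕ) < k + 1 ↔ (i : ℕ) < k ∨ i = ⟨k, hk⟩ := by
  rw [Nat.lt_succ_iff_lt_or_eq, Fin.ext_iff]

variable (h : Layout T a b m M X x c g)
include h

omit h in
theorem partiallyBraided_subset (k : ℕ) : partiallyBraided T a b m M X x c g k ⊆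
    withStrands T a b x c g univ ∪ {e | ∃ j, e ∈ arcOf m M X x c g j} := by
  rintro e (⟨he, -⟩ | ⟨i, -, he⟩)
  · exact Or.inl (Or.inl he)
  · rw [chain_points] at he
    rcases he with rfl | rfl | he
    · exact Or.inl (Or.inr ⟨i, mem_univ _, Or.inl rfl⟩)
    · exact Or.inl (Or.inr ⟨i, mem_univ _, Or.inr rfl⟩)
    · exact Or.inr ⟨i, he⟩

theorem free_of_notMem {L : Markers} (hR : Realized T L) {e : Edge}
    (he : e ∈ withStrands T a b x c g univ ∪ {e | ∃ j, e ∈ arcOf m M X x c g j}) (heT : e ∉ T) :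
    Free L e := by
  intro y hy hye
  obtain ⟨f, hf, k, hk, hfk, hyf, hyk⟩ := realized_ne hR hy
  have := h.genPos.no_triple f (Or.inl (Or.inl hf)) k (Or.inl (Or.inl hk)) e he hfk
    (fun h' => heT (h' ▸ hk)) (fun h' => heT (h' ▸ hf))
  rw [eq_empty_iff_forall_notMem] at this
  exact this y.1 ⟨⟨hyf, hyk⟩, hye⟩

theorem marks {L : Markers} (hR : Realized T L) : ∀ y ∈ L,
    y.1 ∉ verts (withStrands T a b x c g univ ∪ {e | ∃ j, e ∈ arcOf m M X x c g j}) := by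
  intro y hy hv
  obtain ⟨f, hf, k, hk, hfk, hyf, hyk⟩ := realized_ne hR hy
  exact h.genPos.crossPts_disjoint_verts hv ⟨f, Or.inl (Or.inl hf), k, Or.inl (Or.inl hk), hfk, hyf,
    hyk⟩

theorem verts_partiallyBraided {k : ℕ} {v : Plane}
    (hv : v ∈ verts (partiallyBraided T a b m M X x c g k)) :
    v ∈ verts T ∨ ∃ i : Fin n, (i : ℕ) < k ∧ v ∈ points m M X x c g i := by
  obtain ⟨e, ⟨he, -⟩ | ⟨i, hi, he⟩, hve⟩ := hv
  · exact Or.inl ⟨e, he, hve⟩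
  · rcases verts_chain ⟨e, he, hve⟩ with rfl | rfl | h'
    · exact Or.inl (fst_mem_verts (h.mem i))
    · exact Or.inl (snd_mem_verts (h.mem i))
    · exact Or.inr ⟨i, hi, h'⟩

/-- Leading the edges `a j → b j` around the axis, one after the other, is a virtual isotopy. -/
theorem isotopic {L : Markers} (hd : Diag T) (hL : Functional L) (hfin : L.Finite)
    (hR : Realized T L) (hfree : ∀ j, Free L (a j, b j)) (k : ℕ) (hk : k ≤ n) :
    Diag (partiallyBraided T a b m M X x c g k) ∧
      VI L T (partiallyBraided T a b m M X x c g k) := by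
  induction k with
  | zero =>
    have : partiallyBraided T a b m M X x c g 0 = T := by
      ext e
      simp [partiallyBraided]
    rw [this]
    exact ⟨hd, VI.refl L T⟩
  | succ k ih =>
    obtain ⟨hd', hiso⟩ := ih (by omega)
    have hk' : k < n := hk
    set j : Fin n := ⟨k, hk'⟩ with hj
    set S := partiallyBraided T a b m M X x c g k with hS
    have hjS : (a j, b j) ∈ S := by
      refine Or.inl ⟨h.mem j, fun i hi h' => ?_⟩
      rw [h.injective h'] at hj
      rw [hj] at hi
      exact lt_irrefl _ hi
    have hins : insert (a j, b j) (S \ {(a j, b j)}) = S := by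
      rw [insert_sdiff_singleton, insert_eq_of_mem hjS]
    have hchain : ∀ e ∈ chain (a j) (points m M X x c g j) (b j),
        e ∈ withStrands T a b x c g univ ∪ {e | ∃ j, e ∈ arcOf m M X x c g j} := fun e he =>
      partiallyBraided_subset n (Or.inr ⟨j, j.2, he⟩)
    have hsub : insert (a j, b j) (S \ {(a j, b j)}) ∪ chain (a j) (points m M X x c g j) (b j) ⊆
        withStrands T a b x c g univ ∪ {e | ∃ j, e ∈ arcOf m M X x c g j} := by
      rw [hins]
      exact union_subset (partiallyBraided_subset k) hchain
    have hstep := VI.chain (S := S \ {(a j, b j)}) hL hfin (h.genPos.mono hsub) (hins.symm ▸ hd')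
      (fun h' => h'.2 rfl) (fun y hy hv => h.marks hR y hy (verts_mono hsub hv)) (h.nodup_points j)
      ?_ (hfree j) (fun e he => h.free_of_notMem hR (hchain e he) (h.chain_notMem he))
    · have hset : S \ {(a j, b j)} ∪ chain (a j) (points m M X x c g j) (b j) =
          partiallyBraided T a b m M X x c g (k + 1) := by
        ext e
        constructor
        · rintro (⟨⟨heT, he⟩ | ⟨i, hi, he⟩, hej⟩ | he)
          · refine Or.inl ⟨heT, fun i hi => ?_⟩
            rcases (lt_succ_iff_lt_or_eq hk').1 hi with hi | rfl
            · exact he i hi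
            · exact hej
          · exact Or.inr ⟨i, by omega, he⟩
          · exact Or.inr ⟨j, Nat.lt_succ_self k, he⟩
        · rintro (⟨heT, he⟩ | ⟨i, hi, he⟩)
          · exact Or.inl ⟨Or.inl ⟨heT, fun i hi => he i (by omega)⟩, he j (Nat.lt_succ_self k)⟩
          · rcases (lt_succ_iff_lt_or_eq hk').1 hi with hi | rfl
            · refine Or.inl ⟨Or.inr ⟨i, hi, he⟩, ?_⟩
              rintro rfl
              exact h.chain_notMem he (h.mem j)
            · exact Or.inr he
      rw [hins, hset] at hstep
      exact ⟨hstep.1, hiso.trans hstep.2⟩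
    · rw [hins]
      intro P hP hv
      rcases h.verts_partiallyBraided hv with h' | ⟨i, hi, h'⟩
      · exact h.notMem_verts hP h'
      · refine h.notMem_points ?_ hP h'
        rintro rfl
        exact lt_irrefl _ hi

/-- The braid whose closure is the link after all its edges `a j → b j` have been led around. -/
def braid (_ : Layout T a b m M X x c g) (L : Markers) : BraidDrawing n where
  edges := braidEdges T a b m M x c g
  isOver := (draw (partiallyBraided T a b m M X x c g n) L).isOver
  x := x
  bot := m - n - 1
  top := M + n + 1
  right := X + n + 1

omit h in
theorem closingEdge_iff (β : BraidDrawing n) (j : Fin n) (e : Edge) :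
    (∃ i : Fin 5, e = (β.closingCorner j i.castSucc, β.closingCorner j i.succ)) ↔
      e = ((β.x j, β.bot), (β.x j, β.bot - closingOffset j)) ∨
      e = ((β.x j, β.bot - closingOffset j), (β.right + closingOffset j, β.bot - closingOffset j)) ∨
      e = ((β.right + closingOffset j, β.bot - closingOffset j),
        (β.right + closingOffset j, β.top + closingOffset j)) ∨
      e = ((β.right + closingOffset j, β.top + closingOffset j),
        (β.x j, β.top + closingOffset j)) ∨
      e = ((β.x j, β.top + closingOffset j), (β.x j, β.top)) := by
  constructor
  · rintro ⟨i, rfl⟩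
    fin_cases i
    · exact Or.inl rfl
    · exact Or.inr (Or.inl rfl)
    · exact Or.inr (Or.inr (Or.inl rfl))
    · exact Or.inr (Or.inr (Or.inr (Or.inl rfl)))
    · exact Or.inr (Or.inr (Or.inr (Or.inr rfl)))
  · rintro (rfl | rfl | rfl | rfl | rfl)
    exacts [⟨0, rfl⟩, ⟨1, rfl⟩, ⟨2, rfl⟩, ⟨3, rfl⟩, ⟨4, rfl⟩]

/-- Every edge of the closure is an edge of the braid or runs between corners of a closing arc. -/
theorem mem_partiallyBraided_iff (L : Markers) (e : Edge) :
    e ∈ partiallyBraided T a b m M X x c g n ↔ e ∈ braidEdges T a b m M x c g ∨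
      ∃ j, ∃ i : Fin 5,
        e = ((h.braid L).closingCorner j i.castSucc, (h.braid L).closingCorner j i.succ) := by
  have key : ∀ j, e ∈ chain (a j) (points m M X x c g j) (b j) ↔
      (e = (a j, (x j, c j)) ∨ e = ((x j, c j), (x j, m - n - 1)) ∨
      e = ((x j, M + n + 1), (x j, g j)) ∨ e = ((x j, g j), b j)) ∨
      ∃ i : Fin 5,
        e = ((h.braid L).closingCorner j i.castSucc, (h.braid L).closingCorner j i.succ) := by
    intro j
    rw [closingEdge_iff]
    simp only [points, arcCorners, List.cons_append, List.nil_append, chain, mem_insert_iff,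
      mem_singleton_iff, braid]
    constructor
    · rintro (h1 | h1 | h1 | h1 | h1 | h1 | h1 | h1 | h1) <;> simp only [h1, true_or, or_true]
    · rintro ((h1 | h1 | h1 | h1) | (h1 | h1 | h1 | h1 | h1)) <;> simp only [h1, true_or, or_true]
  constructor
  · rintro (⟨heT, he⟩ | ⟨j, -, he⟩)
    · exact Or.inl (Or.inl ⟨heT, fun i => he i i.2⟩)
    · rcases (key j).1 he with h1 | h1
      · exact Or.inl (Or.inr ⟨j, h1⟩)
      · exact Or.inr ⟨j, h1⟩
  · rintro ((⟨heT, he⟩ | ⟨j, he⟩) | ⟨j, he⟩)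
    · exact Or.inl ⟨heT, fun i _ => he i⟩
    · exact Or.inr ⟨j, j.2, (key j).2 (Or.inl he)⟩
    · exact Or.inr ⟨j, j.2, (key j).2 (Or.inr he)⟩

theorem closure_braid (L : Markers) :
    (h.braid L).closure = draw (partiallyBraided T a b m M X x c g n) L := by
  refine Drawing.ext ?_ rfl
  ext e
  exact (h.mem_partiallyBraided_iff L e).symm

/-- Only the two ends of a closing arc lie at the heights of the braid. -/
theorem closingCorner_fst (L : Markers) (j : Fin n) (i : Fin 5)
    (h1 : m - n - 1 ≤ ((h.braid L).closingCorner j i.castSucc).2)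
    (h2 : ((h.braid L).closingCorner j i.castSucc).2 ≤ M + n + 1) :
    (h.braid L).closingCorner j i.castSucc = (x j, m - n - 1) := by
  have ho := (h.bounds j).2.1
  fin_cases i
  · rfl
  · change m - n - 1 ≤ m - n - 1 - closingOffset j at h1
    linarith
  · change m - n - 1 ≤ m - n - 1 - closingOffset j at h1
    linarith
  · change M + n + 1 + closingOffset j ≤ M + n + 1 at h2
    linarith
  · change M + n + 1 + closingOffset j ≤ M + n + 1 at h2
    linarith

theorem closingCorner_snd (L : Markers) (j : Fin n) (i : Fin 5)
    (h1 : m - n - 1 ≤ ((h.braid L).closingCorner j i.succ).2)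
    (h2 : ((h.braid L).closingCorner j i.succ).2 ≤ M + n + 1) :
    (h.braid L).closingCorner j i.succ = (x j, M + n + 1) := by
  have ho := (h.bounds j).2.1
  fin_cases i
  · change m - n - 1 ≤ m - n - 1 - closingOffset j at h1
    linarith
  · change m - n - 1 ≤ m - n - 1 - closingOffset j at h1
    linarith
  · change M + n + 1 + closingOffset j ≤ M + n + 1 at h2
    linarith
  · change M + n + 1 + closingOffset j ≤ M + n + 1 at h2
    linarith
  · rfl

/-- If all other edges of the link descend, the strands form a virtual braid. -/
theorem isVirtualBraid {L : Markers} (hL : Functional L) (hR : Realized T L) (hmM : m < M)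
    (hd : Diag (partiallyBraided T a b m M X x c g n)) (hfree : ∀ j, Free L (a j, b j))
    (hdown : ∀ e ∈ T, (∀ j, e ≠ (a j, b j)) → e.2.2 < e.1.2) : (h.braid L).IsVirtualBraid := by
  have hn : (0 : ℝ) ≤ n := Nat.cast_nonneg n
  have hsub : braidEdges T a b m M x c g ⊆ partiallyBraided T a b m M X x c g n := fun e he =>
    (h.mem_partiallyBraided_iff L e).2 (Or.inl he)
  have hgen := hd.gen.mono hsub
  have hover : ∀ e ∈ partiallyBraided T a b m M X x c g n, ¬ Free L e →
      e ∈ braidEdges T a b m M x c g := by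
    intro e he hef
    have heT : e ∈ T := by
      by_contra heT
      exact hef (h.free_of_notMem hR (partiallyBraided_subset n he) heT)
    exact Or.inl ⟨heT, fun i hi => hef (hi ▸ hfree i)⟩
  have hall : ∀ e ∈ braidEdges T a b m M x c g, e.2.2 < e.1.2 ∧ e.1.2 ≤ M + n + 1 ∧
      m - n - 1 ≤ e.2.2 ∧ e.1.1 < X + n + 1 ∧ e.2.1 < X + n + 1 := by
    rintro e (⟨heT, he⟩ | ⟨j, he⟩)
    · obtain ⟨h1, h2, h3⟩ := h.box _ (fst_mem_verts heT)
      obtain ⟨k1, k2, k3⟩ := h.box _ (snd_mem_verts heT)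
      exact ⟨hdown e heT he, by linarith, by linarith, by linarith, by linarith⟩
    · obtain ⟨h1, h2, h3, h4, h5, h6, h7, h8, -⟩ := h.bounds j
      obtain ⟨k1, k2, k3⟩ := h.box _ (fst_mem_verts (h.mem j))
      obtain ⟨l1, l2, l3⟩ := h.box _ (snd_mem_verts (h.mem j))
      dsimp only at k1 k2 k3 l1 l2 l3
      rcases he with rfl | rfl | rfl | rfl <;>
        refine ⟨?_, ?_, ?_, ?_, ?_⟩ <;> dsimp only <;> linarith
  refine ⟨?_, ?_, ?_, fun e he => (hall e he).1, fun e he => ⟨(hall e he).2.1, (hall e he).2.2.1⟩,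
    fun e he => (hall e he).2.2.2, ?_, ?_, ?_, ?_⟩
  · refine ⟨hgen.finite, hgen.ne, hgen.not_opposite, hgen.vertex, hgen.no_triple, ?_⟩
    intro e f hef
    obtain ⟨he, hf, h1⟩ := (hd.gen.generic hL).isOver_spec e f hef
    obtain ⟨-, -, y, hy, hye, hyf, -⟩ := hef
    exact ⟨hover e he fun h' => h' y hy hye, hover f hf fun h' => h' y hy hyf, h1⟩
  · exact fun i j hij => (h.lt hij).1
  · change m - n - 1 < M + n + 1
    linarith
  · intro j
    refine ⟨(x j, g j), Or.inr ⟨j, Or.inr (Or.inr (Or.inl rfl))⟩, fun w hw => ?_⟩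
    exact congrArg Prod.snd (hd.link.outInj _ (hsub hw)
      ((x j, M + n + 1), (x j, g j)) (hsub (Or.inr ⟨j, Or.inr (Or.inr (Or.inl rfl))⟩)) rfl)
  · intro j
    refine ⟨(x j, c j), Or.inr ⟨j, Or.inr (Or.inl rfl)⟩, fun w hw => ?_⟩
    exact congrArg Prod.fst (hd.link.inInj _ (hsub hw)
      ((x j, c j), (x j, m - n - 1)) (hsub (Or.inr ⟨j, Or.inr (Or.inl rfl)⟩)) rfl)
  · intro e he
    obtain ⟨h1, h2, h3, -⟩ := hall e he
    obtain ⟨f, hf, hfe⟩ := hd.link.succ e (hsub he)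
    rcases (h.mem_partiallyBraided_iff L f).1 hf with hf' | ⟨j, i, rfl⟩
    · left
      refine ⟨f.2, ?_, fun w hw => ?_⟩
      · change (e.2, f.2) ∈ braidEdges T a b m M x c g
        rwa [← hfe]
      · exact congrArg Prod.snd (hd.link.outInj _ (hsub hw) f hf hfe.symm)
    · right
      dsimp only at hfe
      refine ⟨j, hfe.symm.trans (h.closingCorner_fst L j i ?_ ?_)⟩
      · rw [hfe]; exact h3
      · rw [hfe]; linarith
  · intro e he
    obtain ⟨h1, h2, h3, -⟩ := hall e he
    obtain ⟨f, hf, hfe⟩ := hd.link.pred e (hsub he)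
    rcases (h.mem_partiallyBraided_iff L f).1 hf with hf' | ⟨j, i, rfl⟩
    · left
      refine ⟨f.1, ?_, fun w hw => ?_⟩
      · change (f.1, e.1) ∈ braidEdges T a b m M x c g
        rwa [← hfe]
      · exact congrArg Prod.fst (hd.link.inInj _ (hsub hw) f hf hfe.symm)
    · right
      dsimp only at hfe
      refine ⟨j, hfe.symm.trans (h.closingCorner_snd L j i ?_ ?_)⟩
      · rw [hfe]; linarith
      · rw [hfe]; exact h2

end Layout

theorem exists_box {E : Set Plane} (hE : E.Finite) :
    ∃ m M X : ℝ, m < M ∧ ∀ v ∈ E, m < v.2 ∧ v.2 < M ∧ v.1 < X := by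
  obtain ⟨m, hm⟩ := (hE.image Prod.snd).bddBelow
  obtain ⟨M, hM⟩ := (hE.image Prod.snd).bddAbove
  obtain ⟨X, hX⟩ := (hE.image Prod.fst).bddAbove
  refine ⟨min m M - 1, M + 1, X + 1, by linarith [min_le_right m M], fun v hv => ?_⟩
  have h1 : m ≤ v.2 := hm ⟨v, hv, rfl⟩
  have h2 : v.2 ≤ M := hM ⟨v, hv, rfl⟩
  have h3 : v.1 ≤ X := hX ⟨v, hv, rfl⟩
  exact ⟨by linarith [min_le_left m M], by linarith, by linarith⟩

end VirtualLink

theorem theorem1 (D : VirtualLink.Drawing) (hD : D.IsLinkDiagram) :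
    ∃ (n : ℕ) (β : VirtualLink.BraidDrawing n),
      β.IsVirtualBraid ∧ VirtualLink.VirtuallyIsotopic D β.closure := by
  open VirtualLink in
  obtain ⟨L₀, hL₀, hR₀, hDL⟩ := exists_markers hD.generic
  have hd₀ := diag_of_isLinkDiagram hD
  have hfin₀ : L₀.Finite := by
    refine Set.Finite.of_finite_image (f := Prod.fst)
      (hd₀.gen.finite_crossPts.subset ?_) fun m hm m' hm' h => hL₀ m hm m' hm' h
    rintro _ ⟨m, hm, rfl⟩
    obtain ⟨e, he, f, hf, h⟩ := realized_ne hR₀ hm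
    exact ⟨e, he, f, hf, h⟩
  obtain ⟨T, L, hd, hL, hfin, hR, hiso, hdown⟩ := exists_descending _ rfl hd₀ hL₀ hfin₀ hR₀
  obtain ⟨m, M, X, hmM, hbox⟩ := exists_box hd.gen.finite_verts
  have hA : {e ∈ T | ¬ e.2.2 < e.1.2}.Finite := hd.gen.finite.subset (Set.sep_subset _ _)
  obtain ⟨n, f, hf, hfA⟩ := hA.fin_param
  have hfT : ∀ j, f j ∈ T ∧ ¬ (f j).2.2 < (f j).1.2 := fun j => by
    have : f j ∈ {e ∈ T | ¬ e.2.2 < e.1.2} := hfA ▸ Set.mem_range_self j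
    exact this
  obtain ⟨x, c, g, hband, hgen⟩ := exists_strands hd.gen (m := m) (M := M)
    (fun v hv => (hbox v hv).2.2) (a := fun j => (f j).1) (b := fun j => (f j).2)
    (fun j => fst_mem_verts (hfT j).1) (fun j => snd_mem_verts (hfT j).1) Finset.univ
  have h : Layout T (fun j => (f j).1) (fun j => (f j).2) m M X x c g :=
    ⟨hbox, fun j => (hfT j).1, fun i j hij => hf hij, fun j => hband j (Finset.mem_univ j),
      by rwa [Finset.coe_univ] at hgen⟩
  have hfree : ∀ j, Free L ((f j).1, (f j).2) := fun j => by
    by_contra hfree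
    exact (hfT j).2 (hdown _ (hfT j).1 hfree)
  obtain ⟨hd', hiso'⟩ := h.isotopic hd hL hfin hR hfree n le_rfl
  refine ⟨n, h.braid L, h.isVirtualBraid hL hR hmM hd' hfree ?_, ?_⟩
  · intro e he hne
    by_contra hup
    have : e ∈ Set.range f := hfA ▸ ⟨he, hup⟩
    obtain ⟨j, rfl⟩ := this
    exact hne j rfl
  · rw [h.closure_braid, hDL]
    exact Relation.EqvGen.trans _ _ _ hiso hiso'
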